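/- **Theorem (forced Cauchy estimates).** Write $\mathcal F\{f\}(k)=\int_{\mathbb R}e^{-ikx}f(x)\,dx$ for the Fourier transform on tempered distributions, $\|f\|_{H^s(\mathbb R)}=\|(1+k^2)^{s/2}\mathcal F\{f\}\|_{L^2(\mathbb R)}$, and let $H^m(0,T)$ consist of the restrictions to $(0,T)$ of elements of $H^m(\mathbb R)$, with $\|g\|_{H^m(0,T)}=\inf\{\|G\|_{H^m(\mathbb R)}: G|_{(0,T)}=g\}$. Let $\omega(k)=|k|\sqrt{1+k^2}$, let $T>0$, and let $F$ be a forcing term on $\mathbb R\times(0,T)$ in one of the spaces named below. Let $Z=S[0,0;F]$ be the solution of $$Z_{tt}-Z_{xx}+Z_{xxxx}=F,\quad x\in\mathbb R,\ t\in(0,T),\qquad Z(x,0)=Z_t(x,0)=0,$$ given, for $t\in[0,T]$, by $$Z(x,t)=\frac1{2\pi}\int_{\mathbb R}\frac{e^{ikx}}{2i\omega}\Big\{e^{i\omega t}\int_0^te^{-i\omega t'}\mathcal F\{F\}(k,t')\,dt'-e^{-i\omega t}\int_0^te^{i\omega t'}\mathcal F\{F\}(k,t')\,dt'\Big\}dk,$$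 that is, $Z(t)$ is the tempered distribution in $x$ whose Fourier transform is $\frac1{2i\omega}\{\cdots\}$; $\partial_tZ$ is its derivative in $t$ as a tempered distribution in $x$. 1. *Space estimate.* There is a constant $c(T)$, depending only on $T$, such that for all $s\in\mathbb R$ and $F\in L^1_t((0,T);H^{s-2}_x(\mathbb R))$, $$\|Z(t)\|_{H^s_x(\mathbb R)}+\|\partial_tZ(t)\|_{H^{s-2}_x(\mathbb R)}\le c(T)\,\|F\|_{L^1_t((0,T);H^{s-2}_x(\mathbb R))},\qquad t\in[0,T].$$ 2. *Time estimates.* For every $j\in\mathbb N_0$ and $s\in\mathbb R$ there is a constant $c_j(s,T)$, depending only on $j,s,T$, such that for all $x\in\mathbb R$ $$\|\partial_x^jZ(x,\cdot)\|_{H_t^{\frac{2s-2j+1}4}(0,T)}\le c_j(s,T)\begin{cases}\|F\|_{L^1_t((0,T);H^{s-2}_x(\mathbb R))},&-\tfrac12+j\le s\le\tfrac32+j,\\[2pt]\|F\|_{L^2_t((0,T);H^{s-2}_x(\mathbb R))},&\tfrac32+j\le s\le\tfrac72+j,\end{cases}$$ for all $F$ in the space on the right-hand side. Here $x\mapsto\partial_x^jZ(x,\cdot)$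 is the family of distributions on $(0,T)$, continuous in $x\in\mathbb R$, that represents the distribution $\partial_x^jZ$ on $\mathbb R\times(0,T)$; in the stated ranges of $s$ it exists, is unique, and consists of locally integrable functions. -/

import Mathlib

open MeasureTheory Set Complex
open scoped ENNReal NNReal SchwartzMap FourierTransform

noncomputable section

namespace Boussinesq

/-! ### Fourier transform and Sobolev spaces on the line -/

/-- The Fourier transform `(𝓕 φ)(k) = ∫ e^{-ikx} φ(x) dx` on Schwartz functions, obtained from
Mathlib's one (which has `e^{-2πikx}`) by rescaling the frequency; see `fourierSchwartz_apply`. -/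
def fourierSchwartz : 𝓢(ℝ, ℂ) →L[ℂ] 𝓢(ℝ, ℂ) :=
  (SchwartzMap.compCLMOfContinuousLinearEquiv ℂ
    (ContinuousLinearEquiv.smulLeft (R₁ := ℝ) (M₁ := ℝ)
      (Units.mk0 ((2 * Real.pi)⁻¹) (inv_ne_zero Real.two_pi_pos.ne')))).comp
    (FourierTransform.fourierCLM ℂ 𝓢(ℝ, ℂ))

theorem fourierSchwartz_apply (φ : 𝓢(ℝ, ℂ)) (k : ℝ) :
    fourierSchwartz φ k = ∫ x : ℝ, cexp (-(I * k * x)) * φ x := by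
  have h : fourierSchwartz φ k = (𝓕 φ : 𝓢(ℝ, ℂ)) ((2 * Real.pi)⁻¹ * k) := rfl
  rw [h, SchwartzMap.fourier_coe, Real.fourier_real_eq_integral_exp_smul]
  refine integral_congr_ae (Filter.Eventually.of_forall fun x => ?_)
  simp only [smul_eq_mul]
  congr 2
  push_cast
  have : (Real.pi : ℂ) ≠ 0 := by exact_mod_cast Real.pi_ne_zero
  field_simp

/-- The Fourier transform of tempered distributions, `⟨𝓕 f, φ⟩ = ⟨f, 𝓕 φ⟩`. -/
def fourierDist (f : 𝓢'(ℝ, ℂ)) : 𝓢'(ℝ, ℂ) :=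
  PointwiseConvergenceCLM.precomp ℂ fourierSchwartz f

/-- `𝓕 f` is (the tempered distribution given by) the function `g`. -/
def IsFourierDensity (f : 𝓢'(ℝ, ℂ)) (g : ℝ → ℂ) : Prop :=
  ∀ φ : 𝓢(ℝ, ℂ), Integrable (fun k => g k * φ k) ∧ fourierDist f φ = ∫ k, g k * φ k

/-- The norm `‖(1 + k²)^{s/2} 𝓕 f‖_{L²(ℝ)}` of `H^s(ℝ)`, with value `∞` when `f ∉ H^s(ℝ)`.
The density `g` of `𝓕 f` is unique almost everywhere when it exists, so the infimum is the
value at that density, or `∞` when `𝓕 f` is not a function. -/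
def sobolevENorm (s : ℝ) (f : 𝓢'(ℝ, ℂ)) : ℝ≥0∞ :=
  ⨅ (g : ℝ → ℂ) (_ : IsFourierDensity f g),
    eLpNorm (fun k : ℝ => (((1 + k ^ 2) ^ (s / 2) : ℝ) : ℂ) * g k) 2 volume

/-- `φ` is a test function on the open interval `(0, T)`. -/
def IsTestOn (T : ℝ) (φ : 𝓢(ℝ, ℂ)) : Prop :=
  tsupport (φ : ℝ → ℂ) ⊆ Ioo 0 T

/-- The restriction of the tempered distribution `G` to the interval `(0, T)`, as a
distribution there, is the function `v`. -/
def RestrictsTo (T : ℝ) (G : 𝓢'(ℝ, ℂ)) (v : ℝ → ℂ) : Prop :=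
  ∀ φ : 𝓢(ℝ, ℂ), IsTestOn T φ →
    IntegrableOn (fun t => v t * φ t) (Ioo 0 T) ∧ G φ = ∫ t in Ioo 0 T, v t * φ t

/-- The norm of `H^m(0, T)`: the infimum of the `H^m(ℝ)` norms of all extensions, with value `∞`
when there is no extension in `H^m(ℝ)`. It is written for distributions on `(0, T)` that are
functions; for `m ≥ 0` every element of `H^m(0, T)` is one. -/
def sobolevENormOn (m T : ℝ) (v : ℝ → ℂ) : ℝ≥0∞ :=
  ⨅ (G : 𝓢'(ℝ, ℂ)) (_ : RestrictsTo T G v), sobolevENorm m G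

/-! ### Forcing terms: the spaces `L^p((0, T); H^σ(ℝ))` -/

/-- `Fhat k t` is a jointly measurable version of the Fourier transform in `x` of `F(·, t)`,
for almost every `t ∈ (0, T)`. -/
def IsSpatialFourier (T : ℝ) (F : ℝ → 𝓢'(ℝ, ℂ)) (Fhat : ℝ → ℝ → ℂ) : Prop :=
  Measurable (Function.uncurry Fhat) ∧
    ∀ᵐ t ∂(volume.restrict (Ioo 0 T)), IsFourierDensity (F t) (fun k => Fhat k t)

/-- The norm of `L^p((0, T); H^σ(ℝ))`. -/
def bochnerENorm (p : ℝ≥0∞) (σ T : ℝ) (F : ℝ → 𝓢'(ℝ, ℂ)) : ℝ≥0∞ :=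
  eLpNorm (fun t => sobolevENorm σ (F t)) p (volume.restrict (Ioo 0 T))

/-- `F ∈ L^p((0, T); H^σ(ℝ))`. As `H^σ(ℝ)` is isometric, through the Fourier transform, to a
separable weighted `L²` space, strong measurability of `t ↦ F t` is the same as the existence of
a jointly measurable version of the Fourier transform. -/
def MemBochner (p : ℝ≥0∞) (σ T : ℝ) (F : ℝ → 𝓢'(ℝ, ℂ)) : Prop :=
  (∃ Fhat : ℝ → ℝ → ℂ, IsSpatialFourier T F Fhat) ∧ bochnerENorm p σ T F < ∞

/-! ### The forced Cauchy problem with zero data -/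

/-- The dispersion relation `ω(k) = |k| (1 + k²)^{1/2}` for real `k`. -/
def omega (k : ℝ) : ℝ := |k| * Real.sqrt (1 + k ^ 2)

/-- The Fourier transform in `x`, at `k` and at time `t`, of the solution of
`Z_tt - Z_xx + Z_xxxx = F`, `Z(·, 0) = Z_t(·, 0) = 0`:
`(1 / 2iω) { e^{iωt} ∫₀ᵗ e^{-iωt'} 𝓕F(k, t') dt' - e^{-iωt} ∫₀ᵗ e^{iωt'} 𝓕F(k, t') dt' }`.
The value at the single frequency `k = 0` is immaterial. -/
def solutionHat (Fhat : ℝ → ℝ → ℂ) (t k : ℝ) : ℂ :=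
  1 / (2 * I * omega k) *
    (cexp (I * omega k * t) * (∫ t' in (0 : ℝ)..t, cexp (-(I * omega k * t')) * Fhat k t')
      - cexp (-(I * omega k * t)) * ∫ t' in (0 : ℝ)..t, cexp (I * omega k * t') * Fhat k t')

/-- `Z = S[0, 0; F]` on `[0, T]`: for every `t ∈ [0, T]`, `Z t` is the inverse Fourier transform
of `solutionHat`. -/
def IsForcedSolution (T : ℝ) (F Z : ℝ → 𝓢'(ℝ, ℂ)) : Prop :=
  ∃ Fhat : ℝ → ℝ → ℂ, IsSpatialFourier T F Fhat ∧
    ∀ t ∈ Icc 0 T, IsFourierDensity (Z t) (solutionHat Fhat t)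

/-- `Z' = ∂_t Z` on `[0, T]` (one-sided at the end points), as tempered distributions in `x`. -/
def IsTimeDerivative (T : ℝ) (Z Z' : ℝ → 𝓢'(ℝ, ℂ)) : Prop :=
  ∀ t ∈ Icc 0 T, ∀ ψ : 𝓢(ℝ, ℂ),
    HasDerivWithinAt (fun τ => Z τ ψ) (Z' t ψ) (Icc 0 T) t

/-- `v x` is the function `t ↦ ∂_x^j Z(x, t)` on `(0, T)`, for every `x`. The distribution
`∂_x^j Z` on `ℝ × (0, T)` is `v`, where `x ↦ v x` is continuous as a map into the distributions
on `(0, T)`; this determines each `v x` almost everywhere in `(0, T)`, for every single `x`. -/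
def IsTimeTrace (j : ℕ) (T : ℝ) (Z : ℝ → 𝓢'(ℝ, ℂ)) (v : ℝ → ℝ → ℂ) : Prop :=
  (∀ x, LocallyIntegrableOn (v x) (Ioo 0 T)) ∧
  ∀ η : 𝓢(ℝ, ℂ), IsTestOn T η →
    Continuous (fun x => ∫ t in Ioo 0 T, v x t * η t) ∧
    ∀ ψ : 𝓢(ℝ, ℂ), HasCompactSupport (ψ : ℝ → ℂ) →
      ∫ x, (∫ t in Ioo 0 T, v x t * η t) * ψ x =
        (-1) ^ j * ∫ t in Ioo 0 T, Z t ((SchwartzMap.derivCLM ℂ ℂ)^[j] ψ) * η t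

end Boussinesq

end

/-! In Fourier variables the solution is the Duhamel integral of `sinK k (t - a) = sin(ω(t - a))/ω`
against `Fhat k a`. For the space estimate, `(1 + k²)|sinK k τ| ≤ 2T + 2` for `|τ| ≤ T` (small `k`
by `|sin x| ≤ |x|`, large `k` by `ω ≳ 1 + k²`), while the time derivative has kernel `cos`, bounded
by 1. Minkowski's inequality in `L²` concludes (`hatNorm_setIntegral_mul_le`). The weight of order
`s` merely passes through the integral, so the constant depends on `T` alone.

The time estimates are proved by duality. Write a test function on `(0, T)` as `hat f`. Its pairing
with `∂_x^j Z(x, ·)` is `(2π)⁻¹ ∫∫ e^{ikx} (ik)^j Phi(a, k) Fhat(k, a) dk da`, where `Phi` is the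
transposed Duhamel operator applied to `hat f` (`integral_duhamel_mul`). A cutoff equal to 1 up to
time `T` makes this expression meaningful for every Schwartz `f`, and it is unchanged on test
functions supported in `(0, T)`. If it is bounded by `L` times the `H^{-m}` norm of `f`, Riesz
representation produces an element of `H^m(ℝ)` of norm at most `L` that extends the trace
(`TraceBound.exists_extension`). The bound does not see `x`, since `|e^{ikx}| = 1`.

With `m = (2s - 2j + 1)/4`, Cauchy–Schwarz in `k` reduces matters to bounding `∫ (1 + k²)^{5/2 - 2m}
|Phi(a, k)|² dk` by `∫ (1 + x²)^{-m} |f|² dx`. For `m = 0` this is Plancherel after the substitution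
`τ = ω(k)`, whose Jacobian is at least `√(1 + k²)`. For `m = 1`, put `f = (1 - ix)g` and integrate
by parts once; no boundary term survives because the kernel vanishes at time zero. For `m = 2`, put
`f = (1 + x²)g` and integrate by parts twice. Now a boundary value `hat g(a)` remains, which the
`L²` norm controls only after integration in `a`.

This is the source of the two cases. For `0 ≤ m ≤ 1` the bound is uniform in `a` and pairs with `L¹`
forcing in time; for `1 ≤ m ≤ 2` it is an `L²` bound in `a` and pairs with `L²` forcing.
Intermediate `m` come from a quadratic interpolation argument,
`lintegral_rpow_mul_sq_le_of_decomposition`. -/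

noncomputable section

namespace Boussinesq

/-! ### The Fourier transform on Schwartz functions and on `L¹ ∩ L²` -/

/-- The Fourier integral `∫ e^{-itx} f(x) dx`. -/
def hat (f : ℝ → ℂ) (t : ℝ) : ℂ := ∫ x : ℝ, cexp (-(I * t * x)) * f x

theorem fourierSchwartz_eq_hat (φ : 𝓢(ℝ, ℂ)) : ⇑(fourierSchwartz φ) = hat φ :=
  funext fun k => fourierSchwartz_apply φ k

/-- The inverse of `fourierSchwartz`. -/
def fourierSchwartzInv : 𝓢(ℝ, ℂ) →L[ℂ] 𝓢(ℝ, ℂ) :=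
  (FourierTransform.fourierCLE ℂ 𝓢(ℝ, ℂ)).symm.toContinuousLinearMap.comp
    (SchwartzMap.compCLMOfContinuousLinearEquiv ℂ
    (ContinuousLinearEquiv.smulLeft (R₁ := ℝ) (M₁ := ℝ)
      (Units.mk0 (2 * Real.pi) Real.two_pi_pos.ne')))

theorem fourierSchwartz_inv (φ : 𝓢(ℝ, ℂ)) : fourierSchwartz (fourierSchwartzInv φ) = φ := by
  ext k
  have h : fourierSchwartz (fourierSchwartzInv φ) k
      = (𝓕 (fourierSchwartzInv φ) : 𝓢(ℝ, ℂ)) ((2 * Real.pi)⁻¹ * k) := rfl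
  have h2 : (𝓕 (fourierSchwartzInv φ) : 𝓢(ℝ, ℂ)) = (SchwartzMap.compCLMOfContinuousLinearEquiv ℂ
    (ContinuousLinearEquiv.smulLeft (R₁ := ℝ) (M₁ := ℝ)
      (Units.mk0 (2 * Real.pi) Real.two_pi_pos.ne'))) φ :=
    (FourierTransform.fourierCLE ℂ 𝓢(ℝ, ℂ)).apply_symm_apply _
  rw [h, h2]
  change φ (2 * Real.pi * ((2 * Real.pi)⁻¹ * k)) = φ k
  congr 1
  field_simp

theorem fourierSchwartzInv_fourier (φ : 𝓢(ℝ, ℂ)) :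
    fourierSchwartzInv (fourierSchwartz φ) = φ := by
  have h2 : (SchwartzMap.compCLMOfContinuousLinearEquiv ℂ
    (ContinuousLinearEquiv.smulLeft (R₁ := ℝ) (M₁ := ℝ)
      (Units.mk0 (2 * Real.pi) Real.two_pi_pos.ne'))) (fourierSchwartz φ) =
      FourierTransform.fourierCLE ℂ 𝓢(ℝ, ℂ) φ := by
    ext k
    change (𝓕 φ : 𝓢(ℝ, ℂ)) ((2 * Real.pi)⁻¹ * (2 * Real.pi * k)) = (𝓕 φ : 𝓢(ℝ, ℂ)) k
    congr 1
    field_simp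
  unfold fourierSchwartzInv
  rw [ContinuousLinearMap.comp_apply, h2]
  exact (FourierTransform.fourierCLE ℂ 𝓢(ℝ, ℂ)).symm_apply_apply _

theorem fourierSchwartzInv_apply (ψ : 𝓢(ℝ, ℂ)) (k : ℝ) :
    fourierSchwartzInv ψ k = (2 * Real.pi : ℂ)⁻¹ * ∫ x : ℝ, cexp (I * k * x) * ψ x := by
  have h : fourierSchwartzInv ψ k = (𝓕⁻ ((SchwartzMap.compCLMOfContinuousLinearEquiv ℂ
    (ContinuousLinearEquiv.smulLeft (R₁ := ℝ) (M₁ := ℝ)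
      (Units.mk0 (2 * Real.pi) Real.two_pi_pos.ne'))) ψ) : 𝓢(ℝ, ℂ)) k := rfl
  rw [h, SchwartzMap.fourierInv_coe, Real.fourierInv_eq']
  have := Measure.integral_comp_mul_left (fun x : ℝ => cexp (I * k * x) * ψ x) (2 * Real.pi)
  rw [abs_of_pos (by positivity)] at this
  have e : (2 * Real.pi : ℂ)⁻¹ * ∫ x : ℝ, cexp (I * k * x) * ψ x
      = (2 * Real.pi)⁻¹ • ∫ x : ℝ, cexp (I * k * x) * ψ x := by
    rw [Complex.real_smul]; push_cast; rfl
  rw [e, ← this]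
  refine integral_congr_ae (Filter.Eventually.of_forall fun x => ?_)
  simp only [smul_eq_mul]
  congr 1
  congr 1
  simp only [RCLike.inner_apply, conj_trivial]
  push_cast; ring

theorem hat_eq_fourier (f : ℝ → ℂ) (t : ℝ) : hat f t = 𝓕 f ((2 * Real.pi)⁻¹ * t) := by
  rw [hat, Real.fourier_real_eq_integral_exp_smul]
  refine integral_congr_ae (Filter.Eventually.of_forall fun x => ?_)
  simp only [smul_eq_mul]
  congr 2
  push_cast
  have : (Real.pi : ℂ) ≠ 0 := by exact_mod_cast Real.pi_ne_zero
  field_simp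

theorem eLpNorm_two_sq {α : Type*} [MeasurableSpace α] {μ : Measure α} {ε : Type*} [ENorm ε]
    (f : α → ε) : eLpNorm f 2 μ ^ 2 = ∫⁻ x, ‖f x‖ₑ ^ 2 ∂μ := by
  have := eLpNorm_nnreal_pow_eq_lintegral (μ := μ) (f := f) (p := 2) (by norm_num)
  simpa using this

theorem eLpNorm_two_eq {α : Type*} [MeasurableSpace α] {μ : Measure α} {ε : Type*} [ENorm ε]
    (f : α → ε) : eLpNorm f 2 μ = (∫⁻ x, ‖f x‖ₑ ^ 2 ∂μ) ^ (1 / 2 : ℝ) := by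
  rw [← eLpNorm_two_sq, ← ENNReal.rpow_natCast, ← ENNReal.rpow_mul]
  norm_num

theorem continuous_fourier {f : ℝ → ℂ} (hf : Integrable f) : Continuous (𝓕 f) :=
  VectorFourier.fourierIntegral_continuous Real.continuous_fourierChar continuous_inner hf

/-- Both sides are the same distribution: the integral transform is self-adjoint by Fubini, and the
`L²` transform is compatible with that of tempered distributions. Testing against smooth compactly
supported functions identifies them. -/
theorem fourier_ae_eq_Lp_fourier {f : ℝ → ℂ} (hf : Integrable f) (hf2 : MemLp f 2) :
    𝓕 f =ᵐ[volume] (𝓕 (hf2.toLp f) : Lp ℂ 2 (volume : Measure ℝ)) := by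
  have hc : Continuous (𝓕 f) := continuous_fourier hf
  refine ae_eq_of_integral_contDiff_smul_eq hc.locallyIntegrable
    ((Lp.memLp _).locallyIntegrable (by norm_num)) fun g hg hgs => ?_
  let G : 𝓢(ℝ, ℂ) := HasCompactSupport.toSchwartzMap (f := fun x => (g x : ℂ))
    (hgs.comp_left (g := fun x : ℝ => (x : ℂ)) (by simp)) (Complex.ofRealCLM.contDiff.comp hg)
  have hG : ∀ x, G x = (g x : ℂ) := fun x => rfl
  have h1 := congrArg (fun D : 𝓢'(ℝ, ℂ) => D G) (Lp.fourier_toTemperedDistribution_eq (hf2.toLp f))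
  simp only [TemperedDistribution.fourier_apply, Lp.toTemperedDistribution_apply] at h1
  have h2 : ∫ x, 𝓕 f x • G x = ∫ x, f x • (𝓕 G : 𝓢(ℝ, ℂ)) x := by
    have := VectorFourier.integral_fourierIntegral_smul_eq_flip (L := innerₗ ℝ) (μ := volume)
      (ν := volume) (f := f) (g := G)
      Real.continuous_fourierChar continuous_inner hf G.integrable
    have flip : (innerₗ ℝ).flip = innerₗ ℝ := by
      ext; simp
    rw [SchwartzMap.fourier_coe]
    rw [flip] at this
    exact this
  calc ∫ x, g x • 𝓕 f x = ∫ x, 𝓕 f x • G x := by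
        refine integral_congr_ae (Filter.Eventually.of_forall fun x => ?_)
        simp [hG, mul_comm]
    _ = ∫ x, f x • (𝓕 G : 𝓢(ℝ, ℂ)) x := h2
    _ = ∫ x, (𝓕 G : 𝓢(ℝ, ℂ)) x • (hf2.toLp f) x := by
        refine integral_congr_ae ?_
        filter_upwards [hf2.coeFn_toLp] with x hx
        rw [hx, smul_eq_mul, smul_eq_mul, mul_comm]
    _ = _ := h1
    _ = _ := by
        refine integral_congr_ae (Filter.Eventually.of_forall fun x => ?_)
        simp [hG]

theorem lintegral_fourier_sq {f : ℝ → ℂ} (hf : Integrable f) (hf2 : MemLp f 2) :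
    ∫⁻ t, ‖𝓕 f t‖ₑ ^ 2 = ∫⁻ x, ‖f x‖ₑ ^ 2 := by
  rw [← eLpNorm_two_sq, ← eLpNorm_two_sq, eLpNorm_congr_ae (fourier_ae_eq_Lp_fourier hf hf2)]
  have h := Lp.norm_fourier_eq (hf2.toLp f)
  have h2 : ‖(𝓕 (hf2.toLp f) : Lp ℂ 2 (volume : Measure ℝ))‖ₑ = ‖hf2.toLp f‖ₑ := by
    rw [← ofReal_norm, ← ofReal_norm, h]
  rw [← Lp.enorm_def, h2, Lp.enorm_toLp]

theorem lintegral_comp_mul_left_real {c : ℝ} (hc : 0 < c) (f : ℝ → ℝ≥0∞) :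
    ∫⁻ x, f (c * x) = ENNReal.ofReal c⁻¹ * ∫⁻ x, f x := by
  have := Real.map_volume_mul_left hc.ne'
  have e : MeasurableEmbedding (fun x : ℝ => c * x) :=
    (Homeomorph.mulLeft₀ c hc.ne').measurableEmbedding
  rw [← e.lintegral_map, this, lintegral_smul_measure, abs_of_pos (by positivity), smul_eq_mul]

/-- Plancherel's identity. -/
theorem lintegral_hat_sq {f : ℝ → ℂ} (hf : Integrable f) (hf2 : MemLp f 2) :
    ∫⁻ t, ‖hat f t‖ₑ ^ 2 = ENNReal.ofReal (2 * Real.pi) * ∫⁻ x, ‖f x‖ₑ ^ 2 := by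
  simp_rw [hat_eq_fourier]
  rw [lintegral_comp_mul_left_real (c := (2 * Real.pi)⁻¹) (by positivity)
    (fun t => ‖𝓕 f t‖ₑ ^ 2), inv_inv, lintegral_fourier_sq hf hf2]

theorem continuous_hat {f : ℝ → ℂ} (hf : Integrable f) : Continuous (hat f) := by
  have : hat f = fun t => 𝓕 f ((2 * Real.pi)⁻¹ * t) := funext (hat_eq_fourier f)
  rw [this]
  exact (continuous_fourier hf).comp (by fun_prop)

/-! ### Distributions whose Fourier transform is a function -/

theorem exists_schwartz_of_contDiff {g : ℝ → ℝ} (hg : ContDiff ℝ (⊤ : ℕ∞) g)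
    (hgs : HasCompactSupport g) :
    ∃ G : 𝓢(ℝ, ℂ), (∀ x, G x = (g x : ℂ)) ∧ HasCompactSupport (G : ℝ → ℂ) :=
  have h := hgs.comp_left (g := fun x : ℝ => (x : ℂ)) (by simp)
  ⟨HasCompactSupport.toSchwartzMap (f := fun x => (g x : ℂ)) h
    (Complex.ofRealCLM.contDiff.comp hg), fun _ => rfl, h⟩

theorem exists_schwartz_one_on {K : Set ℝ} (hK : IsCompact K) :
    ∃ G : 𝓢(ℝ, ℂ), (∀ x ∈ K, G x = 1) ∧ HasCompactSupport (G : ℝ → ℂ) := by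
  obtain ⟨r, hr, hKr⟩ := hK.isBounded.subset_ball_lt 0 0
  let f : ContDiffBump (0 : ℝ) := ⟨r, r + 1, hr, by linarith⟩
  obtain ⟨G, h1, h2⟩ := exists_schwartz_of_contDiff (g := f) f.contDiff f.hasCompactSupport
  refine ⟨G, fun x hx => ?_, h2⟩
  rw [h1, f.one_of_mem_closedBall (Metric.ball_subset_closedBall (hKr hx))]
  simp

/-- On a compact set, test with a Schwartz function equal to 1 there. -/
theorem locallyIntegrable_of_schwartz {g : ℝ → ℂ}
    (h : ∀ φ : 𝓢(ℝ, ℂ), Integrable (fun k => g k * φ k)) : LocallyIntegrable g := by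
  rw [locallyIntegrable_iff]
  intro K hK
  obtain ⟨G, h1, -⟩ := exists_schwartz_one_on hK
  refine ((h G).integrableOn (s := K)).congr_fun (fun x hx => ?_) hK.measurableSet
  simp [h1 x hx]

/-- Smooth compactly supported functions separate locally integrable functions. This makes the
infimum in `sobolevENorm` an actual value. -/
theorem IsFourierDensity.ae_eq {f : 𝓢'(ℝ, ℂ)} {g h : ℝ → ℂ} (hg : IsFourierDensity f g)
    (hh : IsFourierDensity f h) : g =ᵐ[volume] h := by
  refine ae_eq_of_integral_contDiff_smul_eq (locallyIntegrable_of_schwartz fun φ => (hg φ).1)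
    (locallyIntegrable_of_schwartz fun φ => (hh φ).1) fun u hu hus => ?_
  obtain ⟨G, h1, -⟩ := exists_schwartz_of_contDiff hu hus
  have e : ∀ v : ℝ → ℂ, ∫ x, u x • v x = ∫ x, v x * G x := fun v =>
    integral_congr_ae (Filter.Eventually.of_forall fun x => by simp [h1, mul_comm])
  rw [e, e, ← (hg G).2, ← (hh G).2]

theorem IsFourierDensity.congr_ae {f : 𝓢'(ℝ, ℂ)} {g h : ℝ → ℂ} (hg : IsFourierDensity f g)
    (e : g =ᵐ[volume] h) : IsFourierDensity f h := fun φ => by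
  have e' : (fun k => g k * φ k) =ᵐ[volume] fun k => h k * φ k := by
    filter_upwards [e] with k hk
    rw [hk]
  exact ⟨(hg φ).1.congr e', (hg φ).2.trans (integral_congr_ae e')⟩

theorem sobolevENorm_eq {f : 𝓢'(ℝ, ℂ)} {g : ℝ → ℂ} (hg : IsFourierDensity f g) (s : ℝ) :
    sobolevENorm s f
      = eLpNorm (fun k : ℝ => (((1 + k ^ 2) ^ (s / 2) : ℝ) : ℂ) * g k) 2 volume := by
  refine le_antisymm (iInf₂_le g hg) (le_iInf₂ fun h hh => le_of_eq (eLpNorm_congr_ae ?_))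
  filter_upwards [hg.ae_eq hh] with k hk
  rw [hk]

theorem IsFourierDensity.apply_eq {f : 𝓢'(ℝ, ℂ)} {g : ℝ → ℂ} (hg : IsFourierDensity f g)
    (ψ : 𝓢(ℝ, ℂ)) : f ψ = ∫ k, g k * fourierSchwartzInv ψ k := by
  rw [← (hg _).2]
  change f ψ = f (fourierSchwartz (fourierSchwartzInv ψ))
  rw [fourierSchwartz_inv]

/-! ### Bessel weights and the construction of distributions from weighted densities -/

/-- The Bessel weight `(1 + k²)^a`. -/
def wt (a k : ℝ) : ℝ := (1 + k ^ 2) ^ a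

theorem wt_pos (a k : ℝ) : 0 < wt a k := Real.rpow_pos_of_pos (by positivity) _

theorem wt_add (a b k : ℝ) : wt (a + b) k = wt a k * wt b k :=
  Real.rpow_add (by positivity) _ _

theorem wt_zero (k : ℝ) : wt 0 k = 1 := Real.rpow_zero _

theorem wt_one (k : ℝ) : wt 1 k = 1 + k ^ 2 := Real.rpow_one _

theorem wt_mono {a b : ℝ} (h : a ≤ b) (k : ℝ) : wt a k ≤ wt b k :=
  Real.rpow_le_rpow_of_exponent_le (by nlinarith [sq_nonneg k]) h

theorem hasTemperateGrowth_wt (a : ℝ) :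
    Function.HasTemperateGrowth (fun k : ℝ => (wt a k : ℂ)) := by
  have h := Function.hasTemperateGrowth_one_add_norm_sq_rpow (H := ℝ) a
  have h2 := Complex.ofRealCLM.hasTemperateGrowth.comp h
  convert h2 using 1
  ext k
  simp [wt]

theorem continuous_wt (a : ℝ) : Continuous (wt a) := by
  unfold wt
  exact Continuous.rpow_const (by fun_prop) fun x => Or.inl (by positivity)

/-- Multiplication of Schwartz functions by the weight. -/
def wtMul (a : ℝ) : 𝓢(ℝ, ℂ) →L[ℂ] 𝓢(ℝ, ℂ) :=
  SchwartzMap.smulLeftCLM ℂ (fun k : ℝ => (wt a k : ℂ))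

theorem wtMul_apply (a : ℝ) (φ : 𝓢(ℝ, ℂ)) (k : ℝ) : wtMul a φ k = wt a k * φ k := by
  rw [wtMul, SchwartzMap.smulLeftCLM_apply_apply (hasTemperateGrowth_wt a), smul_eq_mul]

/-- For general `a` the function `g` need not be square integrable, so the weight is moved: `wt a *
g` acts as an `L²` distribution on test functions premultiplied by `wt (-a)`. -/
theorem exists_isFourierDensity {a : ℝ} {g : ℝ → ℂ}
    (hg : MemLp (fun k => (wt a k : ℂ) * g k) 2) : ∃ f : 𝓢'(ℝ, ℂ), IsFourierDensity f g := by
  have e : ∀ (φ : 𝓢(ℝ, ℂ)) (k : ℝ), g k * φ k = wtMul (-a) φ k * ((wt a k : ℂ) * g k) := by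
    intro φ k
    rw [wtMul_apply]
    have : (wt (-a) k : ℂ) * wt a k = 1 := by
      rw [← Complex.ofReal_mul, ← wt_add, neg_add_cancel, wt_zero, Complex.ofReal_one]
    linear_combination (g k * φ k) * (-this)
  refine ⟨PointwiseConvergenceCLM.precomp ℂ ((wtMul (-a)).comp fourierSchwartzInv)
    (Lp.toTemperedDistribution (hg.toLp _)), fun φ => ⟨?_, ?_⟩⟩
  · simp_rw [e]
    exact MemLp.integrable_mul (p := 2) (q := 2) ((wtMul (-a) φ).memLp 2) hg
  · change (Lp.toTemperedDistribution (hg.toLp _))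
      (wtMul (-a) (fourierSchwartzInv (fourierSchwartz φ))) = _
    rw [fourierSchwartzInv_fourier, Lp.toTemperedDistribution_apply]
    refine integral_congr_ae ?_
    filter_upwards [hg.coeFn_toLp] with k hk
    rw [hk, smul_eq_mul, e]

/-! ### Duality, interpolation and integral inequalities -/

/-- Riesz representation for functionals on a space of functions bounded by an `L²` seminorm. -/
theorem exists_memLp_repr {V : Type*} [AddCommGroup V] [Module ℂ V] (ι : V →ₗ[ℂ] ℝ → ℂ)
    (hι : ∀ φ, MemLp (ι φ) 2) (L : V →ₗ[ℂ] ℂ) (C : ℝ≥0)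
    (hL : ∀ φ, ‖L φ‖ₑ ≤ C * eLpNorm (ι φ) 2 volume) :
    ∃ h : ℝ → ℂ, MemLp h 2 ∧ eLpNorm h 2 volume ≤ C ∧ ∀ φ, L φ = ∫ x, h x * ι φ x := by
  let J : V →ₗ[ℂ] Lp ℂ 2 (volume : Measure ℝ) :=
    { toFun := fun φ => (hι φ).toLp
      map_add' := fun φ ψ => by
        rw [← MemLp.toLp_add]
        exact MemLp.toLp_congr _ _ (by rw [map_add])
      map_smul' := fun c φ => by
        rw [RingHom.id_apply, ← MemLp.toLp_const_smul]
        exact MemLp.toLp_congr _ _ (by rw [map_smul]) }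
  have hJ : ∀ φ, ‖L φ‖ ≤ C * ‖J φ‖ := fun φ => by
    have h := hL φ
    rw [← Lp.enorm_toLp (hf := hι φ)] at h
    rw [← ofReal_norm, ← ofReal_norm, ← ENNReal.ofReal_coe_nnreal,
      ← ENNReal.ofReal_mul (by positivity)] at h
    exact (ENNReal.ofReal_le_ofReal_iff (by positivity)).1 h
  -- The map to `L²` need not be injective, but the bound kills `L` on its kernel. So `L` descends
  -- to the range, where it is bounded and extends by Hahn–Banach.
  have hker : LinearMap.ker J ≤ LinearMap.ker L := fun φ hφ => by
    have h0 : J φ = 0 := hφ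
    have := hJ φ
    rw [h0, norm_zero, mul_zero] at this
    exact norm_le_zero_iff.1 this
  let ℓ : LinearMap.range J →ₗ[ℂ] ℂ :=
    ((LinearMap.ker J).liftQ L hker).comp J.quotKerEquivRange.symm.toLinearMap
  have hℓ : ∀ φ, ℓ ⟨J φ, LinearMap.mem_range_self J φ⟩ = L φ := fun φ => by
    have : J.quotKerEquivRange.symm ⟨J φ, LinearMap.mem_range_self J φ⟩
        = (LinearMap.ker J).mkQ φ := J.quotKerEquivRange_symm_apply_image φ _
    simp only [ℓ, LinearMap.comp_apply, LinearEquiv.coe_coe, this]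
    exact Submodule.liftQ_apply _ _ _
  let ℓc : StrongDual ℂ (LinearMap.range J) := ℓ.mkContinuous C (by
    rintro ⟨_, φ, rfl⟩
    rw [hℓ]
    exact hJ φ)
  obtain ⟨Λ, hΛ, hΛn⟩ := exists_extension_norm_eq _ ℓc
  let y : Lp ℂ 2 (volume : Measure ℝ) := (InnerProductSpace.toDual ℂ _).symm Λ
  have hy : ‖y‖ ≤ C := by
    rw [LinearIsometryEquiv.norm_map, hΛn]
    exact LinearMap.mkContinuous_norm_le _ (by positivity) _
  -- The pairing in the conclusion is bilinear, whereas the inner product is conjugate linear in the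
  -- Riesz vector; hence the conjugate.
  have hym : MemLp (fun x => (starRingEnd ℂ) (y x)) 2 volume := (Lp.memLp y).star
  refine ⟨fun x => (starRingEnd ℂ) (y x), hym, ?_, fun φ => ?_⟩
  · have e : eLpNorm (fun x => (starRingEnd ℂ) (y x)) 2 volume = eLpNorm y 2 volume :=
      eLpNorm_congr_norm_ae (Filter.Eventually.of_forall fun x => by simp)
    rw [e, ← Lp.enorm_def, ← ofReal_norm, ← ENNReal.ofReal_coe_nnreal]
    exact ENNReal.ofReal_le_ofReal hy
  · have h1 : L φ = Λ (J φ) := by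
      rw [hΛ ⟨J φ, LinearMap.mem_range_self J φ⟩, ← hℓ φ]
      rfl
    rw [h1, ← InnerProductSpace.toDual_symm_apply (𝕜 := ℂ), L2.inner_def]
    refine integral_congr_ae ?_
    filter_upwards [(hι φ).coeFn_toLp] with x hx
    have hx' : (J φ) x = ι φ x := hx
    rw [hx', RCLike.inner_apply, mul_comm]

section Lintegral

variable {α : Type*} [MeasurableSpace α] {μ : Measure α}

theorem lintegral_mul_le_sqrt {f g : α → ℝ≥0∞} (hf : AEMeasurable f μ) (hg : AEMeasurable g μ) :
    ∫⁻ a, f a * g a ∂μ ≤ (∫⁻ a, f a ^ 2 ∂μ) ^ (1 / 2 : ℝ) * (∫⁻ a, g a ^ 2 ∂μ) ^ (1 / 2 : ℝ) := by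
  have := ENNReal.lintegral_mul_le_Lp_mul_Lq μ Real.HolderConjugate.two_two hf hg
  simpa using this

theorem sq_lintegral_mul_le {f g : α → ℝ≥0∞} (hf : AEMeasurable f μ) (hg : AEMeasurable g μ) :
    (∫⁻ a, f a * g a ∂μ) ^ 2 ≤ (∫⁻ a, f a ^ 2 ∂μ) * ∫⁻ a, g a ^ 2 ∂μ := by
  refine (pow_le_pow_left' (lintegral_mul_le_sqrt hf hg) 2).trans (le_of_eq ?_)
  rw [mul_pow, ← ENNReal.rpow_natCast, ← ENNReal.rpow_natCast, ← ENNReal.rpow_mul,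
    ← ENNReal.rpow_mul]
  norm_num

theorem sqrt_sq_ennreal (a : ℝ≥0∞) : (a ^ (1 / 2 : ℝ)) ^ 2 = a := by
  rw [← ENNReal.rpow_natCast, ← ENNReal.rpow_mul]
  norm_num

theorem sq_sqrt_ennreal (a : ℝ≥0∞) : (a ^ 2) ^ (1 / 2 : ℝ) = a := by
  rw [← ENNReal.rpow_natCast, ← ENNReal.rpow_mul]
  norm_num

/-- Minkowski's integral inequality in `L²`. -/
theorem lintegral_sq_lintegral_le {β : Type*} [MeasurableSpace β] {ν : Measure β} [SFinite μ]
    [SFinite ν] {h : α → β → ℝ≥0∞} (hh : Measurable (Function.uncurry h)) :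
    ∫⁻ a, (∫⁻ b, h a b ∂ν) ^ 2 ∂μ ≤ (∫⁻ b, (∫⁻ a, h a b ^ 2 ∂μ) ^ (1 / 2 : ℝ) ∂ν) ^ 2 := by
  have h1 : ∀ a, Measurable (h a) := fun a => hh.of_uncurry_left
  have h2 : ∀ b, Measurable fun a => h a b := fun b => hh.of_uncurry_right
  set H : β → ℝ≥0∞ := fun b => (∫⁻ a, h a b ^ 2 ∂μ) ^ (1 / 2 : ℝ) with hH
  have hHm : Measurable H := by
    refine Measurable.pow_const ?_ _
    exact Measurable.lintegral_prod_left' (f := fun p : α × β => h p.1 p.2 ^ 2) (hh.pow_const 2)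
  have hm : Measurable fun p : α × β => h p.1 p.2 := hh
  -- The square becomes a double integral over `b` and `c`. Tonelli moves the `a` integral
  -- innermost, and Cauchy–Schwarz there splits it as `H b * H c`.
  calc ∫⁻ a, (∫⁻ b, h a b ∂ν) ^ 2 ∂μ
      = ∫⁻ a, ∫⁻ b, ∫⁻ c, h a b * h a c ∂ν ∂ν ∂μ := by
        refine lintegral_congr fun a => ?_
        rw [sq, ← lintegral_mul_const _ (h1 a)]
        exact lintegral_congr fun b => (lintegral_const_mul _ (h1 a)).symm
    _ = ∫⁻ b, ∫⁻ a, ∫⁻ c, h a b * h a c ∂ν ∂μ ∂ν := by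
        rw [lintegral_lintegral_swap]
        refine Measurable.aemeasurable ?_
        refine Measurable.lintegral_prod_right' (f := fun q : (α × β) × β =>
          h q.1.1 q.1.2 * h q.1.1 q.2) ?_
        exact (hm.comp measurable_fst).mul
          (hm.comp ((measurable_fst.comp measurable_fst).prodMk measurable_snd))
    _ = ∫⁻ b, ∫⁻ c, ∫⁻ a, h a b * h a c ∂μ ∂ν ∂ν := by
        refine lintegral_congr fun b => ?_
        rw [lintegral_lintegral_swap]
        exact (((h2 b).comp measurable_fst).mul hm).aemeasurable
    _ ≤ ∫⁻ b, ∫⁻ c, H b * H c ∂ν ∂ν :=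
        lintegral_mono fun b => lintegral_mono fun c =>
          lintegral_mul_le_sqrt (h2 b).aemeasurable (h2 c).aemeasurable
    _ = (∫⁻ b, H b ∂ν) ^ 2 := by
        rw [sq, ← lintegral_mul_const _ hHm]
        exact lintegral_congr fun b => lintegral_const_mul _ hHm

end Lintegral

/-! ### Quadratic interpolation of weighted `L²` bounds -/

/-- The constant in the integral representation of `x ^ θ`. -/
theorem exists_rpow_eq_lintegral {θ : ℝ} (hθ : θ ∈ Ioo (0 : ℝ) 1) :
    ∃ c : ℝ≥0∞, ∀ x : ℝ, 0 ≤ x → ENNReal.ofReal (x ^ θ)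
      = c * ∫⁻ t in Ioi (0 : ℝ), ENNReal.ofReal (t ^ (θ - 1)) * ENNReal.ofReal (x / (x + t)) := by
  refine ⟨ENNReal.ofReal (∫ t in Ioi 0, Real.rpowIntegrand₀₁ θ t 1)⁻¹, fun x hx => ?_⟩
  have hpos := Real.integral_rpowIntegrand₀₁_one_pos hθ
  rw [Real.rpow_eq_const_mul_integral hθ hx, ENNReal.ofReal_mul (by positivity),
    ofReal_integral_eq_lintegral_ofReal (Real.integrableOn_rpowIntegrand₀₁_Ioi hθ hx)]
  · congr 1
    refine setLIntegral_congr_fun measurableSet_Ioi fun t ht => ?_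
    have ht' : (0 : ℝ) < t := ht
    rw [Real.rpowIntegrand₀₁_eq_pow_div hθ ht'.le hx, ← ENNReal.ofReal_mul (by positivity),
      mul_div_assoc, add_comm x t]
  · filter_upwards [ae_restrict_mem measurableSet_Ioi] with t ht
    exact Real.rpowIntegrand₀₁_nonneg hθ.1 (le_of_lt ht) hx

theorem enorm_sq_eq_ofReal (z : ℂ) : ‖z‖ₑ ^ 2 = ENNReal.ofReal (‖z‖ ^ 2) := by
  rw [← ofReal_norm, ENNReal.ofReal_pow (norm_nonneg _)]

/-- The factor `P / (P + t)` is the minimum of `|a|² + (P/t)|b|²` over all splittings of a unit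
vector as `a + b`; the defect is a perfect square. -/
theorem enorm_add_sq_le_of_pos {a b : ℂ} {P t : ℝ} (hP : 0 < P) (ht : 0 < t) :
    ENNReal.ofReal (P / (P + t)) * ‖a + b‖ₑ ^ 2
      ≤ ‖a‖ₑ ^ 2 + ENNReal.ofReal t⁻¹ * (ENNReal.ofReal P * ‖b‖ₑ ^ 2) := by
  simp only [enorm_sq_eq_ofReal]
  rw [← ENNReal.ofReal_mul (by positivity), ← ENNReal.ofReal_mul (by positivity),
    ← ENNReal.ofReal_mul (by positivity), ← ENNReal.ofReal_add (by positivity) (by positivity)]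
  refine ENNReal.ofReal_le_ofReal ?_
  have h1 : ‖a + b‖ ^ 2 ≤ (‖a‖ + ‖b‖) ^ 2 := by gcongr; exact norm_add_le a b
  calc P / (P + t) * ‖a + b‖ ^ 2 ≤ P / (P + t) * (‖a‖ + ‖b‖) ^ 2 := by gcongr
    _ ≤ ‖a‖ ^ 2 + t⁻¹ * (P * ‖b‖ ^ 2) := by
      rw [div_mul_eq_mul_div, div_le_iff₀ (by positivity)]
      have : (‖a‖ ^ 2 + t⁻¹ * (P * ‖b‖ ^ 2)) * (P + t) - P * (‖a‖ + ‖b‖) ^ 2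
          = t⁻¹ * (t * ‖a‖ - P * ‖b‖) ^ 2 := by
        field_simp
        ring
      nlinarith [mul_nonneg (inv_nonneg.2 ht.le) (sq_nonneg (t * ‖a‖ - P * ‖b‖))]

theorem lintegral_rpow_mul_sq_eq {γ : Type*} [MeasurableSpace γ] (ρ : Measure γ) [SFinite ρ]
    {θ : ℝ} {c : ℝ≥0∞} (hc : ∀ x : ℝ, 0 ≤ x → ENNReal.ofReal (x ^ θ)
      = c * ∫⁻ t in Ioi (0 : ℝ), ENNReal.ofReal (t ^ (θ - 1)) * ENNReal.ofReal (x / (x + t)))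
    {R : γ → ℝ} {u : γ → ℂ} (hR : Measurable R) (hR0 : ∀ x, 0 < R x) (hu : Measurable u) :
    ∫⁻ a, ENNReal.ofReal (R a ^ θ) * ‖u a‖ₑ ^ 2 ∂ρ
      = c * ∫⁻ t in Ioi (0 : ℝ), ENNReal.ofReal (t ^ (θ - 1)) *
        ∫⁻ a, ENNReal.ofReal (R a / (R a + t)) * ‖u a‖ₑ ^ 2 ∂ρ := by
  have m1 : Measurable fun p : ℝ × γ => ENNReal.ofReal (p.1 ^ (θ - 1)) *
      (ENNReal.ofReal (R p.2 / (R p.2 + p.1)) * ‖u p.2‖ₑ ^ 2) := by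
    have : Measurable fun p : ℝ × γ => R p.2 := hR.comp measurable_snd
    have hu' : Measurable fun p : ℝ × γ => u p.2 := hu.comp measurable_snd
    exact ((measurable_fst.pow_const _).ennreal_ofReal).mul
      (((this.div (this.add measurable_fst)).ennreal_ofReal).mul (hu'.enorm.pow_const 2))
  have e1 : ∀ a, ENNReal.ofReal (R a ^ θ) * ‖u a‖ₑ ^ 2
      = c * ∫⁻ t in Ioi (0 : ℝ), ENNReal.ofReal (t ^ (θ - 1)) *
        (ENNReal.ofReal (R a / (R a + t)) * ‖u a‖ₑ ^ 2) := by
    intro a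
    rw [hc _ (hR0 a).le, mul_assoc, ← lintegral_mul_const]
    · congr 1
      exact lintegral_congr fun t => mul_assoc _ _ _
    · fun_prop
  simp_rw [e1]
  rw [lintegral_const_mul, lintegral_lintegral_swap]
  · congr 1
    refine lintegral_congr fun t => lintegral_const_mul' _ _ ENNReal.ofReal_ne_top
  · exact (m1.comp measurable_swap).aemeasurable
  · exact Measurable.lintegral_prod_left' (μ := volume.restrict (Ioi (0 : ℝ))) m1

/-- Quadratic interpolation between two weighted `L²` bounds. `U = U₀ + U₁` is a decomposition of
the image of `f` under a linear map, that corresponds to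
`f = Q / (Q + t) f + t / (Q + t) f`. -/
theorem lintegral_rpow_mul_sq_le_of_decomposition {α β : Type*} [MeasurableSpace α]
    [MeasurableSpace β] {μ : Measure α} {ν : Measure β} [SFinite μ] [SFinite ν] {θ : ℝ}
    (hθ : θ ∈ Ioo (0 : ℝ) 1) {P : α → ℝ} {Q : β → ℝ} (hPm : Measurable P) (hQm : Measurable Q)
    (hP : ∀ a, 0 < P a) (hQ : ∀ b, 0 < Q b) {U : α → ℂ} (hU : Measurable U) {f : β → ℂ}
    (hf : Measurable f) {K : ℝ≥0∞}
    (h : ∀ t : ℝ, 0 < t → ∃ U₀ U₁ : α → ℂ, Measurable U₀ ∧ (∀ᵐ a ∂μ, U a = U₀ a + U₁ a) ∧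
      ∫⁻ a, ‖U₀ a‖ₑ ^ 2 ∂μ ≤ K * ∫⁻ b, ‖((Q b / (Q b + t) : ℝ) : ℂ) * f b‖ₑ ^ 2 ∂ν ∧
      ∫⁻ a, ENNReal.ofReal (P a) * ‖U₁ a‖ₑ ^ 2 ∂μ
        ≤ K * ∫⁻ b, ENNReal.ofReal (Q b) * ‖((t / (Q b + t) : ℝ) : ℂ) * f b‖ₑ ^ 2 ∂ν) :
    ∫⁻ a, ENNReal.ofReal (P a ^ θ) * ‖U a‖ₑ ^ 2 ∂μ
      ≤ K * ∫⁻ b, ENNReal.ofReal (Q b ^ θ) * ‖f b‖ₑ ^ 2 ∂ν := by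
  -- For fixed `t` the given splitting of `f` is the optimal one, so the right side collapses
  -- exactly: `(Q/(Q+t))² + t⁻¹ Q (t/(Q+t))² = Q/(Q+t)`. On the left any splitting gives an
  -- inequality in the right direction.
  have key : ∀ t : ℝ, 0 < t → ∫⁻ a, ENNReal.ofReal (P a / (P a + t)) * ‖U a‖ₑ ^ 2 ∂μ
      ≤ K * ∫⁻ b, ENNReal.ofReal (Q b / (Q b + t)) * ‖f b‖ₑ ^ 2 ∂ν := by
    intro t ht
    obtain ⟨U₀, U₁, hm, hU01, h0, h1⟩ := h t ht
    calc ∫⁻ a, ENNReal.ofReal (P a / (P a + t)) * ‖U a‖ₑ ^ 2 ∂μ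
        ≤ ∫⁻ a, ‖U₀ a‖ₑ ^ 2 + ENNReal.ofReal t⁻¹ * (ENNReal.ofReal (P a) * ‖U₁ a‖ₑ ^ 2) ∂μ := by
          refine lintegral_mono_ae ?_
          filter_upwards [hU01] with a ha
          rw [ha]
          exact enorm_add_sq_le_of_pos (hP a) ht
      _ = ∫⁻ a, ‖U₀ a‖ₑ ^ 2 ∂μ
          + ENNReal.ofReal t⁻¹ * ∫⁻ a, ENNReal.ofReal (P a) * ‖U₁ a‖ₑ ^ 2 ∂μ := by
          rw [lintegral_add_left (hm.enorm.pow_const 2),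
            lintegral_const_mul' _ _ ENNReal.ofReal_ne_top]
      _ ≤ K * ∫⁻ b, ‖((Q b / (Q b + t) : ℝ) : ℂ) * f b‖ₑ ^ 2 ∂ν + ENNReal.ofReal t⁻¹ *
          (K * ∫⁻ b, ENNReal.ofReal (Q b) * ‖((t / (Q b + t) : ℝ) : ℂ) * f b‖ₑ ^ 2 ∂ν) := by
          gcongr
      _ = K * ∫⁻ b, (‖((Q b / (Q b + t) : ℝ) : ℂ) * f b‖ₑ ^ 2 + ENNReal.ofReal t⁻¹ *
          (ENNReal.ofReal (Q b) * ‖((t / (Q b + t) : ℝ) : ℂ) * f b‖ₑ ^ 2)) ∂ν := by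
          rw [lintegral_add_left, lintegral_const_mul' _ _ ENNReal.ofReal_ne_top]
          · ring
          · refine Measurable.pow_const (Measurable.enorm ?_) 2
            exact (Complex.measurable_ofReal.comp (hQm.div (hQm.add_const t))).mul hf
      _ = K * ∫⁻ b, ENNReal.ofReal (Q b / (Q b + t)) * ‖f b‖ₑ ^ 2 ∂ν := by
          congr 1
          refine lintegral_congr fun b => ?_
          have hb := hQ b
          simp only [enorm_sq_eq_ofReal, norm_mul, mul_pow, Complex.norm_real, Real.norm_eq_abs,
            sq_abs]
          rw [← ENNReal.ofReal_mul (by positivity), ← ENNReal.ofReal_mul (by positivity),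
            ← ENNReal.ofReal_mul (by positivity), ← ENNReal.ofReal_add (by positivity)
            (by positivity)]
          congr 1
          field_simp
  obtain ⟨c, hc⟩ := exists_rpow_eq_lintegral hθ
  rw [lintegral_rpow_mul_sq_eq μ hc hPm hP hU, lintegral_rpow_mul_sq_eq ν hc hQm hQ hf, mul_left_comm K]
  refine mul_le_mul_right ?_ c
  rw [← lintegral_const_mul]
  · refine lintegral_mono_ae ?_
    filter_upwards [ae_restrict_mem measurableSet_Ioi] with t ht
    rw [mul_left_comm]
    exact mul_le_mul_right (key t ht) _
  · refine Measurable.mul (by fun_prop) ?_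
    have : Measurable fun p : ℝ × β => ENNReal.ofReal (Q p.2 / (Q p.2 + p.1)) * ‖f p.2‖ₑ ^ 2 := by
      have h1 : Measurable fun p : ℝ × β => Q p.2 := hQm.comp measurable_snd
      have h2 : Measurable fun p : ℝ × β => f p.2 := hf.comp measurable_snd
      exact ((h1.div (h1.add measurable_fst)).ennreal_ofReal).mul (h2.enorm.pow_const 2)
    exact this.lintegral_prod_right'

/-! ### The dispersion relation as a change of variables -/

theorem omega_nonneg (k : ℝ) : 0 ≤ omega k := by unfold omega; positivity

theorem omega_pos {k : ℝ} (hk : k ≠ 0) : 0 < omega k := by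
  unfold omega
  have := abs_pos.2 hk
  positivity

theorem continuous_omega : Continuous omega := by unfold omega; fun_prop

theorem omega_sq (k : ℝ) : omega k ^ 2 = k ^ 2 * (1 + k ^ 2) := by
  rw [omega, mul_pow, sq_abs, Real.sq_sqrt (by positivity)]

theorem omega_neg (k : ℝ) : omega (-k) = omega k := by simp [omega]

theorem wt_half (k : ℝ) : wt (1 / 2) k = Real.sqrt (1 + k ^ 2) := by
  rw [wt, Real.sqrt_eq_rpow]

theorem wt_neg_arg (a k : ℝ) : wt a (-k) = wt a k := by simp [wt]

theorem measurable_wt (a : ℝ) : Measurable (wt a) := (continuous_wt a).measurable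

theorem hasDerivAt_omega {k : ℝ} (hk : 0 < k) :
    HasDerivAt omega (Real.sqrt (1 + k ^ 2) + k * (k / Real.sqrt (1 + k ^ 2))) k := by
  have h1 : HasDerivAt (fun x : ℝ => 1 + x ^ 2) (2 * k) k := by
    simpa using (hasDerivAt_pow 2 k).const_add 1
  have h2 := (hasDerivAt_id k).mul (h1.sqrt (by positivity))
  have e : (fun x : ℝ => x * Real.sqrt (1 + x ^ 2)) =ᶠ[nhds k] omega := by
    filter_upwards [lt_mem_nhds hk] with x hx
    rw [omega, abs_of_pos hx]
  refine (h2.congr_of_eventuallyEq ?_).congr_deriv ?_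
  · exact e.symm
  · simp only [id_eq, one_mul]
    congr 2
    field_simp

theorem injOn_omega : InjOn omega (Ioi 0) := by
  refine StrictMonoOn.injOn fun x hx y hy hxy => ?_
  have hx' : 0 < x := hx
  have hy' : 0 < y := hy
  rw [omega, omega, abs_of_pos hx', abs_of_pos hy']
  have : Real.sqrt (1 + x ^ 2) < Real.sqrt (1 + y ^ 2) :=
    Real.sqrt_lt_sqrt (by positivity) (by nlinarith)
  have h0 : 0 < Real.sqrt (1 + x ^ 2) := by positivity
  nlinarith

/-- On `k > 0` the derivative of `omega` dominates `√(1 + k²)`, so this is a change of variables.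
Evenness of `omega` handles `k < 0` and accounts for the factor 2. -/
theorem lintegral_comp_omega_le {G : ℝ → ℝ≥0∞} :
    ∫⁻ k, ENNReal.ofReal (wt (1 / 2) k) * G (omega k) ≤ 2 * ∫⁻ τ, G τ := by
  have hpos : ∫⁻ k in Ioi 0, ENNReal.ofReal (wt (1 / 2) k) * G (omega k) ≤ ∫⁻ τ, G τ := by
    calc ∫⁻ k in Ioi 0, ENNReal.ofReal (wt (1 / 2) k) * G (omega k)
        ≤ ∫⁻ k in Ioi 0, ENNReal.ofReal
            |Real.sqrt (1 + k ^ 2) + k * (k / Real.sqrt (1 + k ^ 2))| * G (omega k) := by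
          refine lintegral_mono fun k => ?_
          dsimp only
          gcongr
          rw [wt_half]
          refine le_trans ?_ (le_abs_self _)
          have : 0 ≤ k * (k / Real.sqrt (1 + k ^ 2)) := by
            rw [← mul_div_assoc, ← sq]; positivity
          linarith
      _ = ∫⁻ τ in omega '' Ioi 0, G τ :=
          (lintegral_image_eq_lintegral_abs_deriv_mul measurableSet_Ioi
            (fun k hk => (hasDerivAt_omega hk).hasDerivWithinAt) injOn_omega G).symm
      _ ≤ ∫⁻ τ, G τ := setLIntegral_le_lintegral _ _
  have hneg : ∫⁻ k in Iic 0, ENNReal.ofReal (wt (1 / 2) k) * G (omega k) ≤ ∫⁻ τ, G τ := by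
    have e : MeasurePreserving (fun x : ℝ => -x) volume volume := Measure.measurePreserving_neg _
    have := (e.setLIntegral_comp_preimage_emb (MeasurableEquiv.neg ℝ).measurableEmbedding
      (fun k => ENNReal.ofReal (wt (1 / 2) k) * G (omega k)) (Iic 0))
    rw [← this]
    simp only [wt_neg_arg, omega_neg, Set.neg_preimage, Set.neg_Iic, neg_zero]
    rw [setLIntegral_congr Ioi_ae_eq_Ici.symm]
    exact hpos
  rw [← lintegral_add_compl _ (measurableSet_Ioi (a := (0 : ℝ))), compl_Ioi, two_mul]
  exact add_le_add hpos hneg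

/-! ### Oscillatory integrals over an interval -/

/-- The kernel `sin(ωτ) / ω` of the forced problem. -/
def sinK (k τ : ℝ) : ℝ := Real.sin (omega k * τ) / omega k

/-- `∫_a^b sin(ω(t - a)) / ω ψ(t) dt`. -/
def sinT (ψ : ℝ → ℂ) (a b k : ℝ) : ℂ := ∫ t in Ioc a b, (sinK k (t - a) : ℂ) * ψ t

/-- `∫_a^b cos(ω(t - a)) ψ(t) dt`. -/
def cosT (ψ : ℝ → ℂ) (a b k : ℝ) : ℂ := ∫ t in Ioc a b, (Real.cos (omega k * (t - a)) : ℂ) * ψ t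

theorem measurable_sinK : Measurable fun p : ℝ × ℝ => sinK p.1 p.2 := by
  unfold sinK
  have := continuous_omega.measurable
  fun_prop

theorem continuous_sinK (k : ℝ) : Continuous (sinK k) := by
  unfold sinK; fun_prop

theorem abs_sinK_le (k τ : ℝ) : |sinK k τ| ≤ |τ| := by
  by_cases hk : k = 0
  · simp [sinK, hk, omega]
  have h := omega_pos hk
  rw [sinK, abs_div, abs_of_pos h, div_le_iff₀ h]
  refine Real.abs_sin_le_abs.trans_eq ?_
  rw [abs_mul, abs_of_pos h, mul_comm]

/-- This holds at `k = 0` too: division by zero makes `sinK 0` vanish, and so does the sine. -/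
theorem sinK_mul_omega (k τ : ℝ) : omega k * sinK k τ = Real.sin (omega k * τ) := by
  by_cases hk : k = 0
  · simp [sinK, hk, omega]
  have h := omega_pos hk
  rw [sinK]; field_simp

theorem measurable_sinT {ψ : ℝ → ℂ} (hψ : Measurable ψ) (b : ℝ) :
    Measurable fun p : ℝ × ℝ => sinT ψ p.1 b p.2 := by
  -- The variable lower limit is moved into an indicator, so that measurability of integrals
  -- depending on a parameter applies.
  have e : ∀ p : ℝ × ℝ, sinT ψ p.1 b p.2 = ∫ t, {q : (ℝ × ℝ) × ℝ | q.1.1 < q.2 ∧ q.2 ≤ b}.indicator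
      (fun q => (sinK q.1.2 (q.2 - q.1.1) : ℂ) * ψ q.2) (p, t) := by
    intro p
    rw [sinT, ← integral_indicator measurableSet_Ioc]
    rfl
  simp_rw [e]
  refine (StronglyMeasurable.integral_prod_right (f := fun (p : ℝ × ℝ) (t : ℝ) =>
    {q : (ℝ × ℝ) × ℝ | q.1.1 < q.2 ∧ q.2 ≤ b}.indicator
      (fun q => (sinK q.1.2 (q.2 - q.1.1) : ℂ) * ψ q.2) (p, t)) (ν := volume) ?_).measurable
  refine Measurable.stronglyMeasurable ?_
  refine Measurable.indicator ?_ ?_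
  · have h1 : Measurable fun q : (ℝ × ℝ) × ℝ => sinK q.1.2 (q.2 - q.1.1) :=
      measurable_sinK.comp (g := fun p : ℝ × ℝ => sinK p.1 p.2)
        (f := fun q : (ℝ × ℝ) × ℝ => (q.1.2, q.2 - q.1.1)) (by fun_prop)
    fun_prop
  · exact (measurableSet_lt (measurable_fst.comp measurable_fst) measurable_snd).inter
      (measurableSet_le measurable_snd measurable_const)

theorem measurable_sinT_right {ψ : ℝ → ℂ} (hψ : Measurable ψ) (a b : ℝ) :
    Measurable (sinT ψ a b) :=
  (measurable_sinT hψ b).comp (g := fun p : ℝ × ℝ => sinT ψ p.1 b p.2) measurable_prodMk_left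

theorem memLp_indicator_Ioc {ψ : ℝ → ℂ} (hψ : Continuous ψ) (a b : ℝ) (p : ℝ≥0∞) :
    MemLp ((Ioc a b).indicator ψ) p := by
  rw [memLp_indicator_iff_restrict measurableSet_Ioc]
  obtain ⟨C, hC⟩ := isCompact_Icc.exists_bound_of_continuousOn (s := Icc a b) hψ.continuousOn
  refine MemLp.of_bound hψ.aestronglyMeasurable C ?_
  filter_upwards [ae_restrict_mem measurableSet_Ioc] with t ht
  exact hC t (Ioc_subset_Icc_self ht)

theorem hat_indicator {ψ : ℝ → ℂ} (a b τ : ℝ) :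
    hat ((Ioc a b).indicator ψ) τ = ∫ t in Ioc a b, cexp (-(I * τ * t)) * ψ t := by
  rw [hat, ← integral_indicator measurableSet_Ioc]
  congr 1
  ext t
  by_cases h : t ∈ Ioc a b <;> simp [h]

theorem lintegral_hat_indicator_sq {ψ : ℝ → ℂ} (hψ : Continuous ψ) (a b : ℝ) :
    ∫⁻ τ, ‖hat ((Ioc a b).indicator ψ) τ‖ₑ ^ 2
      = ENNReal.ofReal (2 * Real.pi) * ∫⁻ t in Ioc a b, ‖ψ t‖ₑ ^ 2 := by
  rw [lintegral_hat_sq (memLp_one_iff_integrable.1 (memLp_indicator_Ioc hψ a b 1))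
    (memLp_indicator_Ioc hψ a b 2), ← lintegral_indicator measurableSet_Ioc]
  congr 1
  refine lintegral_congr fun t => ?_
  by_cases h : t ∈ Ioc a b <;> simp [h]

theorem integrableOn_Ioc_of_continuous {ψ : ℝ → ℂ} (hψ : Continuous ψ) (a b : ℝ) :
    IntegrableOn ψ (Ioc a b) :=
  (hψ.continuousOn.integrableOn_Icc).mono_set Ioc_subset_Icc_self

theorem cosT_eq {ψ : ℝ → ℂ} (hψ : Continuous ψ) (a b k : ℝ) :
    cosT ψ a b k = (1 / 2) * (cexp (I * omega k * a) * hat ((Ioc a b).indicator ψ) (omega k)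
      + cexp (-(I * omega k * a)) * hat ((Ioc a b).indicator ψ) (-omega k)) := by
  rw [hat_indicator, hat_indicator, cosT, ← integral_const_mul, ← integral_const_mul,
    ← integral_add, ← integral_const_mul]
  · refine integral_congr_ae (Filter.Eventually.of_forall fun t => ?_)
    simp only
    rw [Complex.ofReal_cos, Complex.cos, ← mul_assoc, ← mul_assoc, ← Complex.exp_add,
      ← Complex.exp_add]
    have e1 : (((omega k * (t - a) : ℝ) : ℂ) * I) = -(I * omega k * a) + -(I * (-omega k : ℝ) * t) := by
      push_cast; ring
    have e2 : (-((omega k * (t - a) : ℝ) : ℂ) * I) = I * omega k * a + -(I * omega k * t) := by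
      push_cast; ring
    rw [e1, e2]
    ring
  · exact integrableOn_Ioc_of_continuous (by fun_prop) a b
  · exact integrableOn_Ioc_of_continuous (by fun_prop) a b

theorem omega_mul_sinT_eq {ψ : ℝ → ℂ} (hψ : Continuous ψ) (a b k : ℝ) :
    omega k * sinT ψ a b k = (I / 2) * (cexp (I * omega k * a) *
      hat ((Ioc a b).indicator ψ) (omega k)
      - cexp (-(I * omega k * a)) * hat ((Ioc a b).indicator ψ) (-omega k)) := by
  rw [hat_indicator, hat_indicator, sinT, ← integral_const_mul, ← integral_const_mul,
    ← integral_const_mul, ← integral_sub, ← integral_const_mul]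
  · refine integral_congr_ae (Filter.Eventually.of_forall fun t => ?_)
    simp only
    rw [← mul_assoc, ← Complex.ofReal_mul, sinK_mul_omega,
      Complex.ofReal_sin, Complex.sin, ← mul_assoc, ← mul_assoc, ← Complex.exp_add,
      ← Complex.exp_add]
    have e1 : (((omega k * (t - a) : ℝ) : ℂ) * I) = -(I * omega k * a) + -(I * (-omega k : ℝ) * t) := by
      push_cast; ring
    have e2 : (-((omega k * (t - a) : ℝ) : ℂ) * I) = I * omega k * a + -(I * omega k * t) := by
      push_cast; ring
    rw [e1, e2]
    ring
  · exact integrableOn_Ioc_of_continuous (by fun_prop) a b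
  · exact integrableOn_Ioc_of_continuous (by fun_prop) a b

theorem norm_cexp_I_mul (x y : ℝ) : ‖cexp (I * x * y)‖ = 1 := by
  rw [show I * x * y = ((x * y : ℝ) : ℂ) * I by push_cast; ring, Complex.norm_exp_ofReal_mul_I]

theorem norm_cexp_neg_I_mul (x y : ℝ) : ‖cexp (-(I * x * y))‖ = 1 := by
  rw [show -(I * x * y) = ((-(x * y) : ℝ) : ℂ) * I by push_cast; ring,
    Complex.norm_exp_ofReal_mul_I]

theorem enorm_add_sq_le (z w : ℂ) : ‖z + w‖ₑ ^ 2 ≤ 2 * (‖z‖ₑ ^ 2 + ‖w‖ₑ ^ 2) := by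
  simp only [enorm_sq_eq_ofReal]
  rw [← ENNReal.ofReal_add (by positivity) (by positivity), ← ENNReal.ofReal_ofNat,
    ← ENNReal.ofReal_mul (by positivity)]
  refine ENNReal.ofReal_le_ofReal ?_
  have := norm_add_le z w
  nlinarith [sq_nonneg (‖z‖ - ‖w‖), norm_nonneg z, norm_nonneg w, norm_nonneg (z + w)]

theorem enorm_half_mul_sq_le {c z w : ℂ} (hc : ‖c‖ = 1 / 2) :
    ‖c * (z + w)‖ₑ ^ 2 ≤ ‖z‖ₑ ^ 2 + ‖w‖ₑ ^ 2 := by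
  simp only [enorm_sq_eq_ofReal]
  rw [← ENNReal.ofReal_add (by positivity) (by positivity)]
  refine ENNReal.ofReal_le_ofReal ?_
  rw [norm_mul, hc]
  have := norm_add_le z w
  nlinarith [sq_nonneg (‖z‖ - ‖w‖), norm_nonneg z, norm_nonneg w, norm_nonneg (z + w)]

/-- Change of variables followed by Plancherel. The constant `8π` is `2 · 2 · 2π`: two signs of the
frequency, the factor 2 of `lintegral_comp_omega_le`, and the `2π` of Plancherel. -/
theorem lintegral_wt_half_mul_le {ψ : ℝ → ℂ} (hψ : Continuous ψ) (a b : ℝ) {V : ℝ → ℂ}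
    (hV : ∀ k, ‖V k‖ₑ ^ 2 ≤ ‖hat ((Ioc a b).indicator ψ) (omega k)‖ₑ ^ 2
      + ‖hat ((Ioc a b).indicator ψ) (-omega k)‖ₑ ^ 2) :
    ∫⁻ k, ENNReal.ofReal (wt (1 / 2) k) * ‖V k‖ₑ ^ 2
      ≤ ENNReal.ofReal (8 * Real.pi) * ∫⁻ t in Ioc a b, ‖ψ t‖ₑ ^ 2 := by
  set H := hat ((Ioc a b).indicator ψ) with hH
  have hHc : Continuous H :=
    continuous_hat (memLp_one_iff_integrable.1 (memLp_indicator_Ioc hψ a b 1))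
  have hHi := lintegral_hat_indicator_sq hψ a b
  rw [← hH] at hHi
  calc ∫⁻ k, ENNReal.ofReal (wt (1 / 2) k) * ‖V k‖ₑ ^ 2
      ≤ ∫⁻ k, (ENNReal.ofReal (wt (1 / 2) k) * ‖H (omega k)‖ₑ ^ 2
        + ENNReal.ofReal (wt (1 / 2) k) * ‖H (-omega k)‖ₑ ^ 2) := by
        refine lintegral_mono fun k => ?_
        rw [← mul_add]
        exact mul_le_mul_right (hV k) _
    _ = (∫⁻ k, ENNReal.ofReal (wt (1 / 2) k) * ‖H (omega k)‖ₑ ^ 2)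
        + ∫⁻ k, ENNReal.ofReal (wt (1 / 2) k) * ‖H (-omega k)‖ₑ ^ 2 := by
        refine lintegral_add_left ?_ _
        exact ((measurable_wt _).ennreal_ofReal).mul
          (((hHc.comp continuous_omega).measurable.enorm).pow_const 2)
    _ ≤ 2 * (∫⁻ τ, ‖H τ‖ₑ ^ 2) + 2 * ∫⁻ τ, ‖H (-τ)‖ₑ ^ 2 :=
        add_le_add (lintegral_comp_omega_le (G := fun τ => ‖H τ‖ₑ ^ 2))
          (lintegral_comp_omega_le (G := fun τ => ‖H (-τ)‖ₑ ^ 2))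
    _ = _ := by
        rw [lintegral_neg_eq_self (fun τ => ‖H τ‖ₑ ^ 2), hHi, ← two_mul, ← mul_assoc, ← mul_assoc]
        congr 1
        rw [← ENNReal.ofReal_ofNat, ← ENNReal.ofReal_mul (by positivity),
          ← ENNReal.ofReal_mul (by positivity)]
        congr 1; ring

theorem lintegral_cosT_le {ψ : ℝ → ℂ} (hψ : Continuous ψ) (a b : ℝ) :
    ∫⁻ k, ENNReal.ofReal (wt (1 / 2) k) * ‖cosT ψ a b k‖ₑ ^ 2
      ≤ ENNReal.ofReal (8 * Real.pi) * ∫⁻ t in Ioc a b, ‖ψ t‖ₑ ^ 2 := by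
  refine lintegral_wt_half_mul_le hψ a b fun k => ?_
  rw [cosT_eq hψ]
  refine (enorm_half_mul_sq_le (by simp)).trans_eq ?_
  simp only [enorm_sq_eq_ofReal, norm_mul, norm_cexp_I_mul, norm_cexp_neg_I_mul, one_mul]

theorem lintegral_omega_mul_sinT_le {ψ : ℝ → ℂ} (hψ : Continuous ψ) (a b : ℝ) :
    ∫⁻ k, ENNReal.ofReal (wt (1 / 2) k) * ‖omega k * sinT ψ a b k‖ₑ ^ 2
      ≤ ENNReal.ofReal (8 * Real.pi) * ∫⁻ t in Ioc a b, ‖ψ t‖ₑ ^ 2 := by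
  refine lintegral_wt_half_mul_le hψ a b fun k => ?_
  rw [omega_mul_sinT_eq hψ, sub_eq_add_neg]
  refine (enorm_half_mul_sq_le (by simp)).trans_eq ?_
  simp only [enorm_sq_eq_ofReal, norm_neg, norm_mul, norm_cexp_I_mul, norm_cexp_neg_I_mul, one_mul]

/-- `|sinK k τ| ≤ |τ|` and Cauchy–Schwarz in time. This serves near `k = 0`, where the bound on
`omega k * sinT` gives no control after division by `omega k`. -/
theorem enorm_sinT_sq_le {ψ : ℝ → ℂ} (hψ : Continuous ψ) {a b : ℝ} (hab : a ≤ b) (k : ℝ) :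
    ‖sinT ψ a b k‖ₑ ^ 2 ≤ ENNReal.ofReal ((b - a) ^ 3) * ∫⁻ t in Ioc a b, ‖ψ t‖ₑ ^ 2 := by
  have h0 : 0 ≤ b - a := sub_nonneg.2 hab
  calc ‖sinT ψ a b k‖ₑ ^ 2
      ≤ (∫⁻ t in Ioc a b, ‖(sinK k (t - a) : ℂ) * ψ t‖ₑ) ^ 2 := by
        gcongr; exact enorm_integral_le_lintegral_enorm _
    _ ≤ (∫⁻ t in Ioc a b, ENNReal.ofReal (b - a) * ‖ψ t‖ₑ) ^ 2 := by
        gcongr 1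
        refine setLIntegral_mono' measurableSet_Ioc fun t ht => ?_
        rw [enorm_mul]
        gcongr
        rw [← ofReal_norm, Complex.norm_real, Real.norm_eq_abs]
        refine ENNReal.ofReal_le_ofReal ((abs_sinK_le _ _).trans ?_)
        rw [abs_of_nonneg (by linarith [ht.1])]
        linarith [ht.2]
    _ ≤ (∫⁻ t in Ioc a b, ENNReal.ofReal (b - a) ^ 2) * ∫⁻ t in Ioc a b, ‖ψ t‖ₑ ^ 2 :=
        sq_lintegral_mul_le (by fun_prop) (hψ.measurable.enorm.aemeasurable)
    _ = _ := by
        rw [setLIntegral_const, Real.volume_Ioc, ← ENNReal.ofReal_pow h0,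
          ← ENNReal.ofReal_mul (by positivity)]
        ring_nf

theorem wt_two (k : ℝ) : wt 2 k = (1 + k ^ 2) ^ 2 := by
  rw [wt]; exact_mod_cast Real.rpow_natCast _ 2

theorem wt_five_half (k : ℝ) : wt (5 / 2) k = wt (1 / 2) k * (1 + k ^ 2) ^ 2 := by
  rw [← wt_two, ← wt_add]; norm_num

/-- For `|k| > 1`, `(1 + k²)² ≤ 4ω²` turns the bound on `omega k * sinT` into a gain of two powers
of the weight. On `[-1, 1]` the weight is at most 8 and the pointwise bound is integrated over
length 2. -/
theorem lintegral_sinT_le {ψ : ℝ → ℂ} (hψ : Continuous ψ) {a b : ℝ} (hab : a ≤ b) :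
    ∫⁻ k, ENNReal.ofReal (wt (5 / 2) k) * ‖sinT ψ a b k‖ₑ ^ 2
      ≤ ENNReal.ofReal (32 * Real.pi + 16 * (b - a) ^ 3) * ∫⁻ t in Ioc a b, ‖ψ t‖ₑ ^ 2 := by
  have h0 : 0 ≤ b - a := sub_nonneg.2 hab
  have hp : ∀ k, ENNReal.ofReal (wt (5 / 2) k) * ‖sinT ψ a b k‖ₑ ^ 2 ≤
      ENNReal.ofReal 4 * (ENNReal.ofReal (wt (1 / 2) k) * ‖omega k * sinT ψ a b k‖ₑ ^ 2)
      + (Icc (-1 : ℝ) 1).indicator (fun _ => ENNReal.ofReal (8 * (b - a) ^ 3) *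
          ∫⁻ t in Ioc a b, ‖ψ t‖ₑ ^ 2) k := by
    intro k
    have hw := (wt_pos (1 / 2) k).le
    by_cases hk : k ∈ Icc (-1 : ℝ) 1
    · rw [indicator_of_mem hk]
      refine le_trans ?_ le_add_self
      have hk2 : k ^ 2 ≤ 1 := by nlinarith [hk.1, hk.2]
      have h8 : wt (5 / 2) k ≤ 8 := by
        have : wt (1 / 2) k ≤ 2 := by
          rw [wt_half]
          exact Real.sqrt_le_iff.2 ⟨by norm_num, by nlinarith⟩
        rw [wt_five_half]
        nlinarith [sq_nonneg k, mul_le_mul this (show (1 + k ^ 2) ^ 2 ≤ 4 by nlinarith [sq_nonneg k])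
          (by positivity) (by norm_num)]
      calc _ ≤ ENNReal.ofReal 8 * (ENNReal.ofReal ((b - a) ^ 3) *
            ∫⁻ t in Ioc a b, ‖ψ t‖ₑ ^ 2) := by
            gcongr
            exact enorm_sinT_sq_le hψ hab k
        _ = _ := by rw [← mul_assoc, ← ENNReal.ofReal_mul (by positivity)]
    · rw [indicator_of_notMem hk, add_zero]
      have hk2 : 1 ≤ k ^ 2 := by
        by_contra h
        have := abs_lt_of_sq_lt_sq (a := k) (b := 1) (by linarith) (by norm_num)
        exact hk ⟨(abs_lt.1 this).1.le, (abs_lt.1 this).2.le⟩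
      simp only [enorm_sq_eq_ofReal]
      rw [← ENNReal.ofReal_mul (wt_pos _ _).le, ← ENNReal.ofReal_mul hw,
        ← ENNReal.ofReal_mul (by norm_num)]
      refine ENNReal.ofReal_le_ofReal ?_
      rw [wt_five_half, norm_mul, mul_pow, Complex.norm_real, Real.norm_eq_abs, sq_abs, omega_sq]
      have : (1 + k ^ 2) ^ 2 ≤ 4 * (k ^ 2 * (1 + k ^ 2)) := by nlinarith
      have h2 : 0 ≤ wt (1 / 2) k * ‖sinT ψ a b k‖ ^ 2 := by positivity
      nlinarith [mul_le_mul_of_nonneg_left this h2]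
  calc _ ≤ _ := lintegral_mono hp
    _ = ENNReal.ofReal 4 * (∫⁻ k, ENNReal.ofReal (wt (1 / 2) k) * ‖omega k * sinT ψ a b k‖ₑ ^ 2)
        + ENNReal.ofReal (8 * (b - a) ^ 3) * (∫⁻ t in Ioc a b, ‖ψ t‖ₑ ^ 2) * ENNReal.ofReal 2 := by
        rw [lintegral_add_right, lintegral_const_mul' _ _ ENNReal.ofReal_ne_top,
          lintegral_indicator_const measurableSet_Icc, Real.volume_Icc,
          show (1 : ℝ) - -1 = 2 by norm_num]
        · exact measurable_const.indicator measurableSet_Icc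
    _ ≤ ENNReal.ofReal 4 * (ENNReal.ofReal (8 * Real.pi) * ∫⁻ t in Ioc a b, ‖ψ t‖ₑ ^ 2)
        + ENNReal.ofReal (8 * (b - a) ^ 3) * (∫⁻ t in Ioc a b, ‖ψ t‖ₑ ^ 2) * ENNReal.ofReal 2 := by
        gcongr
        exact lintegral_omega_mul_sinT_le hψ a b
    _ = _ := by
        rw [mul_right_comm, ← mul_assoc, ← ENNReal.ofReal_mul (by positivity),
          ← ENNReal.ofReal_mul (by positivity), ← add_mul,
          ← ENNReal.ofReal_add (by positivity) (by positivity)]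
        congr 2
        ring

/-! ### Integration by parts -/

/-- The boundary term at `a` vanishes with the kernel, the one at `b` with `p`. The frequency zero
is excluded because there `sinK` is 0 by convention and its derivative is not the cosine. -/
theorem sinT_deriv {p p' : ℝ → ℂ} (hp : ∀ t, HasDerivAt p (p' t) t) (hp' : Continuous p')
    {a b k : ℝ} (hab : a ≤ b) (hb : p b = 0) (hk : k ≠ 0) :
    sinT p' a b k = - cosT p a b k := by
  have hpc : Continuous p := continuous_iff_continuousAt.2 fun t => (hp t).continuousAt
  have hd : ∀ t, HasDerivAt (fun t => (sinK k (t - a) : ℂ) * p t)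
      ((Real.cos (omega k * (t - a)) : ℂ) * p t + (sinK k (t - a) : ℂ) * p' t) t := by
    intro t
    have h1 : HasDerivAt (fun t => sinK k (t - a)) (Real.cos (omega k * (t - a))) t := by
      have := (((hasDerivAt_id t).sub_const a).const_mul (omega k)).sin.div_const (omega k)
      refine this.congr_deriv ?_
      have := (omega_pos hk).ne'
      simp only [id_eq]
      field_simp
    exact h1.ofReal_comp.mul (hp t)
  have hs := continuous_sinK k
  have h := intervalIntegral.integral_eq_sub_of_hasDerivAt (a := a) (b := b) (fun t _ => hd t)
    (by apply Continuous.intervalIntegrable; fun_prop)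
  rw [hb, mul_zero, sub_self, show sinK k 0 = 0 by simp [sinK], intervalIntegral.integral_of_le hab,
    integral_add (integrableOn_Ioc_of_continuous (by fun_prop) a b)
    (integrableOn_Ioc_of_continuous (by fun_prop) a b)] at h
  simp only [Complex.ofReal_zero, zero_mul, sub_zero] at h
  exact eq_neg_of_add_eq_zero_right h

/-- Here the boundary value `p a` survives, as the cosine is 1 at time zero. It is this term that
later requires integration in `a`. -/
theorem cosT_deriv {p p' : ℝ → ℂ} (hp : ∀ t, HasDerivAt p (p' t) t) (hp' : Continuous p')
    {a b : ℝ} (hab : a ≤ b) (hb : p b = 0) (k : ℝ) :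
    cosT p' a b k = - p a + omega k ^ 2 * sinT p a b k := by
  have hpc : Continuous p := continuous_iff_continuousAt.2 fun t => (hp t).continuousAt
  have hd : ∀ t, HasDerivAt (fun t => (Real.cos (omega k * (t - a)) : ℂ) * p t)
      (-((omega k ^ 2 : ℂ) * ((sinK k (t - a) : ℂ) * p t))
        + (Real.cos (omega k * (t - a)) : ℂ) * p' t) t := by
    intro t
    have h1 : HasDerivAt (fun t => Real.cos (omega k * (t - a)))
        (-(omega k ^ 2 * sinK k (t - a))) t := by
      have := (((hasDerivAt_id t).sub_const a).const_mul (omega k)).cos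
      refine this.congr_deriv ?_
      simp only [id_eq]
      rw [← sinK_mul_omega]
      ring
    refine (h1.ofReal_comp.mul (hp t)).congr_deriv ?_
    push_cast
    ring
  have hs := continuous_sinK k
  have h := intervalIntegral.integral_eq_sub_of_hasDerivAt (a := a) (b := b) (fun t _ => hd t)
    (by apply Continuous.intervalIntegrable; fun_prop)
  rw [hb, mul_zero, sub_self, mul_zero, Real.cos_zero, intervalIntegral.integral_of_le hab,
    integral_add (integrableOn_Ioc_of_continuous (by fun_prop) a b)
    (integrableOn_Ioc_of_continuous (by fun_prop) a b), integral_neg, integral_const_mul] at h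
  rw [cosT, sinT]
  rw [Complex.ofReal_one] at h
  linear_combination h

theorem sinT_add {p q : ℝ → ℂ} (hp : Continuous p) (hq : Continuous q) (a b k : ℝ) :
    sinT (fun t => p t + q t) a b k = sinT p a b k + sinT q a b k := by
  have hs := continuous_sinK k
  rw [sinT, sinT, sinT, ← integral_add (integrableOn_Ioc_of_continuous (by fun_prop) a b)
    (integrableOn_Ioc_of_continuous (by fun_prop) a b)]
  simp_rw [mul_add]

theorem cosT_add {p q : ℝ → ℂ} (hp : Continuous p) (hq : Continuous q) (a b k : ℝ) :
    cosT (fun t => p t + q t) a b k = cosT p a b k + cosT q a b k := by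
  rw [cosT, cosT, cosT, ← integral_add (integrableOn_Ioc_of_continuous (by fun_prop) a b)
    (integrableOn_Ioc_of_continuous (by fun_prop) a b)]
  simp_rw [mul_add]

theorem hasDerivAt_hat {g : ℝ → ℂ} (hg : Integrable g) (hg' : Integrable fun x : ℝ => x * g x)
    (t : ℝ) : HasDerivAt (hat g) (hat (fun x : ℝ => -(I * x) * g x) t) t := by
  have h1 := Real.hasDerivAt_fourier hg (by simpa using hg') ((2 * Real.pi)⁻¹ * t)
  have h2 : HasDerivAt (fun t : ℝ => (2 * Real.pi)⁻¹ * t) (2 * Real.pi)⁻¹ t := by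
    simpa using (hasDerivAt_id t).const_mul (2 * Real.pi)⁻¹
  have h3 := h1.scomp t h2
  have e : hat g = (𝓕 g) ∘ fun t : ℝ => (2 * Real.pi)⁻¹ * t := funext (hat_eq_fourier g)
  rw [e]
  refine h3.congr_deriv ?_
  rw [hat_eq_fourier, Real.fourier_real_eq_integral_exp_smul,
    Real.fourier_real_eq_integral_exp_smul, ← integral_smul]
  refine integral_congr_ae (Filter.Eventually.of_forall fun x => ?_)
  simp only [smul_eq_mul, Complex.real_smul]
  have : (Real.pi : ℂ) ≠ 0 := by exact_mod_cast Real.pi_ne_zero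
  push_cast
  field_simp

/-! ### The time integral of the kernel against a Fourier integral -/

/-- A cutoff function equal to `1` on `(-∞, T]` that vanishes near `T + 2`, with its first two
derivatives. -/
structure Cutoff (T : ℝ) where
  /-- The cutoff function. -/
  χ : ℝ → ℂ
  /-- Its first derivative. -/
  χ' : ℝ → ℂ
  /-- Its second derivative. -/
  χ'' : ℝ → ℂ
  hasDerivAt : ∀ t, HasDerivAt χ (χ' t) t
  hasDerivAt' : ∀ t, HasDerivAt χ' (χ'' t) t
  continuous'' : Continuous χ''
  eq_one : ∀ t ≤ T, χ t = 1
  eq_zero : χ (T + 2) = 0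
  eq_zero' : χ' (T + 2) = 0

theorem nonempty_cutoff (T : ℝ) : Nonempty (Cutoff T) := by
  -- The transition takes place on `[T, T + 1]`, so `T + 2` has a whole neighbourhood on which `u`
  -- vanishes, and the derivative vanishes there as well.
  let u : ℝ → ℝ := fun t => Real.smoothTransition (T + 1 - t)
  have hu : ContDiff ℝ (⊤ : ℕ∞) u := Real.smoothTransition.contDiff.comp (by fun_prop)
  have hu1 : ContDiff ℝ (⊤ : ℕ∞) (deriv u) := (contDiff_infty_iff_deriv.1 hu).2
  have hu2 : ContDiff ℝ (⊤ : ℕ∞) (deriv (deriv u)) := (contDiff_infty_iff_deriv.1 hu1).2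
  have h0 : u =ᶠ[nhds (T + 2)] fun _ => 0 := by
    filter_upwards [lt_mem_nhds (show T + 1 < T + 2 by linarith)] with t ht
    exact Real.smoothTransition.zero_of_nonpos (by linarith)
  refine ⟨⟨fun t => ofReal (u t), fun t => ofReal (deriv u t), fun t => ofReal (deriv (deriv u) t), fun t => ?_, fun t => ?_,
    ?_, fun t ht => ?_, ?_, ?_⟩⟩
  · exact ((hu.differentiable (by simp)) t).hasDerivAt.ofReal_comp
  · exact ((hu1.differentiable (by simp)) t).hasDerivAt.ofReal_comp
  · exact Complex.continuous_ofReal.comp hu2.continuous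
  · simp only [u]
    rw [Real.smoothTransition.one_of_one_le (by linarith), Complex.ofReal_one]
  · rw [h0.eq_of_nhds, Complex.ofReal_zero]
  · rw [h0.deriv_eq, deriv_const, Complex.ofReal_zero]

namespace Cutoff

variable {T : ℝ} (c : Cutoff T)

theorem continuous : Continuous c.χ :=
  continuous_iff_continuousAt.2 fun t => (c.hasDerivAt t).continuousAt

theorem continuous' : Continuous c.χ' :=
  continuous_iff_continuousAt.2 fun t => (c.hasDerivAt' t).continuousAt

end Cutoff

theorem lintegral_wt_lt_top {a : ℝ} (ha : a ≤ -1) : ∫⁻ k, ENNReal.ofReal (wt a k) < ∞ := by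
  have h := integrable_inv_one_add_sq.lintegral_lt_top
  refine lt_of_le_of_lt (lintegral_mono fun k => ENNReal.ofReal_le_ofReal ?_) h
  refine (wt_mono ha k).trans_eq ?_
  rw [wt, Real.rpow_neg_one]

theorem measurable_wt_mul_sq (a : ℝ) {V : ℝ → ℂ} (hV : Measurable V) :
    Measurable fun k => ENNReal.ofReal (wt a k) * ‖V k‖ₑ ^ 2 :=
  ((measurable_wt _).ennreal_ofReal).mul (hV.enorm.pow_const 2)

/-- To be used with `q` the cutoff and its first two derivatives. The constant is uniform in the
starting time `a`, and the right sides are integrals over the whole line so that Plancherel applies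
to `ψ = hat g`. -/
theorem exists_cutoff_bound {T : ℝ} (hT : 0 < T) {q : ℝ → ℂ} (hq : Continuous q) :
    ∃ K : ℝ≥0, ∀ (ψ : ℝ → ℂ), Continuous ψ → ∀ a ∈ Icc 0 T,
      ∫⁻ k, ENNReal.ofReal (wt (5 / 2) k) * ‖sinT (fun t => q t * ψ t) a (T + 2) k‖ₑ ^ 2
        ≤ K * ∫⁻ t, ‖ψ t‖ₑ ^ 2 ∧
      ∫⁻ k, ENNReal.ofReal (wt (1 / 2) k) * ‖cosT (fun t => q t * ψ t) a (T + 2) k‖ₑ ^ 2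
        ≤ K * ∫⁻ t, ‖ψ t‖ₑ ^ 2 ∧
      ‖q a * ψ a‖ₑ ^ 2 ≤ K * ‖ψ a‖ₑ ^ 2 := by
  obtain ⟨M, hM⟩ := isCompact_Icc.exists_bound_of_continuousOn (s := Icc 0 (T + 2)) hq.continuousOn
  have hp : ∀ (ψ : ℝ → ℂ), ∀ t ∈ Icc 0 (T + 2),
      ‖q t * ψ t‖ₑ ^ 2 ≤ ENNReal.ofReal (M ^ 2) * ‖ψ t‖ₑ ^ 2 := by
    intro ψ t ht
    simp only [enorm_sq_eq_ofReal]
    rw [← ENNReal.ofReal_mul (by positivity)]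
    refine ENNReal.ofReal_le_ofReal ?_
    rw [norm_mul, mul_pow]
    gcongr
    exact hM t ht
  have hi : ∀ ψ : ℝ → ℂ, ∀ a ∈ Icc 0 T, ∫⁻ t in Ioc a (T + 2), ‖q t * ψ t‖ₑ ^ 2
      ≤ ENNReal.ofReal (M ^ 2) * ∫⁻ t, ‖ψ t‖ₑ ^ 2 := by
    intro ψ a ha
    calc ∫⁻ t in Ioc a (T + 2), ‖q t * ψ t‖ₑ ^ 2
        ≤ ∫⁻ t in Ioc a (T + 2), ENNReal.ofReal (M ^ 2) * ‖ψ t‖ₑ ^ 2 :=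
          setLIntegral_mono' measurableSet_Ioc fun t ht => hp ψ t ⟨ha.1.trans ht.1.le, ht.2⟩
      _ ≤ ∫⁻ t, ENNReal.ofReal (M ^ 2) * ‖ψ t‖ₑ ^ 2 := setLIntegral_le_lintegral _ _
      _ = _ := lintegral_const_mul' _ _ ENNReal.ofReal_ne_top
  -- The first two summands dominate the constants of the sine and cosine bounds for every `a` in
  -- `[0, T]`; the final 1 secures `1 ≤ R` for the pointwise bound.
  set R : ℝ := 32 * Real.pi + 16 * (T + 2) ^ 3 + 1 with hR
  have hR0 : 0 ≤ R := by positivity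
  have hR1 : 1 ≤ R := by
    have : 0 ≤ 32 * Real.pi + 16 * (T + 2) ^ 3 := by positivity
    linarith
  have hK : ((R * M ^ 2).toNNReal : ℝ≥0∞) = ENNReal.ofReal R * ENNReal.ofReal (M ^ 2) := by
    rw [← ENNReal.ofReal_mul hR0]; rfl
  refine ⟨(R * M ^ 2).toNNReal, fun ψ hψ a ha => ⟨?_, ?_, ?_⟩⟩
  · refine (lintegral_sinT_le (by fun_prop) (by linarith [ha.2])).trans ?_
    rw [hK, mul_assoc]
    gcongr
    · have : (T + 2 - a) ^ 3 ≤ (T + 2) ^ 3 :=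
        pow_le_pow_left₀ (by linarith [ha.2]) (by linarith [ha.1]) 3
      linarith
    · exact hi ψ a ha
  · refine (lintegral_cosT_le (by fun_prop) a (T + 2)).trans ?_
    rw [hK, mul_assoc]
    gcongr
    · have : 0 ≤ (T + 2) ^ 3 := by positivity
      linarith [Real.pi_pos]
    · exact hi ψ a ha
  · refine (hp ψ a ⟨ha.1, by linarith [ha.2]⟩).trans ?_
    rw [hK]
    gcongr
    exact le_mul_of_one_le_left' (by simpa using ENNReal.ofReal_le_ofReal hR1)

/-! ### The transposed solution operator and its endpoint bounds -/

/-- Measurable functions in `L¹ ∩ L²`. -/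
structure Adm (f : ℝ → ℂ) : Prop where
  measurable : Measurable f
  integrable : Integrable f
  memLp : MemLp f 2

theorem Adm.mul_bounded {f : ℝ → ℂ} (hf : Adm f) {u : ℝ → ℂ} (hu : Measurable u) {C : ℝ}
    (hC : ∀ x, ‖u x‖ ≤ C) : Adm fun x => u x * f x where
  measurable := hu.mul hf.measurable
  integrable := hf.integrable.bdd_mul hu.aestronglyMeasurable (Filter.Eventually.of_forall hC)
  memLp := hf.memLp.mul (p := ∞) (q := 2) (r := 2)
    (memLp_top_of_bound hu.aestronglyMeasurable C (Filter.Eventually.of_forall hC))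

theorem hat_add {f g : ℝ → ℂ} (hf : Integrable f) (hg : Integrable g) (t : ℝ) :
    hat (fun x => f x + g x) t = hat f t + hat g t := by
  have h : ∀ {u : ℝ → ℂ}, Integrable u → Integrable fun x : ℝ => cexp (-(I * t * x)) * u x :=
    fun hu => hu.bdd_mul (c := 1) (by fun_prop)
      (Filter.Eventually.of_forall fun x => (norm_cexp_neg_I_mul t x).le)
  rw [hat, hat, hat, ← integral_add (h hf) (h hg)]
  simp_rw [mul_add]

/-- The transpose of the solution operator, applied to the test function `hat f` and cut off in
time. -/
def Phi {T : ℝ} (c : Cutoff T) (f : ℝ → ℂ) (a k : ℝ) : ℂ :=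
  sinT (fun t => c.χ t * hat f t) a (T + 2) k

section Phi

variable {T : ℝ} (c : Cutoff T)

theorem measurable_Phi {f : ℝ → ℂ} (hf : Integrable f) :
    Measurable fun p : ℝ × ℝ => Phi c f p.1 p.2 :=
  measurable_sinT (c.continuous.mul (continuous_hat hf)).measurable _

theorem measurable_Phi_right {f : ℝ → ℂ} (hf : Integrable f) (a : ℝ) :
    Measurable (Phi c f a) :=
  (measurable_Phi c hf).comp (g := fun p : ℝ × ℝ => Phi c f p.1 p.2) measurable_prodMk_left

theorem Phi_add {f g : ℝ → ℂ} (hf : Integrable f) (hg : Integrable g) (a k : ℝ) :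
    Phi c (fun x => f x + g x) a k = Phi c f a k + Phi c g a k := by
  unfold Phi
  have h := sinT_add (p := fun t => c.χ t * hat f t) (q := fun t => c.χ t * hat g t)
    (c.continuous.mul (continuous_hat hf)) (c.continuous.mul (continuous_hat hg)) a (T + 2) k
  rw [← h]
  simp_rw [hat_add hf hg, mul_add]

/-- The endpoint `m = 0`: no integration by parts, only `exists_cutoff_bound` and Plancherel. -/
theorem exists_Phi_bound_zero (hT : 0 < T) : ∃ K : ℝ≥0, ∀ f, Adm f → ∀ a ∈ Icc 0 T,
    ∫⁻ k, ENNReal.ofReal (wt (5 / 2) k) * ‖Phi c f a k‖ₑ ^ 2 ≤ K * ∫⁻ x, ‖f x‖ₑ ^ 2 := by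
  obtain ⟨K, hK⟩ := exists_cutoff_bound hT c.continuous
  refine ⟨K * (2 * Real.pi).toNNReal, fun f hf a ha => ?_⟩
  refine ((hK _ (continuous_hat hf.integrable) a ha).1).trans_eq ?_
  rw [lintegral_hat_sq hf.integrable hf.memLp, ENNReal.coe_mul, mul_assoc]
  rfl

theorem sinT_cutoff_mul_deriv {χ χ' ψ ψ' : ℝ → ℂ} (hχ : ∀ t, HasDerivAt χ (χ' t) t)
    (hχ' : Continuous χ') (hψ : ∀ t, HasDerivAt ψ (ψ' t) t) (hψ' : Continuous ψ') {a b k : ℝ}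
    (hab : a ≤ b) (hb : χ b = 0) (hk : k ≠ 0) :
    sinT (fun t => χ t * ψ' t) a b k
      = - cosT (fun t => χ t * ψ t) a b k - sinT (fun t => χ' t * ψ t) a b k := by
  have hχc : Continuous χ := continuous_iff_continuousAt.2 fun t => (hχ t).continuousAt
  have hψc : Continuous ψ := continuous_iff_continuousAt.2 fun t => (hψ t).continuousAt
  have h := sinT_deriv (p := fun t => χ t * ψ t) (fun t => (hχ t).mul (hψ t)) (by fun_prop) hab
    (by simp [hb]) hk
  rw [sinT_add (by fun_prop) (by fun_prop)] at h
  linear_combination h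

theorem cosT_cutoff_mul_deriv {χ χ' ψ ψ' : ℝ → ℂ} (hχ : ∀ t, HasDerivAt χ (χ' t) t)
    (hχ' : Continuous χ') (hψ : ∀ t, HasDerivAt ψ (ψ' t) t) (hψ' : Continuous ψ') {a b : ℝ}
    (hab : a ≤ b) (hb : χ b = 0) (k : ℝ) :
    cosT (fun t => χ t * ψ' t) a b k
      = - (χ a * ψ a) + omega k ^ 2 * sinT (fun t => χ t * ψ t) a b k
        - cosT (fun t => χ' t * ψ t) a b k := by
  have hχc : Continuous χ := continuous_iff_continuousAt.2 fun t => (hχ t).continuousAt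
  have hψc : Continuous ψ := continuous_iff_continuousAt.2 fun t => (hψ t).continuousAt
  have h := cosT_deriv (p := fun t => χ t * ψ t) (fun t => (hχ t).mul (hψ t)) (by fun_prop) hab
    (by simp [hb]) k
  rw [cosT_add (by fun_prop) (by fun_prop)] at h
  linear_combination h

theorem enorm_add_three_sq_le (x y z : ℂ) :
    ‖x + (y + z)‖ₑ ^ 2 ≤ 4 * (‖x‖ₑ ^ 2 + (‖y‖ₑ ^ 2 + ‖z‖ₑ ^ 2)) := by
  refine (enorm_add_sq_le _ _).trans ?_
  calc _ ≤ 2 * (2 * ‖x‖ₑ ^ 2 + 2 * (‖y‖ₑ ^ 2 + ‖z‖ₑ ^ 2)) := by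
        gcongr
        · exact le_mul_of_one_le_left' (by norm_num)
        · exact enorm_add_sq_le _ _
    _ = _ := by ring

theorem enorm_add_four_sq_le (x y z w : ℂ) :
    ‖x + y + (z + w)‖ₑ ^ 2 ≤ 4 * (‖x‖ₑ ^ 2 + ‖y‖ₑ ^ 2 + (‖z‖ₑ ^ 2 + ‖w‖ₑ ^ 2)) := by
  refine (enorm_add_sq_le _ _).trans ?_
  calc _ ≤ 2 * (2 * (‖x‖ₑ ^ 2 + ‖y‖ₑ ^ 2) + 2 * (‖z‖ₑ ^ 2 + ‖w‖ₑ ^ 2)) := by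
        gcongr <;> exact enorm_add_sq_le _ _
    _ = _ := by ring

theorem norm_one_sub_I_mul_sq (x : ℝ) : ‖(1 - I * x : ℂ)‖ ^ 2 = 1 + x ^ 2 := by
  rw [← Complex.normSq_eq_norm_sq, Complex.normSq_apply]
  simp [sq]

theorem one_sub_I_mul_ne_zero (x : ℝ) : (1 - I * x : ℂ) ≠ 0 := fun h => by
  have := norm_one_sub_I_mul_sq x
  rw [h] at this
  norm_num at this
  nlinarith [sq_nonneg x]

theorem one_add_sq_ne_zero (x : ℝ) : (1 + (x : ℂ) ^ 2) ≠ 0 := by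
  have : (1 + x ^ 2 : ℝ) ≠ 0 := by positivity
  exact_mod_cast this

/-- The endpoint `m = 1`. Dividing `f` by `1 - ix` gives `g` whose `L²` norm is the `H^{-1}` norm of
`f`. The resulting derivative of `hat g` is moved onto the kernel, where it costs one factor `ω`. -/
theorem exists_Phi_bound_one (hT : 0 < T) : ∃ K : ℝ≥0, ∀ f, Adm f → ∀ a ∈ Icc 0 T,
    ∫⁻ k, ENNReal.ofReal (wt (1 / 2) k) * ‖Phi c f a k‖ₑ ^ 2
      ≤ K * ∫⁻ x, ENNReal.ofReal (wt (-1) x) * ‖f x‖ₑ ^ 2 := by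
  obtain ⟨K, hK⟩ := exists_cutoff_bound hT c.continuous
  obtain ⟨K', hK'⟩ := exists_cutoff_bound hT c.continuous'
  refine ⟨4 * (K + (K + K')) * (2 * Real.pi).toNNReal, fun f hf a ha => ?_⟩
  have hn : ∀ x : ℝ, 1 ≤ ‖(1 - I * x : ℂ)‖ := fun x => by
    have := norm_one_sub_I_mul_sq x
    nlinarith [norm_nonneg (1 - I * x : ℂ), sq_nonneg x]
  have hn' : ∀ x : ℝ, |x| ≤ ‖(1 - I * x : ℂ)‖ := fun x =>
    abs_le_of_sq_le_sq (by rw [norm_one_sub_I_mul_sq]; linarith) (norm_nonneg _)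
  set g : ℝ → ℂ := fun x => (1 - I * x)⁻¹ * f x with hg
  have hga : Adm g := hf.mul_bounded (by fun_prop) (C := 1) fun x => by
    rw [norm_inv]; exact inv_le_one_of_one_le₀ (hn x)
  have hga' : Adm fun x : ℝ => -(I * x) * g x := by
    have : (fun x : ℝ => -(I * x) * g x) = fun x : ℝ => (-(I * x) * (1 - I * x)⁻¹) * f x := by
      ext x; rw [hg]; ring
    rw [this]
    refine hf.mul_bounded (by fun_prop) (C := 1) fun x => ?_
    rw [norm_mul, norm_inv, norm_neg, norm_mul, norm_I, one_mul, Complex.norm_real,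
      Real.norm_eq_abs, ← div_eq_mul_inv]
    exact div_le_one_of_le₀ (hn' x) (norm_nonneg _)
  have hgx : Integrable fun x : ℝ => x * g x := by
    have := hga'.integrable.const_mul I
    refine this.congr (Filter.Eventually.of_forall fun x => ?_)
    simp only
    linear_combination (-(x * g x)) * I_sq
  -- Multiplication by `-ix` becomes differentiation, so `hat f = ψ + ψ'`.
  have hfg : f = fun x : ℝ => g x + -(I * x) * g x := by
    ext x
    have := one_sub_I_mul_ne_zero x
    simp only [hg]
    field_simp
    ring
  set ψ := hat g with hψ
  set ψ' := hat (fun x : ℝ => -(I * x) * g x) with hψ'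
  have hd : ∀ t, HasDerivAt ψ (ψ' t) t := hasDerivAt_hat hga.integrable hgx
  have hψc : Continuous ψ := continuous_hat hga.integrable
  have hψc' : Continuous ψ' := continuous_hat hga'.integrable
  have hPhi : ∀ k, k ≠ 0 → Phi c f a k = sinT (fun t => c.χ t * ψ t) a (T + 2) k
      + (-cosT (fun t => c.χ t * ψ t) a (T + 2) k + -sinT (fun t => c.χ' t * ψ t) a (T + 2) k) := by
    intro k hk
    have e : Phi c f a k = Phi c (fun x : ℝ => g x + -(I * x) * g x) a k := by rw [← hfg]
    rw [e, Phi_add c hga.integrable hga'.integrable, ← sub_eq_add_neg]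
    congr 1
    exact sinT_cutoff_mul_deriv c.hasDerivAt c.continuous' hd hψc' (by linarith [ha.2]) c.eq_zero hk
  have hψ2 : ∫⁻ t, ‖ψ t‖ₑ ^ 2 = ENNReal.ofReal (2 * Real.pi) *
      ∫⁻ x, ENNReal.ofReal (wt (-1) x) * ‖f x‖ₑ ^ 2 := by
    rw [hψ, lintegral_hat_sq hga.integrable hga.memLp]
    congr 1
    refine lintegral_congr fun x => ?_
    simp only [enorm_sq_eq_ofReal]
    rw [← ENNReal.ofReal_mul (wt_pos _ _).le, hg]
    simp only
    rw [norm_mul, norm_inv, mul_pow, inv_pow, norm_one_sub_I_mul_sq, wt, Real.rpow_neg_one]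
  have hc := c.continuous
  have hc' := c.continuous'
  have m1 : Measurable (sinT (fun t => c.χ t * ψ t) a (T + 2)) :=
    measurable_sinT_right (by fun_prop) _ _
  have m3 : Measurable (sinT (fun t => c.χ' t * ψ t) a (T + 2)) :=
    measurable_sinT_right (by fun_prop) _ _
  -- The sine terms have two powers of the weight to spare; only the cosine term needs exactly the
  -- weight of order `1/2`.
  have hS : ∀ V : ℝ → ℂ, ∫⁻ k, ENNReal.ofReal (wt (1 / 2) k) * ‖V k‖ₑ ^ 2
      ≤ ∫⁻ k, ENNReal.ofReal (wt (5 / 2) k) * ‖V k‖ₑ ^ 2 := fun V =>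
    lintegral_mono fun k => mul_le_mul_left
      (ENNReal.ofReal_le_ofReal (wt_mono (by norm_num) k)) _
  calc ∫⁻ k, ENNReal.ofReal (wt (1 / 2) k) * ‖Phi c f a k‖ₑ ^ 2
      ≤ ∫⁻ k, 4 * (ENNReal.ofReal (wt (1 / 2) k) * ‖sinT (fun t => c.χ t * ψ t) a (T + 2) k‖ₑ ^ 2
        + (ENNReal.ofReal (wt (1 / 2) k) * ‖sinT (fun t => c.χ' t * ψ t) a (T + 2) k‖ₑ ^ 2
        + ENNReal.ofReal (wt (1 / 2) k) * ‖cosT (fun t => c.χ t * ψ t) a (T + 2) k‖ₑ ^ 2)) := by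
        refine lintegral_mono_ae ?_
        filter_upwards [Measure.ae_ne volume (0 : ℝ)] with k hk
        rw [hPhi k hk]
        refine (mul_le_mul_right (enorm_add_three_sq_le _ _ _) _).trans_eq ?_
        rw [enorm_neg, enorm_neg]
        ring
    _ = 4 * ((∫⁻ k, ENNReal.ofReal (wt (1 / 2) k) *
            ‖sinT (fun t => c.χ t * ψ t) a (T + 2) k‖ₑ ^ 2)
        + ((∫⁻ k, ENNReal.ofReal (wt (1 / 2) k) * ‖sinT (fun t => c.χ' t * ψ t) a (T + 2) k‖ₑ ^ 2)
        + ∫⁻ k, ENNReal.ofReal (wt (1 / 2) k) *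
            ‖cosT (fun t => c.χ t * ψ t) a (T + 2) k‖ₑ ^ 2)) := by
        rw [lintegral_const_mul' _ _ (by norm_num),
          lintegral_add_left (measurable_wt_mul_sq _ m1),
          lintegral_add_left (measurable_wt_mul_sq _ m3)]
    _ ≤ 4 * (K * (∫⁻ t, ‖ψ t‖ₑ ^ 2) + (K' * (∫⁻ t, ‖ψ t‖ₑ ^ 2) + K * ∫⁻ t, ‖ψ t‖ₑ ^ 2)) := by
        gcongr
        · exact (hS _).trans (hK ψ hψc a ha).1
        · exact (hS _).trans (hK' ψ hψc a ha).1
        · exact (hK ψ hψc a ha).2.1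
    _ = _ := by
        rw [hψ2]
        simp only [ENNReal.coe_mul, ENNReal.coe_add, ENNReal.coe_ofNat]
        change _ = 4 * (K + (K + K')) * ENNReal.ofReal (2 * Real.pi) * _
        ring

/-- The endpoint `m = 2`. Dividing by `1 + x²` and integrating by parts twice leaves the boundary
value `c.χ a * ψ a`, constant in `k`. The weight of order `-3/2` is integrable in `k`, and
integration over `a` turns `|ψ(a)|²` into the `L²` norm. -/
theorem exists_Phi_bound_two (hT : 0 < T) : ∃ K : ℝ≥0, ∀ f, Adm f →
    ∫⁻ a in Ioo 0 T, ∫⁻ k, ENNReal.ofReal (wt (-3 / 2) k) * ‖Phi c f a k‖ₑ ^ 2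
      ≤ K * ∫⁻ x, ENNReal.ofReal (wt (-2) x) * ‖f x‖ₑ ^ 2 := by
  obtain ⟨K, hK⟩ := exists_cutoff_bound hT c.continuous
  obtain ⟨K', hK'⟩ := exists_cutoff_bound hT c.continuous'
  obtain ⟨K'', hK''⟩ := exists_cutoff_bound hT c.continuous''
  obtain ⟨D, hD⟩ := ENNReal.lt_iff_exists_coe.1 (lintegral_wt_lt_top (a := -3 / 2) (by norm_num))
  refine ⟨4 * ((K + 4 * K' + K'') * T.toNNReal + D * K) * (2 * Real.pi).toNNReal,
    fun f hf => ?_⟩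
  have hpos : ∀ x : ℝ, (0 : ℝ) < 1 + x ^ 2 := fun x => by positivity
  set g : ℝ → ℂ := fun x => ((1 + x ^ 2)⁻¹ : ℝ) * f x with hg
  have bound : ∀ u : ℝ → ℂ, Measurable u → (∀ x, ‖u x‖ ≤ 1 + x ^ 2) →
      Adm fun x : ℝ => u x * g x := by
    intro u hu hub
    have : (fun x : ℝ => u x * g x) = fun x : ℝ => (u x * ((1 + x ^ 2)⁻¹ : ℝ)) * f x := by
      ext x; rw [hg]; ring
    rw [this]
    refine hf.mul_bounded (by fun_prop) (C := 1) fun x => ?_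
    rw [norm_mul, Complex.norm_real, Real.norm_eq_abs, abs_of_pos (inv_pos.2 (hpos x)),
      ← div_eq_mul_inv]
    exact div_le_one_of_le₀ (hub x) (hpos x).le
  have hga : Adm g := by
    have := bound (fun _ => 1) measurable_const fun x => by simp; positivity
    simpa using this
  have habs : ∀ x : ℝ, |x| ≤ 1 + x ^ 2 := fun x => by
    rw [abs_le]; constructor <;> nlinarith [sq_nonneg (x - 1), sq_nonneg (x + 1)]
  have hga' : Adm fun x : ℝ => -(I * x) * g x :=
    bound _ (by fun_prop) fun x => by simpa using habs x
  have hga'' : Adm fun x : ℝ => -(I * x) * (-(I * x) * g x) := by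
    have := bound (fun x : ℝ => -(I * x) * -(I * x)) (by fun_prop) fun x => by
      have : |x| * |x| = x ^ 2 := by rw [← sq, sq_abs]
      simp; linarith
    simpa only [mul_assoc] using this
  have hgx : Integrable fun x : ℝ => x * g x :=
    (bound (fun x => x) (by fun_prop) fun x => by simpa using habs x).integrable
  have hgx' : Integrable fun x : ℝ => x * (-(I * x) * g x) := by
    have := (bound (fun x => x * -(I * x)) (by fun_prop) fun x => by
      have : |x| * |x| = x ^ 2 := by rw [← sq, sq_abs]
      simp; linarith).integrable
    simpa only [mul_assoc] using this
  have hgn : Adm fun x : ℝ => -(-(I * x) * (-(I * x) * g x)) :=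
    ⟨hga''.measurable.neg, hga''.integrable.neg, hga''.memLp.neg⟩
  -- Since `(-ix)² = -x²`, this says `hat f = ψ - ψ''`.
  have hfg : f = fun x : ℝ => g x + -(-(I * x) * (-(I * x) * g x)) := by
    ext x
    have := one_add_sq_ne_zero x
    simp only [hg]
    push_cast
    field_simp
    linear_combination ((x : ℂ) ^ 2 * f x) * I_sq
  set ψ := hat g with hψ
  set ψ' := hat (fun x : ℝ => -(I * x) * g x) with hψ'
  set ψ'' := hat (fun x : ℝ => -(I * x) * (-(I * x) * g x)) with hψ''
  have hd : ∀ t, HasDerivAt ψ (ψ' t) t := hasDerivAt_hat hga.integrable hgx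
  have hd' : ∀ t, HasDerivAt ψ' (ψ'' t) t := hasDerivAt_hat hga'.integrable hgx'
  have hψc : Continuous ψ := continuous_hat hga.integrable
  have hψc' : Continuous ψ' := continuous_hat hga'.integrable
  have hψc'' : Continuous ψ'' := continuous_hat hga''.integrable
  have hc := c.continuous
  have hc' := c.continuous'
  have hc'' := c.continuous''
  -- Integrating `χψ''` by parts gives `χψ'` against the cosine and `χ'ψ'` against the sine. Each is
  -- integrated by parts again, and each produces one copy of the cosine term with `χ'ψ`, hence the
  -- factor 2.
  have hPhi : ∀ a ∈ Ioo 0 T, ∀ k, k ≠ 0 → Phi c f a k =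
      (1 + omega k ^ 2) * sinT (fun t => c.χ t * ψ t) a (T + 2) k
      + -sinT (fun t => c.χ'' t * ψ t) a (T + 2) k
      + (-(c.χ a * ψ a) + (-2) * cosT (fun t => c.χ' t * ψ t) a (T + 2) k) := by
    intro a ha k hk
    have hab : a ≤ T + 2 := by linarith [ha.2]
    have e : Phi c f a k = Phi c (fun x : ℝ => g x + -(-(I * x) * (-(I * x) * g x))) a k := by
      rw [← hfg]
    have e2 : Phi c (fun x : ℝ => -(-(I * x) * (-(I * x) * g x))) a k
        = - sinT (fun t => c.χ t * ψ'' t) a (T + 2) k := by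
      have h1 : ∀ t, hat (fun x : ℝ => -(-(I * x) * (-(I * x) * g x))) t = -ψ'' t := fun t => by
        rw [hψ'', hat, hat, ← integral_neg]
        simp_rw [mul_neg]
      rw [Phi, sinT, sinT, ← integral_neg]
      simp_rw [h1, mul_neg]
    have e3 := sinT_cutoff_mul_deriv c.hasDerivAt c.continuous' hd' hψc'' hab c.eq_zero hk
    have e4 := cosT_cutoff_mul_deriv c.hasDerivAt c.continuous' hd hψc' hab c.eq_zero k
    have e5 := sinT_cutoff_mul_deriv c.hasDerivAt' c.continuous'' hd hψc' hab c.eq_zero' hk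
    rw [e, Phi_add c hga.integrable hgn.integrable, e2, e3, e4, e5, Phi]
    ring
  have hψ2 : ∫⁻ t, ‖ψ t‖ₑ ^ 2 = ENNReal.ofReal (2 * Real.pi) *
      ∫⁻ x, ENNReal.ofReal (wt (-2) x) * ‖f x‖ₑ ^ 2 := by
    rw [hψ, lintegral_hat_sq hga.integrable hga.memLp]
    congr 1
    refine lintegral_congr fun x => ?_
    simp only [enorm_sq_eq_ofReal]
    rw [← ENNReal.ofReal_mul (wt_pos _ _).le, hg]
    simp only
    rw [norm_mul, mul_pow, Complex.norm_real, Real.norm_eq_abs, sq_abs, wt, inv_pow,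
      Real.rpow_neg (hpos x).le]
    norm_num
  have hw : Measurable fun k => ENNReal.ofReal (wt (-3 / 2) k) := (measurable_wt _).ennreal_ofReal
  have m1 : ∀ a, Measurable (sinT (fun t => c.χ t * ψ t) a (T + 2)) := fun a =>
    measurable_sinT_right (by fun_prop) _ _
  have m3 : ∀ a, Measurable (sinT (fun t => c.χ'' t * ψ t) a (T + 2)) := fun a =>
    measurable_sinT_right (by fun_prop) _ _
  have hwt : ∀ k, wt (-3 / 2) k * (1 + k ^ 2) ^ 4 = wt (5 / 2) k := fun k => by
    have : wt 4 k = (1 + k ^ 2) ^ 4 := by rw [wt]; exact_mod_cast Real.rpow_natCast _ 4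
    rw [← this, ← wt_add]; norm_num
  -- `1 + ω² ≤ (1 + k²)²`, whose square costs four powers of the weight: `-3/2 + 4 = 5/2`.
  have hS1 : ∀ (V : ℝ → ℂ) (k : ℝ), ENNReal.ofReal (wt (-3 / 2) k) * ‖(1 + omega k ^ 2) * V k‖ₑ ^ 2
      ≤ ENNReal.ofReal (wt (5 / 2) k) * ‖V k‖ₑ ^ 2 := fun V k => by
    simp only [enorm_sq_eq_ofReal]
    rw [← ENNReal.ofReal_mul (wt_pos _ _).le, ← ENNReal.ofReal_mul (wt_pos _ _).le]
    refine ENNReal.ofReal_le_ofReal ?_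
    have e : ‖(1 + omega k ^ 2 : ℂ)‖ = 1 + omega k ^ 2 := by
      rw [show (1 + omega k ^ 2 : ℂ) = ((1 + omega k ^ 2 : ℝ) : ℂ) by push_cast; ring,
        Complex.norm_real, Real.norm_eq_abs, abs_of_pos (by positivity)]
    rw [norm_mul, mul_pow, e, ← hwt, omega_sq, mul_assoc]
    have h1 : 1 + k ^ 2 * (1 + k ^ 2) ≤ (1 + k ^ 2) ^ 2 := by nlinarith [sq_nonneg k]
    have h2 : (1 + k ^ 2 * (1 + k ^ 2)) ^ 2 ≤ (1 + k ^ 2) ^ 4 := by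
      calc _ ≤ ((1 + k ^ 2) ^ 2) ^ 2 := by gcongr
        _ = _ := by ring
    have := wt_pos (-3 / 2) k
    gcongr
  have inner : ∀ a ∈ Ioo 0 T,
      ∫⁻ k, ENNReal.ofReal (wt (-3 / 2) k) * ‖Phi c f a k‖ₑ ^ 2
      ≤ 4 * ((K + 4 * K' + K'') * (∫⁻ t, ‖ψ t‖ₑ ^ 2) + D * K * ‖ψ a‖ₑ ^ 2) := by
    intro a ha
    have ha' : a ∈ Icc 0 T := Ioo_subset_Icc_self ha
    calc ∫⁻ k, ENNReal.ofReal (wt (-3 / 2) k) * ‖Phi c f a k‖ₑ ^ 2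
        ≤ ∫⁻ k, 4 * (ENNReal.ofReal (wt (5 / 2) k) *
            ‖sinT (fun t => c.χ t * ψ t) a (T + 2) k‖ₑ ^ 2
          + (ENNReal.ofReal (wt (5 / 2) k) * ‖sinT (fun t => c.χ'' t * ψ t) a (T + 2) k‖ₑ ^ 2
          + (ENNReal.ofReal (wt (-3 / 2) k) * ‖c.χ a * ψ a‖ₑ ^ 2
          + 4 * (ENNReal.ofReal (wt (1 / 2) k) *
            ‖cosT (fun t => c.χ' t * ψ t) a (T + 2) k‖ₑ ^ 2)))) := by
          refine lintegral_mono_ae ?_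
          filter_upwards [Measure.ae_ne volume (0 : ℝ)] with k hk
          rw [hPhi a ha k hk]
          refine (mul_le_mul_right (enorm_add_four_sq_le _ _ _ _) _).trans ?_
          rw [enorm_neg, enorm_neg]
          have e4 : ‖(-2 : ℂ) * cosT (fun t => c.χ' t * ψ t) a (T + 2) k‖ₑ ^ 2
              = 4 * ‖cosT (fun t => c.χ' t * ψ t) a (T + 2) k‖ₑ ^ 2 := by
            simp only [enorm_sq_eq_ofReal, norm_mul, norm_neg, Complex.norm_ofNat, mul_pow]
            rw [ENNReal.ofReal_mul (by norm_num)]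
            norm_num
          rw [mul_left_comm, mul_add, mul_add _ (_ ^ 2), mul_add _ (_ ^ 2), add_assoc]
          refine mul_le_mul_right (add_le_add (hS1 _ k) (add_le_add ?_ (add_le_add le_rfl ?_))) 4
          · gcongr
            exact wt_mono (by norm_num) k
          · rw [e4, mul_left_comm]
            gcongr
            exact wt_mono (by norm_num) k
      _ = 4 * ((∫⁻ k, ENNReal.ofReal (wt (5 / 2) k) *
            ‖sinT (fun t => c.χ t * ψ t) a (T + 2) k‖ₑ ^ 2)
          + ((∫⁻ k, ENNReal.ofReal (wt (5 / 2) k) *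
            ‖sinT (fun t => c.χ'' t * ψ t) a (T + 2) k‖ₑ ^ 2)
          + (D * ‖c.χ a * ψ a‖ₑ ^ 2
          + 4 * (∫⁻ k, ENNReal.ofReal (wt (1 / 2) k) *
            ‖cosT (fun t => c.χ' t * ψ t) a (T + 2) k‖ₑ ^ 2)))) := by
          rw [lintegral_const_mul' _ _ (by norm_num),
            lintegral_add_left (measurable_wt_mul_sq _ (m1 a)),
            lintegral_add_left (measurable_wt_mul_sq _ (m3 a)),
            lintegral_add_left (hw.mul_const _), lintegral_mul_const _ hw, hD.1,
            lintegral_const_mul' _ _ (by norm_num)]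
      _ ≤ 4 * (K * (∫⁻ t, ‖ψ t‖ₑ ^ 2) + (K'' * (∫⁻ t, ‖ψ t‖ₑ ^ 2) + (D * (K * ‖ψ a‖ₑ ^ 2)
          + 4 * (K' * ∫⁻ t, ‖ψ t‖ₑ ^ 2)))) := by
          gcongr
          · exact (hK ψ hψc a ha').1
          · exact (hK'' ψ hψc a ha').1
          · exact (hK ψ hψc a ha').2.2
          · exact (hK' ψ hψc a ha').2.1
      _ = _ := by ring
  calc _ ≤ ∫⁻ a in Ioo 0 T, 4 * ((K + 4 * K' + K'') * (∫⁻ t, ‖ψ t‖ₑ ^ 2) + D * K * ‖ψ a‖ₑ ^ 2) :=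
        setLIntegral_mono' measurableSet_Ioo inner
    _ = 4 * ((K + 4 * K' + K'') * (∫⁻ t, ‖ψ t‖ₑ ^ 2) * ENNReal.ofReal T
        + D * K * ∫⁻ a in Ioo 0 T, ‖ψ a‖ₑ ^ 2) := by
        rw [lintegral_const_mul' _ _ (by norm_num), lintegral_add_left measurable_const,
          setLIntegral_const, Real.volume_Ioo, sub_zero, lintegral_const_mul]
        exact hψc.measurable.enorm.pow_const 2
    _ ≤ 4 * ((K + 4 * K' + K'') * (∫⁻ t, ‖ψ t‖ₑ ^ 2) * ENNReal.ofReal T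
        + D * K * ∫⁻ a, ‖ψ a‖ₑ ^ 2) := by
        gcongr
        exact Measure.restrict_le_self
    _ = _ := by
        rw [hψ2]
        simp only [ENNReal.coe_mul, ENNReal.coe_add, ENNReal.coe_ofNat]
        change _ = 4 * ((K + 4 * K' + K'') * ENNReal.ofReal T + D * K) *
          ENNReal.ofReal (2 * Real.pi) * _
        ring

end Phi

/-! ### Interpolated bounds -/

theorem wt_rpow (a θ k : ℝ) : wt a k ^ θ = wt (a * θ) k := by
  rw [wt, wt, ← Real.rpow_mul (by positivity)]

theorem ofReal_wt_mul_wt (a b k : ℝ) (x : ℝ≥0∞) :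
    ENNReal.ofReal (wt a k) * (ENNReal.ofReal (wt b k) * x) = ENNReal.ofReal (wt (a + b) k) * x := by
  rw [← mul_assoc, ← ENNReal.ofReal_mul (wt_pos _ _).le, wt_add]

theorem enorm_wt_mul_sq (a k : ℝ) (z : ℂ) :
    ‖(wt a k : ℂ) * z‖ₑ ^ 2 = ENNReal.ofReal (wt (2 * a) k) * ‖z‖ₑ ^ 2 := by
  simp only [enorm_sq_eq_ofReal]
  rw [← ENNReal.ofReal_mul (wt_pos _ _).le, norm_mul, mul_pow, Complex.norm_real, Real.norm_eq_abs,
    sq_abs, two_mul, wt_add, sq (wt a k)]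

section

variable {T : ℝ} (c : Cutoff T)

/-- Both multipliers lie between 0 and 1 and add up to 1, so the splitting required for
interpolation stays admissible and passes through the linear map `Phi c`. -/
theorem Adm.split {f : ℝ → ℂ} (hf : Adm f) {Q : ℝ → ℝ} (hQm : Measurable Q) (hQ : ∀ x, 0 < Q x)
    {t : ℝ} (ht : 0 < t) :
    Adm (fun x => ((Q x / (Q x + t) : ℝ) : ℂ) * f x) ∧
    Adm (fun x => ((t / (Q x + t) : ℝ) : ℂ) * f x) ∧
    ∀ a k, Phi c f a k = Phi c (fun x => ((Q x / (Q x + t) : ℝ) : ℂ) * f x) a k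
      + Phi c (fun x => ((t / (Q x + t) : ℝ) : ℂ) * f x) a k := by
  have h1 : Adm (fun x => ((Q x / (Q x + t) : ℝ) : ℂ) * f x) := by
    refine hf.mul_bounded (by fun_prop) (C := 1) fun x => ?_
    have := hQ x
    rw [Complex.norm_real, Real.norm_eq_abs, abs_of_pos (by positivity)]
    exact div_le_one_of_le₀ (by linarith) (by positivity)
  have h2 : Adm (fun x => ((t / (Q x + t) : ℝ) : ℂ) * f x) := by
    refine hf.mul_bounded (by fun_prop) (C := 1) fun x => ?_
    have := hQ x
    rw [Complex.norm_real, Real.norm_eq_abs, abs_of_pos (by positivity)]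
    exact div_le_one_of_le₀ (by linarith) (by positivity)
  refine ⟨h1, h2, fun a k => ?_⟩
  rw [← Phi_add c h1.integrable h2.integrable]
  congr 1
  ext x
  have := hQ x
  rw [← add_mul, ← Complex.ofReal_add, ← add_div, div_self (by positivity), Complex.ofReal_one,
    one_mul]

theorem exists_Phi_bound_of_le_one (hT : 0 < T) {m : ℝ} (hm : m ∈ Icc (0 : ℝ) 1) :
    ∃ K : ℝ≥0, ∀ f, Adm f → ∀ a ∈ Icc 0 T,
    ∫⁻ k, ENNReal.ofReal (wt (5 / 2 - 2 * m) k) * ‖Phi c f a k‖ₑ ^ 2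
      ≤ K * ∫⁻ x, ENNReal.ofReal (wt (-m) x) * ‖f x‖ₑ ^ 2 := by
  obtain ⟨K₀, hK₀⟩ := exists_Phi_bound_zero c hT
  obtain ⟨K₁, hK₁⟩ := exists_Phi_bound_one c hT
  rcases hm.1.eq_or_lt with rfl | h0
  · refine ⟨K₀, fun f hf a ha => ?_⟩
    simpa [wt_zero] using hK₀ f hf a ha
  rcases hm.2.eq_or_lt with rfl | h1
  · refine ⟨K₁, fun f hf a ha => ?_⟩
    have e : (5 / 2 - 2 * 1 : ℝ) = 1 / 2 := by norm_num
    rw [e]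
    exact hK₁ f hf a ha
  refine ⟨K₀ + K₁, fun f hf a ha => ?_⟩
  -- Interpolation with `θ = m` at fixed `a`. Absorbing the weight of order `5/2` into `U`
  -- normalises the first endpoint, and the weights `-2` and `-1` record the change of order from `m
  -- = 0` to `m = 1`.
  have key := lintegral_rpow_mul_sq_le_of_decomposition (μ := volume) (ν := volume) (θ := m)
    ⟨h0, h1⟩ (measurable_wt (-2)) (measurable_wt (-1)) (wt_pos _) (wt_pos _)
    (U := fun k => (wt (5 / 4) k : ℂ) * Phi c f a k)
    ((Complex.measurable_ofReal.comp (measurable_wt _)).mul (measurable_Phi_right c hf.integrable a))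
    hf.measurable (K := (K₀ + K₁ : ℝ≥0)) (fun t ht => by
      obtain ⟨ha0, ha1, hsum⟩ := hf.split c (measurable_wt (-1)) (wt_pos _) ht
      refine ⟨fun k => (wt (5 / 4) k : ℂ) *
          Phi c (fun x => ((wt (-1) x / (wt (-1) x + t) : ℝ) : ℂ) * f x) a k,
        fun k => (wt (5 / 4) k : ℂ) *
          Phi c (fun x => ((t / (wt (-1) x + t) : ℝ) : ℂ) * f x) a k,
        (Complex.measurable_ofReal.comp (measurable_wt _)).mul
          (measurable_Phi_right c ha0.integrable a), Filter.Eventually.of_forall fun k => ?_, ?_, ?_⟩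
      · rw [hsum a k, mul_add]
      · simp_rw [enorm_wt_mul_sq (5 / 4)]
        rw [show (2 * (5 / 4) : ℝ) = 5 / 2 by norm_num]
        refine (hK₀ _ ha0 a ha).trans ?_
        gcongr
        exact le_self_add
      · simp_rw [enorm_wt_mul_sq (5 / 4), ofReal_wt_mul_wt]
        rw [show (-2 + 2 * (5 / 4) : ℝ) = 1 / 2 by norm_num]
        refine (hK₁ _ ha1 a ha).trans ?_
        gcongr
        exact le_add_self)
  simp_rw [enorm_wt_mul_sq, wt_rpow, ofReal_wt_mul_wt] at key
  rw [show 5 / 2 - 2 * m = -2 * m + 2 * (5 / 4) by ring, show -m = -1 * m by ring]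
  exact key

theorem exists_Phi_bound_of_one_le (hT : 0 < T) {m : ℝ} (hm : m ∈ Icc (1 : ℝ) 2) :
    ∃ K : ℝ≥0, ∀ f, Adm f →
    ∫⁻ a in Ioo 0 T, ∫⁻ k, ENNReal.ofReal (wt (5 / 2 - 2 * m) k) * ‖Phi c f a k‖ₑ ^ 2
      ≤ K * ∫⁻ x, ENNReal.ofReal (wt (-m) x) * ‖f x‖ₑ ^ 2 := by
  obtain ⟨K₀, hK₀⟩ := exists_Phi_bound_one c hT
  obtain ⟨K₁, hK₁⟩ := exists_Phi_bound_two c hT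
  -- The endpoint `m = 1` holds for each `a`; integrating it over `(0, T)` costs a factor `T` and
  -- matches the form of the endpoint `m = 2`.
  have hK₀' : ∀ f, Adm f →
      ∫⁻ a in Ioo 0 T, ∫⁻ k, ENNReal.ofReal (wt (1 / 2) k) * ‖Phi c f a k‖ₑ ^ 2
      ≤ (K₀ * T.toNNReal : ℝ≥0) * ∫⁻ x, ENNReal.ofReal (wt (-1) x) * ‖f x‖ₑ ^ 2 := by
    intro f hf
    refine (setLIntegral_mono' measurableSet_Ioo
      fun a ha => hK₀ f hf a (Ioo_subset_Icc_self ha)).trans_eq ?_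
    rw [setLIntegral_const, Real.volume_Ioo, sub_zero, ENNReal.coe_mul]
    exact mul_right_comm _ _ _
  rcases hm.1.eq_or_lt with rfl | h0
  · refine ⟨K₀ * T.toNNReal, fun f hf => ?_⟩
    rw [show (5 / 2 - 2 * 1 : ℝ) = 1 / 2 by norm_num]
    exact hK₀' f hf
  rcases hm.2.eq_or_lt with rfl | h1
  · refine ⟨K₁, fun f hf => ?_⟩
    rw [show (5 / 2 - 2 * 2 : ℝ) = -3 / 2 by norm_num]
    exact hK₁ f hf
  refine ⟨K₀ * T.toNNReal + K₁, fun f hf => ?_⟩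
  have hwm : ∀ a, Measurable fun p : ℝ × ℝ => ENNReal.ofReal (wt a p.2) := fun a =>
    ((measurable_wt a).comp measurable_snd).ennreal_ofReal
  have hprod : ∀ (a : ℝ) (g : ℝ → ℂ), Adm g →
      ∫⁻ p, ENNReal.ofReal (wt a p.2) * ‖Phi c g p.1 p.2‖ₑ ^ 2
        ∂((volume.restrict (Ioo 0 T)).prod volume)
      = ∫⁻ a' in Ioo 0 T, ∫⁻ k, ENNReal.ofReal (wt a k) * ‖Phi c g a' k‖ₑ ^ 2 := fun a g hg =>
    lintegral_prod _ ((hwm a).mul ((measurable_Phi c hg.integrable).enorm.pow_const 2)).aemeasurable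
  have hwc : Measurable fun p : ℝ × ℝ => (wt (1 / 4) p.2 : ℂ) :=
    Complex.measurable_ofReal.comp ((measurable_wt _).comp measurable_snd)
  -- Interpolation with `θ = m - 1`, now in `L²` of the product in `(a, k)`. The weights of order
  -- `1/4` in `U` and `-1/2` in `f` normalise the endpoint `m = 1`.
  have key := lintegral_rpow_mul_sq_le_of_decomposition
    (μ := (volume.restrict (Ioo 0 T)).prod volume) (ν := volume) (θ := m - 1)
    ⟨by linarith, by linarith⟩ (P := fun p : ℝ × ℝ => wt (-2) p.2) (Q := wt (-1))
    ((measurable_wt (-2)).comp measurable_snd) (measurable_wt (-1)) (fun p => wt_pos _ _) (wt_pos _)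
    (U := fun p => (wt (1 / 4) p.2 : ℂ) * Phi c f p.1 p.2)
    (hwc.mul (measurable_Phi c hf.integrable))
    (f := fun x => (wt (-1 / 2) x : ℂ) * f x)
    ((Complex.measurable_ofReal.comp (measurable_wt _)).mul hf.measurable)
    (K := (K₀ * T.toNNReal + K₁ : ℝ≥0)) (fun t ht => by
      obtain ⟨ha0, ha1, hsum⟩ := hf.split c (measurable_wt (-1)) (wt_pos _) ht
      refine ⟨fun p => (wt (1 / 4) p.2 : ℂ) *
          Phi c (fun x => ((wt (-1) x / (wt (-1) x + t) : ℝ) : ℂ) * f x) p.1 p.2,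
        fun p => (wt (1 / 4) p.2 : ℂ) *
          Phi c (fun x => ((t / (wt (-1) x + t) : ℝ) : ℂ) * f x) p.1 p.2,
        hwc.mul (measurable_Phi c ha0.integrable),
        Filter.Eventually.of_forall fun p => ?_, ?_, ?_⟩
      · rw [hsum p.1 p.2, mul_add]
      · simp_rw [mul_left_comm _ ((wt (-1 / 2) _ : ℝ) : ℂ), enorm_wt_mul_sq (-1 / 2),
          enorm_wt_mul_sq (1 / 4)]
        rw [hprod _ _ ha0, show (2 * (1 / 4) : ℝ) = 1 / 2 by norm_num,
          show (2 * (-1 / 2) : ℝ) = -1 by norm_num]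
        refine (hK₀' _ ha0).trans ?_
        gcongr
        exact le_self_add
      · simp_rw [mul_left_comm _ ((wt (-1 / 2) _ : ℝ) : ℂ), enorm_wt_mul_sq (-1 / 2),
          enorm_wt_mul_sq (1 / 4), ofReal_wt_mul_wt]
        rw [hprod _ _ ha1, show (-2 + 2 * (1 / 4) : ℝ) = -3 / 2 by norm_num,
          show (-1 + 2 * (-1 / 2) : ℝ) = -2 by norm_num]
        refine (hK₁ _ ha1).trans ?_
        gcongr
        exact le_add_self)
  simp_rw [enorm_wt_mul_sq, wt_rpow, ofReal_wt_mul_wt] at key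
  rw [hprod _ _ hf] at key
  rw [show 5 / 2 - 2 * m = -2 * (m - 1) + 2 * (1 / 4) by ring,
    show -m = -1 * (m - 1) + 2 * (-1 / 2) by ring]
  exact key

/-! ### Pairing with the forcing term -/

/-- The norm of `H^σ`, in terms of the Fourier transform. -/
def hatNorm (σ : ℝ) (u : ℝ → ℂ) : ℝ≥0∞ :=
  (∫⁻ k, ENNReal.ofReal (wt σ k) * ‖u k‖ₑ ^ 2) ^ (1 / 2 : ℝ)

theorem measurable_hatNorm (σ : ℝ) {Fhat : ℝ → ℝ → ℂ} (hF : Measurable (Function.uncurry Fhat)) :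
    Measurable fun t => hatNorm σ fun k => Fhat k t := by
  unfold hatNorm
  refine Measurable.pow_const ?_ _
  refine Measurable.lintegral_prod_left' (f := fun p : ℝ × ℝ =>
    ENNReal.ofReal (wt σ p.1) * ‖Fhat p.1 p.2‖ₑ ^ 2) ?_
  exact (((measurable_wt σ).comp measurable_fst).ennreal_ofReal).mul (hF.enorm.pow_const 2)

theorem hatNorm_eq_eLpNorm (σ : ℝ) (u : ℝ → ℂ) :
    hatNorm σ u = eLpNorm (fun k => (wt (σ / 2) k : ℂ) * u k) 2 volume := by
  rw [hatNorm, eLpNorm_two_eq]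
  simp_rw [enorm_wt_mul_sq]
  congr 3
  ext k
  congr 4
  ring

theorem abs_pow_le_wt (j : ℕ) (k : ℝ) : |k| ^ j ≤ wt (j / 2) k := by
  have h : |k| ≤ wt (1 / 2) k := by
    rw [wt_half]
    exact Real.abs_le_sqrt (by linarith)
  calc |k| ^ j ≤ wt (1 / 2) k ^ j := by gcongr
    _ = _ := by
      rw [← Real.rpow_natCast, wt_rpow]
      congr 1
      ring

/-- Duality between weighted `L²` spaces. -/
theorem lintegral_pow_mul_le (j : ℕ) (σ : ℝ) {u w : ℝ → ℂ} (hu : Measurable u)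
    (hw : Measurable w) :
    ∫⁻ k, ‖(I * k) ^ j * (u k * w k)‖ₑ ≤ hatNorm (j - σ) u * hatNorm σ w := by
  have hm : ∀ {v : ℝ → ℂ} (a : ℝ), Measurable v → Measurable fun k => ‖(wt a k : ℂ) * v k‖ₑ :=
    fun a hv => ((Complex.measurable_ofReal.comp (measurable_wt _)).mul hv).enorm
  calc ∫⁻ k, ‖(I * k) ^ j * (u k * w k)‖ₑ
      ≤ ∫⁻ k, ‖(wt ((j - σ) / 2) k : ℂ) * u k‖ₑ * ‖(wt (σ / 2) k : ℂ) * w k‖ₑ := by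
        refine lintegral_mono fun k => ?_
        rw [← enorm_mul, enorm_le_iff_norm_le]
        have e : (wt ((j - σ) / 2) k : ℂ) * u k * ((wt (σ / 2) k : ℂ) * w k)
            = (wt (j / 2) k : ℂ) * (u k * w k) := by
          rw [show (j / 2 : ℝ) = (j - σ) / 2 + σ / 2 by ring, wt_add]
          push_cast
          ring
        rw [e, norm_mul, norm_pow, norm_mul, norm_I, one_mul, norm_mul (wt _ _ : ℂ),
          Complex.norm_real, Complex.norm_real, Real.norm_eq_abs, Real.norm_eq_abs,
          abs_of_pos (wt_pos _ _)]
        gcongr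
        exact abs_pow_le_wt j k
    _ ≤ _ := lintegral_mul_le_sqrt (hm _ hu).aemeasurable (hm _ hw).aemeasurable
    _ = _ := by
        rw [hatNorm_eq_eLpNorm, hatNorm_eq_eLpNorm, eLpNorm_two_eq, eLpNorm_two_eq]

/-- The weighted norm of `Phi c f a` is bounded uniformly in `a`, so it comes out of the time
integral and the forcing is needed only in `L¹`. The condition `hms` matches the dual weight in `k`
with that of the bound. -/
theorem exists_pairing_bound_one (hT : 0 < T) (j : ℕ) {s m : ℝ} (hm : m ∈ Icc (0 : ℝ) 1)
    (hms : j - (s - 2) = 5 / 2 - 2 * m) :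
    ∃ C : ℝ≥0, ∀ Fhat : ℝ → ℝ → ℂ, Measurable (Function.uncurry Fhat) → ∀ f, Adm f →
      ∫⁻ a in Ioo 0 T, ∫⁻ k, ‖(I * k) ^ j * (Phi c f a k * Fhat k a)‖ₑ
        ≤ C * (∫⁻ a in Ioo 0 T, hatNorm (s - 2) fun k => Fhat k a) * hatNorm (-m) f := by
  obtain ⟨K, hK⟩ := exists_Phi_bound_of_le_one c hT hm
  refine ⟨K ^ (1 / 2 : ℝ), fun Fhat hF f hf => ?_⟩
  calc ∫⁻ a in Ioo 0 T, ∫⁻ k, ‖(I * k) ^ j * (Phi c f a k * Fhat k a)‖ₑ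
      ≤ ∫⁻ a in Ioo 0 T, ((K : ℝ≥0∞) ^ (1 / 2 : ℝ) * hatNorm (-m) f)
          * hatNorm (s - 2) fun k => Fhat k a := by
        refine setLIntegral_mono' measurableSet_Ioo fun a ha => ?_
        refine (lintegral_pow_mul_le j (s - 2) (measurable_Phi_right c hf.integrable a)
          hF.of_uncurry_right).trans ?_
        gcongr
        rw [hms, hatNorm, hatNorm, ← ENNReal.mul_rpow_of_nonneg _ _ (by norm_num)]
        gcongr
        exact hK f hf a (Ioo_subset_Icc_self ha)
    _ = _ := by
        rw [lintegral_const_mul _ (measurable_hatNorm _ hF),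
          ENNReal.coe_rpow_of_nonneg _ (by norm_num)]
        ring

/-- Only the `L²` norm in `a` of `Phi` is controlled, so a second Cauchy–Schwarz, in time, puts the
forcing in `L²`. -/
theorem exists_pairing_bound_two (hT : 0 < T) (j : ℕ) {s m : ℝ} (hm : m ∈ Icc (1 : ℝ) 2)
    (hms : j - (s - 2) = 5 / 2 - 2 * m) :
    ∃ C : ℝ≥0, ∀ Fhat : ℝ → ℝ → ℂ, Measurable (Function.uncurry Fhat) → ∀ f, Adm f →
      ∫⁻ a in Ioo 0 T, ∫⁻ k, ‖(I * k) ^ j * (Phi c f a k * Fhat k a)‖ₑ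
        ≤ C * (∫⁻ a in Ioo 0 T, (hatNorm (s - 2) fun k => Fhat k a) ^ 2) ^ (1 / 2 : ℝ)
          * hatNorm (-m) f := by
  obtain ⟨K, hK⟩ := exists_Phi_bound_of_one_le c hT hm
  refine ⟨K ^ (1 / 2 : ℝ), fun Fhat hF f hf => ?_⟩
  have hmP : Measurable fun a => hatNorm (j - (s - 2)) (Phi c f a) :=
    measurable_hatNorm (Fhat := fun k a => Phi c f a k) _
      ((measurable_Phi c hf.integrable).comp measurable_swap)
  calc ∫⁻ a in Ioo 0 T, ∫⁻ k, ‖(I * k) ^ j * (Phi c f a k * Fhat k a)‖ₑ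
      ≤ ∫⁻ a in Ioo 0 T, hatNorm (j - (s - 2)) (Phi c f a) * hatNorm (s - 2) fun k => Fhat k a :=
        lintegral_mono fun a => lintegral_pow_mul_le j (s - 2)
          (measurable_Phi_right c hf.integrable a) hF.of_uncurry_right
    _ ≤ (∫⁻ a in Ioo 0 T, hatNorm (j - (s - 2)) (Phi c f a) ^ 2) ^ (1 / 2 : ℝ)
        * (∫⁻ a in Ioo 0 T, (hatNorm (s - 2) fun k => Fhat k a) ^ 2) ^ (1 / 2 : ℝ) :=
        lintegral_mul_le_sqrt hmP.aemeasurable (measurable_hatNorm _ hF).aemeasurable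
    _ ≤ (K ^ (1 / 2 : ℝ) * hatNorm (-m) f)
        * (∫⁻ a in Ioo 0 T, (hatNorm (s - 2) fun k => Fhat k a) ^ 2) ^ (1 / 2 : ℝ) := by
        gcongr
        rw [hatNorm, ← ENNReal.mul_rpow_of_nonneg _ _ (by norm_num)]
        gcongr
        refine le_trans (le_of_eq ?_) (hK f hf)
        refine lintegral_congr fun a => ?_
        rw [hatNorm, sqrt_sq_ennreal, hms]
    _ = _ := by
        rw [ENNReal.coe_rpow_of_nonneg _ (by norm_num)]
        ring

end

/-! ### Integrability of the forcing term in time -/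

/-- Cauchy–Schwarz against the square integrable weight of order `-1`. A weighted `L¹` bound in `k`
can be exchanged with the time integral by Tonelli. -/
theorem exists_hatNorm_lintegral_bound (σ : ℝ) : ∃ C : ℝ≥0, ∀ u : ℝ → ℂ, Measurable u →
    ∫⁻ k, ENNReal.ofReal (wt (σ / 2 - 1) k) * ‖u k‖ₑ ≤ C * hatNorm σ u := by
  obtain ⟨D, hD⟩ := ENNReal.lt_iff_exists_coe.1 (lintegral_wt_lt_top (a := -2) (by norm_num))
  refine ⟨D ^ (1 / 2 : ℝ), fun u hu => ?_⟩
  calc ∫⁻ k, ENNReal.ofReal (wt (σ / 2 - 1) k) * ‖u k‖ₑ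
      = ∫⁻ k, ENNReal.ofReal (wt (-1) k) * ‖(wt (σ / 2) k : ℂ) * u k‖ₑ := by
        refine lintegral_congr fun k => ?_
        rw [enorm_mul, ← ofReal_norm ((wt (σ / 2) k : ℝ) : ℂ), Complex.norm_real, Real.norm_eq_abs,
          abs_of_pos (wt_pos _ _), ofReal_wt_mul_wt, neg_add_eq_sub]
    _ ≤ (∫⁻ k, ENNReal.ofReal (wt (-1) k) ^ 2) ^ (1 / 2 : ℝ)
        * (∫⁻ k, ‖(wt (σ / 2) k : ℂ) * u k‖ₑ ^ 2) ^ (1 / 2 : ℝ) :=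
        lintegral_mul_le_sqrt (measurable_wt _).ennreal_ofReal.aemeasurable
          ((Complex.measurable_ofReal.comp (measurable_wt _)).mul hu).enorm.aemeasurable
    _ = _ := by
        rw [← eLpNorm_two_eq, ← hatNorm_eq_eLpNorm, ENNReal.coe_rpow_of_nonneg _ (by norm_num),
          ← hD.1]
        congr 3
        ext k
        rw [← ENNReal.ofReal_pow (wt_pos _ _).le, ← Real.rpow_natCast, wt_rpow]
        norm_num

theorem lintegral_wt_mul_lt_top {T σ : ℝ} {Fhat : ℝ → ℝ → ℂ}
    (hF : Measurable (Function.uncurry Fhat))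
    (hN : ∫⁻ a in Ioo 0 T, hatNorm σ (fun k => Fhat k a) < ∞) :
    ∫⁻ k, ENNReal.ofReal (wt (σ / 2 - 1) k) * ∫⁻ a in Ioo 0 T, ‖Fhat k a‖ₑ < ∞ := by
  obtain ⟨C, hC⟩ := exists_hatNorm_lintegral_bound σ
  have hm : Measurable fun p : ℝ × ℝ => ‖Fhat p.1 p.2‖ₑ := hF.enorm
  calc ∫⁻ k, ENNReal.ofReal (wt (σ / 2 - 1) k) * ∫⁻ a in Ioo 0 T, ‖Fhat k a‖ₑ
      = ∫⁻ k, ∫⁻ a in Ioo 0 T, ENNReal.ofReal (wt (σ / 2 - 1) k) * ‖Fhat k a‖ₑ :=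
        lintegral_congr fun k => (lintegral_const_mul' _ _ ENNReal.ofReal_ne_top).symm
    _ = ∫⁻ a in Ioo 0 T, ∫⁻ k, ENNReal.ofReal (wt (σ / 2 - 1) k) * ‖Fhat k a‖ₑ :=
        lintegral_lintegral_swap
          ((((measurable_wt _).comp measurable_fst).ennreal_ofReal).mul hm).aemeasurable
    _ ≤ ∫⁻ a in Ioo 0 T, C * hatNorm σ (fun k => Fhat k a) :=
        lintegral_mono fun a => hC _ hF.of_uncurry_right
    _ < ∞ := by
        rw [lintegral_const_mul' _ _ ENNReal.coe_ne_top]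
        exact ENNReal.mul_lt_top ENNReal.coe_lt_top hN

/-- The hypothesis controls `Fhat` in `k` at fixed time, while the solution formula integrates in
time at fixed `k`. Tonelli passes from one to the other, and a finite integral with positive weight
is finite almost everywhere. -/
theorem ae_integrableOn {T σ : ℝ} {Fhat : ℝ → ℝ → ℂ} (hF : Measurable (Function.uncurry Fhat))
    (hN : ∫⁻ a in Ioo 0 T, hatNorm σ (fun k => Fhat k a) < ∞) :
    ∀ᵐ k, IntegrableOn (Fhat k) (Ioo 0 T) := by
  have h := lintegral_wt_mul_lt_top hF hN
  have hm : Measurable fun k => ∫⁻ a in Ioo 0 T, ‖Fhat k a‖ₑ :=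
    Measurable.lintegral_prod_right' (f := fun p : ℝ × ℝ => ‖Fhat p.1 p.2‖ₑ) hF.enorm
  filter_upwards [ae_lt_top (((measurable_wt _).ennreal_ofReal).mul hm) h.ne] with k hk
  refine ⟨hF.of_uncurry_left.aestronglyMeasurable, ?_⟩
  by_contra hcon
  have htop : ∫⁻ a in Ioo 0 T, ‖Fhat k a‖ₑ = ∞ := by
    simpa [HasFiniteIntegral] using hcon
  rw [Pi.mul_apply, htop, ENNReal.mul_top (by simpa using wt_pos _ _)] at hk
  exact lt_irrefl _ hk

/-! ### The Duhamel integral -/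

/-- The Duhamel integral `∫_{(0,T) ∩ (-∞,t)} sin(ω(t - a)) / ω Fhat(k, a) da`. -/
def duhamel (T : ℝ) (Fhat : ℝ → ℝ → ℂ) (t k : ℝ) : ℂ :=
  ∫ a in Ioo 0 T, (((Iio t).indicator (fun a => sinK k (t - a)) a : ℝ) : ℂ) * Fhat k a

theorem solutionHat_eq_setIntegral {Fhat : ℝ → ℝ → ℂ} {t k : ℝ} (ht : 0 ≤ t)
    (hF : IntegrableOn (Fhat k) (Ioc 0 t)) :
    solutionHat Fhat t k = ∫ a in Ioc 0 t, (sinK k (t - a) : ℂ) * Fhat k a := by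
  have hb : ∀ {e : ℝ → ℂ}, Continuous e → (∀ a, ‖e a‖ ≤ 1) →
      Integrable (fun a => e a * Fhat k a) (volume.restrict (Ioc 0 t)) := fun he he1 =>
    hF.bdd_mul he.aestronglyMeasurable (Filter.Eventually.of_forall he1)
  rw [solutionHat, intervalIntegral.integral_of_le ht, intervalIntegral.integral_of_le ht,
    ← integral_const_mul, ← integral_const_mul, ← integral_sub, ← integral_const_mul]
  · refine integral_congr_ae (Filter.Eventually.of_forall fun a => ?_)
    simp only
    rw [← mul_assoc, ← mul_assoc, ← Complex.exp_add, ← Complex.exp_add, sinK,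
      Complex.ofReal_div, Complex.ofReal_sin, Complex.sin]
    have e1 : (((omega k * (t - a) : ℝ) : ℂ) * I) = I * omega k * t + -(I * omega k * a) := by
      push_cast; ring
    have e2 : (-((omega k * (t - a) : ℝ) : ℂ) * I) = -(I * omega k * t) + I * omega k * a := by
      push_cast; ring
    -- No case distinction is needed at `omega k = 0`, where both sides are 0.
    have e3 : (1 / (2 * I * omega k) : ℂ) = -I / 2 / omega k := by
      rw [div_div, mul_assoc, one_div, mul_inv, mul_inv, Complex.inv_I, div_eq_mul_inv, mul_inv]
      ring
    rw [e1, e2, e3]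
    ring
  · exact (hb (e := fun a : ℝ => cexp (-(I * omega k * a))) (by fun_prop)
      fun a => (norm_cexp_neg_I_mul _ _).le).const_mul _
  · exact (hb (e := fun a : ℝ => cexp (I * omega k * a)) (by fun_prop)
      fun a => (norm_cexp_I_mul _ _).le).const_mul _

/-- The form with an indicator integrates over the fixed interval `(0, T)`, which is what Fubini
needs when `t` varies. -/
theorem solutionHat_eq_duhamel {T : ℝ} {Fhat : ℝ → ℝ → ℂ} {t k : ℝ} (ht : t ∈ Icc 0 T)
    (hF : IntegrableOn (Fhat k) (Ioo 0 T)) : solutionHat Fhat t k = duhamel T Fhat t k := by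
  have hsub : Ioo 0 t ⊆ Ioo 0 T := Ioo_subset_Ioo_right ht.2
  have hF' : IntegrableOn (Fhat k) (Ioc 0 t) :=
    (hF.mono_set hsub).congr_set_ae Ioo_ae_eq_Ioc.symm
  rw [solutionHat_eq_setIntegral ht.1 hF', duhamel, integral_Ioc_eq_integral_Ioo,
    ← integral_indicator measurableSet_Ioo, ← integral_indicator measurableSet_Ioo]
  congr 1
  ext a
  by_cases h1 : a ∈ Ioo 0 t
  · rw [indicator_of_mem h1, indicator_of_mem (hsub h1), indicator_of_mem (show a ∈ Iio t from h1.2)]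
  · rw [indicator_of_notMem h1]
    by_cases h2 : a ∈ Ioo 0 T
    · rw [indicator_of_mem h2, indicator_of_notMem (fun h : a ∈ Iio t => h1 ⟨h2.1, h⟩)]
      simp
    · rw [indicator_of_notMem h2]

theorem measurable_duhamel {T : ℝ} {Fhat : ℝ → ℝ → ℂ} (hF : Measurable (Function.uncurry Fhat)) :
    Measurable fun p : ℝ × ℝ => duhamel T Fhat p.1 p.2 := by
  refine (StronglyMeasurable.integral_prod_right (f := fun (p : ℝ × ℝ) (a : ℝ) =>
    ((({q : (ℝ × ℝ) × ℝ | q.2 < q.1.1}.indicator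
      (fun q => sinK q.1.2 (q.1.1 - q.2)) (p, a) : ℝ) : ℂ)) * Fhat p.2 a)
      (ν := volume.restrict (Ioo 0 T)) ?_).measurable
  refine Measurable.stronglyMeasurable (Measurable.mul ?_ ?_)
  · refine Complex.measurable_ofReal.comp (Measurable.indicator ?_ ?_)
    · exact measurable_sinK.comp (g := fun p : ℝ × ℝ => sinK p.1 p.2)
        (f := fun q : (ℝ × ℝ) × ℝ => (q.1.2, q.1.1 - q.2)) (by fun_prop)
    · exact measurableSet_lt measurable_snd (measurable_fst.comp measurable_fst)
  · exact hF.comp (f := fun q : (ℝ × ℝ) × ℝ => (q.1.2, q.2)) (by fun_prop)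

theorem enorm_indicator_sinK_le {T t a : ℝ} (k : ℝ) (ht : t ∈ Icc 0 T) (ha : a ∈ Ioo 0 T) :
    ‖(((Iio t).indicator (fun a => sinK k (t - a)) a : ℝ) : ℂ)‖ₑ ≤ ENNReal.ofReal T := by
  rw [← ofReal_norm, Complex.norm_real, Real.norm_eq_abs]
  refine ENNReal.ofReal_le_ofReal ?_
  by_cases h : a ∈ Iio t
  · have h' : a < t := h
    rw [indicator_of_mem h]
    refine (abs_sinK_le _ _).trans ?_
    rw [abs_of_pos (by linarith)]
    linarith [ha.1, ht.2]
  · rw [indicator_of_notMem h, abs_zero]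
    linarith [ha.1, ha.2]

theorem enorm_duhamel_le {T t : ℝ} (Fhat : ℝ → ℝ → ℂ) (k : ℝ) (ht : t ∈ Icc 0 T) :
    ‖duhamel T Fhat t k‖ₑ ≤ ENNReal.ofReal T * ∫⁻ a in Ioo 0 T, ‖Fhat k a‖ₑ := by
  refine (enorm_integral_le_lintegral_enorm _).trans ?_
  rw [← lintegral_const_mul' _ _ ENNReal.ofReal_ne_top]
  refine setLIntegral_mono' measurableSet_Ioo fun a ha => ?_
  rw [enorm_mul]
  gcongr
  exact enorm_indicator_sinK_le k ht ha

/-! ### Test functions on `(0, T)` -/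

theorem IsTestOn.eq_zero {T : ℝ} {η : 𝓢(ℝ, ℂ)} (hη : IsTestOn T η) {t : ℝ} (ht : t ∉ Ioo 0 T) :
    η t = 0 :=
  image_eq_zero_of_notMem_tsupport fun h => ht (hη h)

theorem IsTestOn.isCompact_tsupport {T : ℝ} {η : 𝓢(ℝ, ℂ)} (hη : IsTestOn T η) :
    IsCompact (tsupport (η : ℝ → ℂ)) :=
  isCompact_Icc.of_isClosed_subset (isClosed_tsupport _) (hη.trans Ioo_subset_Icc_self)

theorem IsTestOn.integrableOn_mul {T : ℝ} {η : 𝓢(ℝ, ℂ)} (hη : IsTestOn T η) {v : ℝ → ℂ}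
    (hv : LocallyIntegrableOn v (Ioo 0 T)) : IntegrableOn (fun t => v t * η t) (Ioo 0 T) := by
  have h1 : IntegrableOn (fun t => v t * η t) (tsupport (η : ℝ → ℂ)) := by
    have := hv.integrableOn_compact_subset hη hη.isCompact_tsupport
    exact this.mul_continuousOn η.continuous.continuousOn hη.isCompact_tsupport
  refine h1.of_forall_sdiff_eq_zero measurableSet_Ioo fun t ht => ?_
  rw [image_eq_zero_of_notMem_tsupport ht.2, mul_zero]

theorem IsTestOn.setIntegral_mul_eq {T : ℝ} {η : 𝓢(ℝ, ℂ)} (hη : IsTestOn T η) (v : ℝ → ℂ) :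
    ∫ t in Ioo 0 T, v t * η t = ∫ t, v t * η t :=
  setIntegral_eq_integral_of_forall_compl_eq_zero fun t ht => by rw [hη.eq_zero ht, mul_zero]

theorem hat_fourierSchwartzInv (η : 𝓢(ℝ, ℂ)) : hat (fourierSchwartzInv η) = η := by
  rw [← fourierSchwartz_eq_hat, fourierSchwartz_inv]

theorem abs_sinK_le_inv (k τ : ℝ) : |sinK k τ| ≤ (omega k)⁻¹ := by
  rw [sinK, abs_div, abs_of_nonneg (omega_nonneg k), div_eq_mul_inv]
  exact mul_le_of_le_one_left (inv_nonneg.2 (omega_nonneg k)) (Real.abs_sin_le_one _)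

section

variable {T : ℝ} (c : Cutoff T)

/-- Here the cutoff disappears: it equals 1 for `t ≤ T`, and `η` vanishes outside `(0, T)`. -/
theorem Phi_eq_of_isTestOn {η : 𝓢(ℝ, ℂ)} (hη : IsTestOn T η) {a : ℝ} (ha : a ∈ Ioo 0 T) (k : ℝ) :
    Phi c (fourierSchwartzInv η) a k
      = ∫ t in Ioo 0 T, (((Iio t).indicator (fun a => sinK k (t - a)) a : ℝ) : ℂ) * η t := by
  rw [Phi, sinT, hat_fourierSchwartzInv, ← integral_indicator measurableSet_Ioo,
    ← integral_indicator measurableSet_Ioc]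
  congr 1
  ext t
  by_cases hat : a < t
  · by_cases htT : t < T
    · rw [indicator_of_mem (show t ∈ Ioc a (T + 2) from ⟨hat, by linarith⟩),
        indicator_of_mem (show t ∈ Ioo 0 T from ⟨ha.1.trans hat, htT⟩),
        indicator_of_mem (show a ∈ Iio t from hat), c.eq_one t htT.le, one_mul]
    · have h0 : t ∉ Ioo 0 T := fun h => htT h.2
      rw [indicator_of_notMem h0]
      simp [indicator_apply, hη.eq_zero h0]
  · rw [indicator_of_notMem (fun h : t ∈ Ioc a (T + 2) => hat h.1)]
    simp [indicator_apply, hat]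

/-- Fubini on `(0, T)²` at fixed frequency; the kernel is bounded by `(omega k)⁻¹`, correctly also
at `k = 0` where both are 0. -/
theorem integral_duhamel_mul {Fhat : ℝ → ℝ → ℂ} {k : ℝ} (hF : IntegrableOn (Fhat k) (Ioo 0 T))
    {η : 𝓢(ℝ, ℂ)} (hη : IsTestOn T η) :
    ∫ t in Ioo 0 T, duhamel T Fhat t k * η t
      = ∫ a in Ioo 0 T, Phi c (fourierSchwartzInv η) a k * Fhat k a := by
  have hm : Measurable fun q : ℝ × ℝ =>
      (((Iio q.1).indicator (fun a => sinK k (q.1 - a)) q.2 : ℝ) : ℂ) := by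
    have : (fun q : ℝ × ℝ => (((Iio q.1).indicator (fun a => sinK k (q.1 - a)) q.2 : ℝ) : ℂ))
      = fun q => (({q : ℝ × ℝ | q.2 < q.1}.indicator (fun q => sinK k (q.1 - q.2)) q : ℝ) : ℂ) :=
      rfl
    rw [this]
    have := continuous_sinK k
    exact Complex.measurable_ofReal.comp (Measurable.indicator (by fun_prop)
      (measurableSet_lt measurable_snd measurable_fst))
  have hint : Integrable (fun q : ℝ × ℝ =>
      (((Iio q.1).indicator (fun a => sinK k (q.1 - a)) q.2 : ℝ) : ℂ) * (η q.1 * Fhat k q.2))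
      ((volume.restrict (Ioo 0 T)).prod (volume.restrict (Ioo 0 T))) := by
    refine (Integrable.mul_prod (η.integrable.restrict (s := Ioo 0 T)) hF).bdd_mul
      (c := (omega k)⁻¹) hm.aestronglyMeasurable (Filter.Eventually.of_forall fun q => ?_)
    rw [Complex.norm_real, Real.norm_eq_abs, indicator_apply]
    split_ifs
    · exact abs_sinK_le_inv _ _
    · simpa using omega_nonneg k
  calc ∫ t in Ioo 0 T, duhamel T Fhat t k * η t
      = ∫ t in Ioo 0 T, ∫ a in Ioo 0 T,
        (((Iio t).indicator (fun a => sinK k (t - a)) a : ℝ) : ℂ) * (η t * Fhat k a) := by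
        congr 1
        ext t
        rw [duhamel, ← integral_mul_const]
        congr 1
        ext a
        ring
    _ = ∫ a in Ioo 0 T, ∫ t in Ioo 0 T,
        (((Iio t).indicator (fun a => sinK k (t - a)) a : ℝ) : ℂ) * (η t * Fhat k a) :=
        integral_integral_swap hint
    _ = _ := by
        refine setIntegral_congr_fun measurableSet_Ioo fun a ha => ?_
        rw [Phi_eq_of_isTestOn c hη ha, ← integral_mul_const]
        congr 1
        ext t
        ring

/-! ### The trace functional -/

theorem Adm.of_schwartz (φ : 𝓢(ℝ, ℂ)) : Adm φ :=
  ⟨φ.continuous.measurable, φ.integrable, φ.memLp 2⟩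

/-- The density, in `(a, k)`, of the trace functional. -/
def traceDensity (j : ℕ) (Fhat : ℝ → ℝ → ℂ) (f : ℝ → ℂ) (p : ℝ × ℝ) : ℂ :=
  (I * p.2) ^ j * (Phi c f p.1 p.2 * Fhat p.2 p.1)

theorem measurable_traceDensity (j : ℕ) {Fhat : ℝ → ℝ → ℂ}
    (hF : Measurable (Function.uncurry Fhat)) {f : ℝ → ℂ} (hf : Integrable f) :
    Measurable (traceDensity c j Fhat f) := by
  refine Measurable.mul (by fun_prop) ((measurable_Phi c hf).mul ?_)
  exact hF.comp measurable_swap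

/-- The functional that the trace `∂_x^j Z(x, ·)` defines on test functions `hat f`. -/
def traceFun (j : ℕ) (Fhat : ℝ → ℝ → ℂ) (x : ℝ) (f : ℝ → ℂ) : ℂ :=
  (2 * Real.pi : ℂ)⁻¹ * ∫ p : ℝ × ℝ, cexp (I * p.2 * x) * traceDensity c j Fhat f p
    ∂((volume.restrict (Ioo 0 T)).prod volume)

/-- The trace functional of the given order, with the forcing term `Fhat`, is bounded on
`H^{-m}`. -/
def TraceBound (j : ℕ) (m : ℝ) (Fhat : ℝ → ℝ → ℂ) (L : ℝ≥0) : Prop :=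
  ∀ f, Adm f → ∫⁻ a in Ioo 0 T, ∫⁻ k, ‖(I * k) ^ j * (Phi c f a k * Fhat k a)‖ₑ
    ≤ L * hatNorm (-m) f

variable {c} {j : ℕ} {m : ℝ} {Fhat : ℝ → ℝ → ℂ} {L : ℝ≥0}

theorem hatNorm_schwartz_lt_top (σ : ℝ) (φ : 𝓢(ℝ, ℂ)) : hatNorm σ φ < ∞ := by
  rw [hatNorm_eq_eLpNorm]
  have := (wtMul (σ / 2) φ).memLp 2
  have e : ⇑(wtMul (σ / 2) φ) = fun k => (wt (σ / 2) k : ℂ) * φ k :=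
    funext (wtMul_apply _ φ)
  rw [e] at this
  exact this.2

theorem TraceBound.lintegral_le (h : TraceBound c j m Fhat L)
    (hF : Measurable (Function.uncurry Fhat)) {f : ℝ → ℂ} (hf : Adm f) :
    ∫⁻ p, ‖traceDensity c j Fhat f p‖ₑ ∂((volume.restrict (Ioo 0 T)).prod volume)
      ≤ L * hatNorm (-m) f := by
  rw [lintegral_prod _ (measurable_traceDensity c j hF hf.integrable).enorm.aemeasurable]
  exact h f hf

theorem TraceBound.integrable (h : TraceBound c j m Fhat L)
    (hF : Measurable (Function.uncurry Fhat)) (φ : 𝓢(ℝ, ℂ)) :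
    Integrable (traceDensity c j Fhat φ) ((volume.restrict (Ioo 0 T)).prod volume) := by
  refine ⟨(measurable_traceDensity c j hF φ.integrable).aestronglyMeasurable, ?_⟩
  exact (h.lintegral_le hF (.of_schwartz φ)).trans_lt
    (ENNReal.mul_lt_top ENNReal.coe_lt_top (hatNorm_schwartz_lt_top _ φ))

theorem TraceBound.integrable_exp (h : TraceBound c j m Fhat L)
    (hF : Measurable (Function.uncurry Fhat)) (φ : 𝓢(ℝ, ℂ)) (x : ℝ) :
    Integrable (fun p : ℝ × ℝ => cexp (I * p.2 * x) * traceDensity c j Fhat φ p)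
      ((volume.restrict (Ioo 0 T)).prod volume) :=
  (h.integrable hF φ).bdd_mul (c := 1) (by fun_prop)
    (Filter.Eventually.of_forall fun p => (norm_cexp_I_mul _ _).le)

theorem Phi_smul (z : ℂ) (f : ℝ → ℂ) (a k : ℝ) :
    Phi c (fun x => z * f x) a k = z * Phi c f a k := by
  have h : ∀ t, hat (fun x => z * f x) t = z * hat f t := fun t => by
    rw [hat, hat, ← integral_const_mul]
    simp_rw [mul_left_comm]
  rw [Phi, Phi, sinT, sinT, ← integral_const_mul]
  simp_rw [h]
  congr 1
  ext t
  ring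

/-- The trace functional as a linear functional. -/
def TraceBound.linearMap (h : TraceBound c j m Fhat L) (hF : Measurable (Function.uncurry Fhat))
    (x : ℝ) : 𝓢(ℝ, ℂ) →ₗ[ℂ] ℂ where
  toFun φ := traceFun c j Fhat x φ
  map_add' φ ψ := by
    rw [traceFun, traceFun, traceFun, ← mul_add, ← integral_add (h.integrable_exp hF φ x)
      (h.integrable_exp hF ψ x)]
    congr 2
    ext p
    have : Phi c ⇑(φ + ψ) p.1 p.2 = Phi c φ p.1 p.2 + Phi c ψ p.1 p.2 :=
      Phi_add c φ.integrable ψ.integrable _ _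
    rw [traceDensity, traceDensity, traceDensity, this]
    ring
  map_smul' z φ := by
    rw [traceFun, traceFun, RingHom.id_apply, smul_eq_mul, mul_left_comm z, ← integral_const_mul z]
    congr 2
    ext p
    have : Phi c ⇑(z • φ) p.1 p.2 = z * Phi c φ p.1 p.2 := Phi_smul z φ _ _
    rw [traceDensity, traceDensity, this]
    ring

theorem TraceBound.enorm_le (h : TraceBound c j m Fhat L)
    (hF : Measurable (Function.uncurry Fhat)) (x : ℝ) {f : ℝ → ℂ} (hf : Adm f) :
    ‖traceFun c j Fhat x f‖ₑ ≤ L * hatNorm (-m) f := by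
  have h1 : ‖(2 * Real.pi : ℂ)⁻¹‖ₑ ≤ 1 := by
    rw [← ofReal_norm, norm_inv, norm_mul, Complex.norm_real, Real.norm_eq_abs,
      abs_of_pos Real.pi_pos, Complex.norm_ofNat]
    exact ENNReal.ofReal_le_one.2 (inv_le_one_of_one_le₀ (by linarith [Real.pi_gt_three]))
  rw [traceFun, enorm_mul]
  refine (mul_le_mul' h1 (enorm_integral_le_lintegral_enorm _)).trans ?_
  rw [one_mul]
  refine le_trans (le_of_eq ?_) (h.lintegral_le hF hf)
  refine lintegral_congr fun p => ?_
  rw [enorm_mul, ← ofReal_norm (cexp _), norm_cexp_I_mul, ENNReal.ofReal_one, one_mul]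

theorem TraceBound.continuous (h : TraceBound c j m Fhat L)
    (hF : Measurable (Function.uncurry Fhat)) (φ : 𝓢(ℝ, ℂ)) :
    Continuous fun x => traceFun c j Fhat x φ := by
  refine continuous_const.mul (continuous_of_dominated (bound := fun p => ‖traceDensity c j Fhat φ p‖)
    (fun x => (h.integrable_exp hF φ x).aestronglyMeasurable) (fun x => ?_)
    (h.integrable hF φ).norm ?_)
  · refine Filter.Eventually.of_forall fun p => ?_
    rw [norm_mul, norm_cexp_I_mul, one_mul]
  · exact Filter.Eventually.of_forall fun p => by fun_prop

/-- Riesz representation in the weighted space gives `u` in `L²` of norm at most `L`. The Fourier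
density `wt (-m / 2) * u` then has `H^m` norm exactly that of `u`. As the functional is defined on
all Schwartz functions, `G` lives on the whole line. -/
theorem TraceBound.exists_extension (h : TraceBound c j m Fhat L)
    (hF : Measurable (Function.uncurry Fhat)) (x : ℝ) :
    ∃ G : 𝓢'(ℝ, ℂ), sobolevENorm m G ≤ L ∧
      ∀ η, G η = traceFun c j Fhat x (fourierSchwartzInv η) := by
  obtain ⟨u, hu, huL, hrep⟩ := exists_memLp_repr
    (ι := { toFun := fun φ : 𝓢(ℝ, ℂ) => (wtMul (-m / 2) φ : ℝ → ℂ)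
            map_add' := fun φ ψ => by rw [map_add]; rfl
            map_smul' := fun z φ => by rw [map_smul]; rfl })
    (fun φ => (wtMul (-m / 2) φ).memLp 2) (h.linearMap hF x) L (fun φ => by
      refine (h.enorm_le hF x (.of_schwartz φ)).trans_eq ?_
      rw [hatNorm_eq_eLpNorm]
      congr 2
      exact funext fun k => (wtMul_apply _ φ k).symm)
  have e : (fun k => (wt (m / 2) k : ℂ) * ((wt (-m / 2) k : ℂ) * u k)) = u := by
    ext k
    rw [← mul_assoc, ← Complex.ofReal_mul, ← wt_add]
    simp [neg_div, wt_zero]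
  obtain ⟨G, hG⟩ := exists_isFourierDensity (a := m / 2) (g := fun k => (wt (-m / 2) k : ℂ) * u k)
    (by rw [e]; exact hu)
  refine ⟨G, ?_, fun η => ?_⟩
  · rw [sobolevENorm_eq hG]
    change eLpNorm (fun k => (wt (m / 2) k : ℂ) * ((wt (-m / 2) k : ℂ) * u k)) 2 volume ≤ L
    rw [e]
    exact huL
  · rw [hG.apply_eq]
    refine Eq.trans ?_ (hrep _).symm
    refine integral_congr_ae (Filter.Eventually.of_forall fun k => ?_)
    change _ = u k * wtMul (-m / 2) (fourierSchwartzInv η) k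
    rw [wtMul_apply]
    ring

theorem exists_lintegral_fourierSchwartzInv_le : ∃ C : ℝ≥0, ∀ η : 𝓢(ℝ, ℂ),
    hatNorm 0 (fourierSchwartzInv η) ≤ C * eLpNorm η 2 volume := by
  refine ⟨((2 * Real.pi)⁻¹ ^ (1 / 2 : ℝ)).toNNReal, fun η => ?_⟩
  have h := lintegral_hat_sq (fourierSchwartzInv η).integrable ((fourierSchwartzInv η).memLp 2)
  rw [hat_fourierSchwartzInv] at h
  have hpi : (0 : ℝ) < 2 * Real.pi := by positivity
  have h2 : ∫⁻ x, ‖fourierSchwartzInv η x‖ₑ ^ 2 = ENNReal.ofReal (2 * Real.pi)⁻¹ *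
      ∫⁻ x, ‖η x‖ₑ ^ 2 := by
    rw [h, ← mul_assoc, ← ENNReal.ofReal_mul (by positivity), inv_mul_cancel₀ hpi.ne',
      ENNReal.ofReal_one, one_mul]
  rw [hatNorm, eLpNorm_two_eq]
  simp only [wt_zero, ENNReal.ofReal_one, one_mul]
  rw [h2, ENNReal.mul_rpow_of_nonneg _ _ (by norm_num), ENNReal.ofReal_rpow_of_pos (by positivity)]
  rfl

theorem hatNorm_mono {σ τ : ℝ} (h : σ ≤ τ) (u : ℝ → ℂ) : hatNorm σ u ≤ hatNorm τ u := by
  unfold hatNorm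
  gcongr
  exact wt_mono h _

/-- For `m ≥ 0` the `H^{-m}` norm is dominated by the `L²` norm, so the functional is also bounded
in `L²` and is represented by a function. -/
theorem TraceBound.exists_trace (h : TraceBound c j m Fhat L) (hm : 0 ≤ m)
    (hF : Measurable (Function.uncurry Fhat)) (x : ℝ) :
    ∃ v : ℝ → ℂ, MemLp v 2 ∧
      ∀ η, ∫ t, v t * η t = traceFun c j Fhat x (fourierSchwartzInv η) := by
  obtain ⟨C, hC⟩ := exists_lintegral_fourierSchwartzInv_le
  obtain ⟨u, hu, -, hrep⟩ := exists_memLp_repr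
    (ι := { toFun := fun φ : 𝓢(ℝ, ℂ) => (φ : ℝ → ℂ)
            map_add' := fun φ ψ => rfl
            map_smul' := fun z φ => rfl })
    (fun φ => φ.memLp 2) ((h.linearMap hF x).comp fourierSchwartzInv.toLinearMap) (L * C)
    (fun η => by
      refine (h.enorm_le hF x (.of_schwartz _)).trans ?_
      rw [ENNReal.coe_mul, mul_assoc]
      gcongr
      exact (hatNorm_mono (by linarith) _).trans (hC η))
  exact ⟨u, hu, fun η => (hrep η).symm⟩

theorem TraceBound.integral_traceFun_mul (h : TraceBound c j m Fhat L)
    (hF : Measurable (Function.uncurry Fhat)) (φ ψ : 𝓢(ℝ, ℂ)) :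
    ∫ x, traceFun c j Fhat x φ * ψ x
      = ∫ k, fourierSchwartzInv ψ k * ((I * k) ^ j * ∫ a in Ioo 0 T, Phi c φ a k * Fhat k a) := by
  have hint := h.integrable hF φ
  have hprod : Integrable (fun q : ℝ × (ℝ × ℝ) =>
      cexp (I * q.2.2 * q.1) * (ψ q.1 * traceDensity c j Fhat φ q.2))
      (volume.prod ((volume.restrict (Ioo 0 T)).prod volume)) :=
    (Integrable.mul_prod ψ.integrable hint).bdd_mul (c := 1) (by fun_prop)
      (Filter.Eventually.of_forall fun p => (norm_cexp_I_mul _ _).le)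
  have hint2 : Integrable (fun p : ℝ × ℝ => fourierSchwartzInv ψ p.2 * traceDensity c j Fhat φ p)
      ((volume.restrict (Ioo 0 T)).prod volume) := by
    refine hint.bdd_mul (c := ‖(fourierSchwartzInv ψ).toBoundedContinuousFunction‖) ?_
      (Filter.Eventually.of_forall fun p =>
        (fourierSchwartzInv ψ).toBoundedContinuousFunction.norm_coe_le_norm p.2)
    exact ((fourierSchwartzInv ψ).continuous.comp continuous_snd).aestronglyMeasurable
  calc ∫ x, traceFun c j Fhat x φ * ψ x
      = (2 * Real.pi : ℂ)⁻¹ * ∫ x : ℝ, ∫ p : ℝ × ℝ, cexp (I * p.2 * x) * (ψ x * traceDensity c j Fhat φ p)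
        ∂((volume.restrict (Ioo 0 T)).prod volume) := by
        rw [← integral_const_mul]
        congr 1
        ext x
        rw [traceFun, mul_assoc, ← integral_mul_const]
        congr 2
        ext p
        ring
    _ = (2 * Real.pi : ℂ)⁻¹ * ∫ p : ℝ × ℝ, (∫ x : ℝ, cexp (I * p.2 * x) *
        (ψ x * traceDensity c j Fhat φ p)) ∂((volume.restrict (Ioo 0 T)).prod volume) := by
        rw [integral_integral_swap hprod]
    _ = ∫ p : ℝ × ℝ, fourierSchwartzInv ψ p.2 * traceDensity c j Fhat φ p
        ∂((volume.restrict (Ioo 0 T)).prod volume) := by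
        rw [← integral_const_mul]
        congr 1
        ext p
        rw [fourierSchwartzInv_apply, mul_assoc, ← integral_mul_const]
        congr 2
        ext x
        ring
    _ = ∫ k, ∫ a in Ioo 0 T, fourierSchwartzInv ψ k * traceDensity c j Fhat φ (a, k) :=
        integral_prod_symm _ hint2
    _ = _ := by
        congr 1
        ext k
        rw [integral_const_mul]
        congr 1
        rw [← integral_const_mul]
        rfl

end

/-! ### Norms of the forcing term -/

theorem IsSpatialFourier.sobolevENorm_ae_eq {T : ℝ} {F : ℝ → 𝓢'(ℝ, ℂ)} {Fhat : ℝ → ℝ → ℂ}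
    (h : IsSpatialFourier T F Fhat) (σ : ℝ) :
    (fun t => sobolevENorm σ (F t)) =ᵐ[volume.restrict (Ioo 0 T)]
      fun t => hatNorm σ fun k => Fhat k t := by
  filter_upwards [h.2] with t ht
  rw [sobolevENorm_eq ht, hatNorm_eq_eLpNorm]
  rfl

theorem IsSpatialFourier.bochnerENorm_one {T : ℝ} {F : ℝ → 𝓢'(ℝ, ℂ)} {Fhat : ℝ → ℝ → ℂ}
    (h : IsSpatialFourier T F Fhat) (σ : ℝ) :
    bochnerENorm 1 σ T F = ∫⁻ t in Ioo 0 T, hatNorm σ fun k => Fhat k t := by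
  rw [bochnerENorm, eLpNorm_congr_ae (h.sobolevENorm_ae_eq σ), eLpNorm_one_eq_lintegral_enorm]
  rfl

theorem IsSpatialFourier.bochnerENorm_two {T : ℝ} {F : ℝ → 𝓢'(ℝ, ℂ)} {Fhat : ℝ → ℝ → ℂ}
    (h : IsSpatialFourier T F Fhat) (σ : ℝ) :
    bochnerENorm 2 σ T F
      = (∫⁻ t in Ioo 0 T, (hatNorm σ fun k => Fhat k t) ^ 2) ^ (1 / 2 : ℝ) := by
  rw [bochnerENorm, eLpNorm_congr_ae (h.sobolevENorm_ae_eq σ), eLpNorm_two_eq]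
  rfl

/-- Square integrability in time on a bounded interval gives integrability, which is all that the
solution formula and the Fubini arguments use. -/
theorem IsSpatialFourier.lintegral_hatNorm_lt_top_of_two {T : ℝ} {F : ℝ → 𝓢'(ℝ, ℂ)}
    {Fhat : ℝ → ℝ → ℂ} (h : IsSpatialFourier T F Fhat) {σ : ℝ}
    (hB : bochnerENorm 2 σ T F < ∞) :
    ∫⁻ t in Ioo 0 T, hatNorm σ (fun k => Fhat k t) < ∞ := by
  rw [h.bochnerENorm_two] at hB
  calc ∫⁻ t in Ioo 0 T, hatNorm σ (fun k => Fhat k t)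
      = ∫⁻ t in Ioo 0 T, 1 * hatNorm σ (fun k => Fhat k t) := by simp_rw [one_mul]
    _ ≤ (∫⁻ t in Ioo 0 T, 1 ^ 2) ^ (1 / 2 : ℝ)
        * (∫⁻ t in Ioo 0 T, (hatNorm σ fun k => Fhat k t) ^ 2) ^ (1 / 2 : ℝ) :=
        lintegral_mul_le_sqrt aemeasurable_const (measurable_hatNorm _ h.1).aemeasurable
    _ < ∞ := by
        refine ENNReal.mul_lt_top (ENNReal.rpow_lt_top_of_nonneg (by norm_num) ?_) hB
        simp

/-! ### Pairing with test functions -/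

theorem exists_enorm_schwartz_le (a : ℝ) (φ : 𝓢(ℝ, ℂ)) :
    ∃ M : ℝ≥0, ∀ k, ‖φ k‖ₑ ≤ M * ENNReal.ofReal (wt a k) := by
  refine ⟨‖(wtMul (-a) φ).toBoundedContinuousFunction‖₊, fun k => ?_⟩
  have h := (wtMul (-a) φ).toBoundedContinuousFunction.nnnorm_coe_le_nnnorm k
  have e : φ k = wtMul (-a) φ k * (wt a k : ℂ) := by
    rw [wtMul_apply, mul_right_comm, ← Complex.ofReal_mul, ← wt_add]
    simp [wt_zero]
  rw [e, enorm_mul, ← ofReal_norm ((wt a k : ℝ) : ℂ), Complex.norm_real, Real.norm_eq_abs,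
    abs_of_pos (wt_pos _ _)]
  gcongr
  exact ENNReal.coe_le_coe.2 h

section

variable {T σ : ℝ} {Fhat : ℝ → ℝ → ℂ}

theorem lintegral_mul_schwartz_lt_top (hF : Measurable (Function.uncurry Fhat))
    (hN : ∫⁻ a in Ioo 0 T, hatNorm σ (fun k => Fhat k a) < ∞) (φ : 𝓢(ℝ, ℂ)) :
    ∫⁻ k, (∫⁻ a in Ioo 0 T, ‖Fhat k a‖ₑ) * ‖φ k‖ₑ < ∞ := by
  obtain ⟨M, hM⟩ := exists_enorm_schwartz_le (σ / 2 - 1) φ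
  calc ∫⁻ k, (∫⁻ a in Ioo 0 T, ‖Fhat k a‖ₑ) * ‖φ k‖ₑ
      ≤ ∫⁻ k, M * (ENNReal.ofReal (wt (σ / 2 - 1) k) * ∫⁻ a in Ioo 0 T, ‖Fhat k a‖ₑ) := by
        refine lintegral_mono fun k => ?_
        rw [← mul_assoc, mul_comm]
        exact mul_le_mul' (hM k) le_rfl
    _ = M * ∫⁻ k, ENNReal.ofReal (wt (σ / 2 - 1) k) * ∫⁻ a in Ioo 0 T, ‖Fhat k a‖ₑ :=
        lintegral_const_mul' _ _ ENNReal.coe_ne_top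
    _ < ∞ := ENNReal.mul_lt_top ENNReal.coe_lt_top (lintegral_wt_mul_lt_top hF hN)

theorem integrable_duhamel_mul (hF : Measurable (Function.uncurry Fhat))
    (hN : ∫⁻ a in Ioo 0 T, hatNorm σ (fun k => Fhat k a) < ∞) (φ : 𝓢(ℝ, ℂ)) :
    Integrable (fun p : ℝ × ℝ => duhamel T Fhat p.1 p.2 * φ p.2)
      ((volume.restrict (Ioo 0 T)).prod volume) := by
  have hm : Measurable fun p : ℝ × ℝ => duhamel T Fhat p.1 p.2 * φ p.2 :=
    (measurable_duhamel hF).mul (φ.continuous.measurable.comp measurable_snd)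
  refine ⟨hm.aestronglyMeasurable, ?_⟩
  rw [HasFiniteIntegral, lintegral_prod _ hm.enorm.aemeasurable]
  calc ∫⁻ t in Ioo 0 T, ∫⁻ k, ‖duhamel T Fhat t k * φ k‖ₑ
      ≤ ∫⁻ t in Ioo 0 T, ENNReal.ofReal T * ∫⁻ k, (∫⁻ a in Ioo 0 T, ‖Fhat k a‖ₑ) * ‖φ k‖ₑ := by
        refine setLIntegral_mono' measurableSet_Ioo fun t ht => ?_
        rw [← lintegral_const_mul' _ _ ENNReal.ofReal_ne_top]
        refine lintegral_mono fun k => ?_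
        rw [enorm_mul, ← mul_assoc]
        gcongr
        exact enorm_duhamel_le Fhat k (Ioo_subset_Icc_self ht)
    _ < ∞ := by
        rw [setLIntegral_const]
        refine ENNReal.mul_lt_top (ENNReal.mul_lt_top ENNReal.ofReal_lt_top
          (lintegral_mul_schwartz_lt_top hF hN φ)) ?_
        rw [Real.volume_Ioo]
        exact ENNReal.ofReal_lt_top

theorem IsFourierDensity.apply_eq_duhamel {f : 𝓢'(ℝ, ℂ)} {t : ℝ}
    (hf : IsFourierDensity f (solutionHat Fhat t)) (ht : t ∈ Icc 0 T)
    (hF : Measurable (Function.uncurry Fhat))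
    (hN : ∫⁻ a in Ioo 0 T, hatNorm σ (fun k => Fhat k a) < ∞) (ψ : 𝓢(ℝ, ℂ)) :
    f ψ = ∫ k, duhamel T Fhat t k * fourierSchwartzInv ψ k := by
  rw [hf.apply_eq]
  refine integral_congr_ae ?_
  filter_upwards [ae_integrableOn hF hN] with k hk
  rw [solutionHat_eq_duhamel ht hk]

/-- Fubini twice: in `(t, k)` to bring the frequency outside, then in `(t, a)` for almost every `k`
through `integral_duhamel_mul`. -/
theorem setIntegral_solution_mul (c : Cutoff T) {Z : ℝ → 𝓢'(ℝ, ℂ)}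
    (hZ : ∀ t ∈ Icc 0 T, IsFourierDensity (Z t) (solutionHat Fhat t))
    (hF : Measurable (Function.uncurry Fhat))
    (hN : ∫⁻ a in Ioo 0 T, hatNorm σ (fun k => Fhat k a) < ∞) {η : 𝓢(ℝ, ℂ)} (hη : IsTestOn T η)
    (ψ : 𝓢(ℝ, ℂ)) :
    ∫ t in Ioo 0 T, Z t ψ * η t = ∫ k, fourierSchwartzInv ψ k *
      ∫ a in Ioo 0 T, Phi c (fourierSchwartzInv η) a k * Fhat k a := by
  have hint : Integrable (fun p : ℝ × ℝ =>
      η p.1 * (duhamel T Fhat p.1 p.2 * fourierSchwartzInv ψ p.2))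
      ((volume.restrict (Ioo 0 T)).prod volume) := by
    refine (integrable_duhamel_mul hF hN _).bdd_mul (c := ‖η.toBoundedContinuousFunction‖) ?_
      (Filter.Eventually.of_forall fun p =>
        η.toBoundedContinuousFunction.norm_coe_le_norm p.1)
    exact (η.continuous.comp continuous_fst).aestronglyMeasurable
  calc ∫ t in Ioo 0 T, Z t ψ * η t
      = ∫ t in Ioo 0 T, ∫ k, η t * (duhamel T Fhat t k * fourierSchwartzInv ψ k) := by
        refine setIntegral_congr_fun measurableSet_Ioo fun t ht => ?_
        have ht' := Ioo_subset_Icc_self ht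
        rw [(hZ t ht').apply_eq_duhamel ht' hF hN, integral_const_mul (η t), mul_comm]
    _ = ∫ k, ∫ t in Ioo 0 T, η t * (duhamel T Fhat t k * fourierSchwartzInv ψ k) :=
        integral_integral_swap hint
    _ = _ := by
        refine integral_congr_ae ?_
        filter_upwards [ae_integrableOn hF hN] with k hk
        rw [← integral_duhamel_mul c hk hη, ← integral_const_mul (fourierSchwartzInv ψ k)]
        congr 1
        ext t
        ring

end

/-! ### Derivatives under the inverse Fourier transform -/

theorem fourierSchwartzInv_deriv (ψ : 𝓢(ℝ, ℂ)) (k : ℝ) :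
    fourierSchwartzInv (SchwartzMap.derivCLM ℂ ℂ ψ) k = -(I * k) * fourierSchwartzInv ψ k := by
  have he : ∀ x : ℝ, HasDerivAt (fun x : ℝ => cexp (I * k * x)) (I * k * cexp (I * k * x)) x := by
    intro x
    have h1 : HasDerivAt (fun x : ℝ => I * k * (x : ℂ)) (I * k) x := by
      simpa using (Complex.ofRealCLM.hasDerivAt (x := x)).const_mul (I * k : ℂ)
    simpa [mul_comm] using h1.cexp
  have hb : ∀ φ : 𝓢(ℝ, ℂ), Integrable fun x : ℝ => cexp (I * k * x) * φ x := fun φ =>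
    φ.integrable.bdd_mul (c := 1) (by fun_prop)
      (Filter.Eventually.of_forall fun x => (norm_cexp_I_mul _ _).le)
  have key := integral_mul_deriv_eq_deriv_mul_of_integrable (u := fun x : ℝ => cexp (I * k * x))
    (v := ψ) (u' := fun x : ℝ => I * k * cexp (I * k * x)) (v' := SchwartzMap.derivCLM ℂ ℂ ψ)
    (fun x _ => he x) (fun x _ => ψ.differentiableAt.hasDerivAt) (hb _)
    (by simpa [Pi.mul_def, mul_assoc] using (hb ψ).const_mul (I * k)) (hb ψ)
  rw [fourierSchwartzInv_apply, fourierSchwartzInv_apply, key]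
  simp_rw [mul_assoc (I * k : ℂ)]
  rw [integral_const_mul (I * k : ℂ)]
  ring

theorem fourierSchwartzInv_iterate_deriv (j : ℕ) (ψ : 𝓢(ℝ, ℂ)) (k : ℝ) :
    fourierSchwartzInv ((SchwartzMap.derivCLM ℂ ℂ)^[j] ψ) k
      = (-(I * k)) ^ j * fourierSchwartzInv ψ k := by
  induction j with
  | zero => simp
  | succ j ih => rw [Function.iterate_succ_apply', fourierSchwartzInv_deriv, ih]; ring

/-! ### The time trace -/

section

variable {T σ m : ℝ} {c : Cutoff T} {j : ℕ} {Fhat : ℝ → ℝ → ℂ} {L : ℝ≥0}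

/-- Both sides reduce to the same integral over `k`: moving `j` derivatives to `ψ` gives `(-1)^j
(-(ik))^j = (ik)^j`. -/
theorem TraceBound.integral_traceFun_mul_eq (h : TraceBound c j m Fhat L) {Z : ℝ → 𝓢'(ℝ, ℂ)}
    (hZ : ∀ t ∈ Icc 0 T, IsFourierDensity (Z t) (solutionHat Fhat t))
    (hF : Measurable (Function.uncurry Fhat))
    (hN : ∫⁻ a in Ioo 0 T, hatNorm σ (fun k => Fhat k a) < ∞) {η : 𝓢(ℝ, ℂ)} (hη : IsTestOn T η)
    (ψ : 𝓢(ℝ, ℂ)) :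
    ∫ x, traceFun c j Fhat x (fourierSchwartzInv η) * ψ x
      = (-1) ^ j * ∫ t in Ioo 0 T, Z t ((SchwartzMap.derivCLM ℂ ℂ)^[j] ψ) * η t := by
  rw [setIntegral_solution_mul c hZ hF hN hη, h.integral_traceFun_mul hF,
    ← integral_const_mul ((-1 : ℂ) ^ j)]
  congr 1
  ext k
  have e : (-1 : ℂ) ^ j * (-(I * k)) ^ j = (I * k) ^ j := by rw [← mul_pow]; simp
  rw [fourierSchwartzInv_iterate_deriv, ← e]
  ring

theorem TraceBound.exists_isTimeTrace (h : TraceBound c j m Fhat L) (hm : 0 ≤ m)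
    {Z : ℝ → 𝓢'(ℝ, ℂ)} (hZ : ∀ t ∈ Icc 0 T, IsFourierDensity (Z t) (solutionHat Fhat t))
    (hF : Measurable (Function.uncurry Fhat))
    (hN : ∫⁻ a in Ioo 0 T, hatNorm σ (fun k => Fhat k a) < ∞) :
    ∃ v : ℝ → ℝ → ℂ, IsTimeTrace j T Z v := by
  choose v hv hrep using h.exists_trace hm hF
  have key : ∀ η : 𝓢(ℝ, ℂ), IsTestOn T η → ∀ x,
      ∫ t in Ioo 0 T, v x t * η t = traceFun c j Fhat x (fourierSchwartzInv η) :=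
    fun η hη x => by rw [hη.setIntegral_mul_eq, hrep]
  refine ⟨v, fun x => ((hv x).locallyIntegrable (by norm_num)).locallyIntegrableOn _,
    fun η hη => ?_⟩
  simp_rw [key η hη]
  exact ⟨h.continuous hF _, fun ψ _ => h.integral_traceFun_mul_eq hZ hF hN hη ψ⟩

/-- Continuity upgrades equality almost everywhere to equality at each point. This is what makes the
time estimate valid for every single `x`. -/
theorem eq_of_forall_integral_mul_schwartz {f g : ℝ → ℂ} (hf : Continuous f) (hg : Continuous g)
    (h : ∀ ψ : 𝓢(ℝ, ℂ), HasCompactSupport (ψ : ℝ → ℂ) → ∫ x, f x * ψ x = ∫ x, g x * ψ x) :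
    f = g := by
  refine (Continuous.ae_eq_iff_eq volume hf hg).1 ?_
  refine ae_eq_of_integral_contDiff_smul_eq hf.locallyIntegrable hg.locallyIntegrable
    fun u hu hus => ?_
  obtain ⟨G, hG, hGs⟩ := exists_schwartz_of_contDiff hu hus
  have := h G hGs
  simp_rw [hG] at this
  simpa [Complex.real_smul, mul_comm] using this

/-- Any trace `v` pairs with test functions as `traceFun` does, since both pairings are continuous
in `x` and agree as distributions. Hence the extension of the functional at `x` extends `v x`. -/
theorem TraceBound.sobolevENormOn_le (h : TraceBound c j m Fhat L)
    {Z : ℝ → 𝓢'(ℝ, ℂ)} (hZ : ∀ t ∈ Icc 0 T, IsFourierDensity (Z t) (solutionHat Fhat t))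
    (hF : Measurable (Function.uncurry Fhat))
    (hN : ∫⁻ a in Ioo 0 T, hatNorm σ (fun k => Fhat k a) < ∞) {v : ℝ → ℝ → ℂ}
    (hv : IsTimeTrace j T Z v) (x : ℝ) : sobolevENormOn m T (v x) ≤ L := by
  obtain ⟨G, hGL, hG⟩ := h.exists_extension hF x
  refine (iInf₂_le G fun η hη => ⟨hη.integrableOn_mul (hv.1 x), ?_⟩).trans hGL
  rw [hG]
  have := eq_of_forall_integral_mul_schwartz (h.continuous hF (fourierSchwartzInv η))
    (hv.2 η hη).1 fun ψ hψ => by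
      rw [(hv.2 η hη).2 ψ hψ, h.integral_traceFun_mul_eq hZ hF hN hη]
  exact congrFun this x

end

/-! ### Norms of Duhamel integrals -/

/-- Minkowski's inequality after splitting the weight: `δ` goes with the kernel, `σ / 2` with the
forcing. The constant therefore does not depend on `σ`. -/
theorem hatNorm_setIntegral_mul_le {T : ℝ} {Fhat : ℝ → ℝ → ℂ}
    (hF : Measurable (Function.uncurry Fhat)) {δ : ℝ} {C : ℝ≥0} {K : ℝ → ℝ → ℂ}
    (hK : ∀ k, ∀ a ∈ Ioo 0 T, ENNReal.ofReal (wt δ k) * ‖K k a‖ₑ ≤ C) (σ : ℝ) :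
    hatNorm (σ + 2 * δ) (fun k => ∫ a in Ioo 0 T, K k a * Fhat k a)
      ≤ C * ∫⁻ a in Ioo 0 T, hatNorm σ fun k => Fhat k a := by
  have hm : Measurable (Function.uncurry fun k a => ‖(wt (σ / 2) k : ℂ) * Fhat k a‖ₑ) :=
    ((Complex.measurable_ofReal.comp ((measurable_wt _).comp measurable_fst)).mul hF).enorm
  have he : ∀ (b k : ℝ) (z : ℂ), ‖(wt b k : ℂ) * z‖ₑ = ENNReal.ofReal (wt b k) * ‖z‖ₑ :=
    fun b k z => by
      rw [enorm_mul, ← ofReal_norm ((wt b k : ℝ) : ℂ), Complex.norm_real, Real.norm_eq_abs,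
        abs_of_pos (wt_pos _ _)]
  have hpt : ∀ k, ‖(wt ((σ + 2 * δ) / 2) k : ℂ) * ∫ a in Ioo 0 T, K k a * Fhat k a‖ₑ
      ≤ C * ∫⁻ a in Ioo 0 T, ‖(wt (σ / 2) k : ℂ) * Fhat k a‖ₑ := fun k => by
    rw [he]
    refine (mul_le_mul' le_rfl (enorm_integral_le_lintegral_enorm _)).trans ?_
    rw [← lintegral_const_mul' _ _ ENNReal.ofReal_ne_top,
      ← lintegral_const_mul' _ _ ENNReal.coe_ne_top]
    refine setLIntegral_mono' measurableSet_Ioo fun a ha => ?_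
    rw [he, show (σ + 2 * δ) / 2 = δ + σ / 2 by ring, wt_add, ENNReal.ofReal_mul (wt_pos _ _).le,
      enorm_mul, mul_mul_mul_comm]
    exact mul_le_mul' (hK k a ha) le_rfl
  have hn : ∀ (τ : ℝ) (u : ℝ → ℂ),
      hatNorm τ u = (∫⁻ k, ‖(wt (τ / 2) k : ℂ) * u k‖ₑ ^ 2) ^ (1 / 2 : ℝ) := fun τ u => by
    rw [hatNorm_eq_eLpNorm, eLpNorm_two_eq]
  calc hatNorm (σ + 2 * δ) (fun k => ∫ a in Ioo 0 T, K k a * Fhat k a)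
      ≤ (∫⁻ k, (C : ℝ≥0∞) ^ 2 * (∫⁻ a in Ioo 0 T, ‖(wt (σ / 2) k : ℂ) * Fhat k a‖ₑ) ^ 2)
          ^ (1 / 2 : ℝ) := by
        rw [hn]
        gcongr with k
        rw [← mul_pow]
        gcongr
        exact hpt k
    _ = C * (∫⁻ k, (∫⁻ a in Ioo 0 T, ‖(wt (σ / 2) k : ℂ) * Fhat k a‖ₑ) ^ 2) ^ (1 / 2 : ℝ) := by
        rw [lintegral_const_mul' _ _ (by finiteness), ENNReal.mul_rpow_of_nonneg _ _ (by norm_num),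
          sq_sqrt_ennreal]
    _ ≤ C * ((∫⁻ a in Ioo 0 T, (∫⁻ k, ‖(wt (σ / 2) k : ℂ) * Fhat k a‖ₑ ^ 2) ^ (1 / 2 : ℝ)) ^ 2)
          ^ (1 / 2 : ℝ) := by
        gcongr
        exact lintegral_sq_lintegral_le hm
    _ = _ := by
        rw [sq_sqrt_ennreal]
        simp_rw [hn]

/-- For `k² ≤ 1` the bound is `2T`; for `k² ≥ 1`, `1 + k² ≤ 2ω` gives 2. The sum covers both. -/
theorem wt_one_mul_abs_sinK_le {T τ : ℝ} (k : ℝ) (hτ : |τ| ≤ T) :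
    wt 1 k * |sinK k τ| ≤ 2 * T + 2 := by
  have hT : 0 ≤ T := (abs_nonneg _).trans hτ
  rw [wt_one]
  rcases le_total (k ^ 2) 1 with hk | hk
  · calc (1 + k ^ 2) * |sinK k τ| ≤ 2 * T := by
          gcongr
          · linarith
          · exact (abs_sinK_le k τ).trans hτ
      _ ≤ _ := by linarith
  · have hk0 : k ≠ 0 := by rintro rfl; norm_num at hk
    have hω := omega_pos hk0
    have h1 : 1 + k ^ 2 ≤ 2 * omega k := by
      have hs : Real.sqrt (1 + k ^ 2) ≤ 2 * |k| := by
        rw [Real.sqrt_le_left (by positivity), mul_pow, sq_abs]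
        linarith
      calc 1 + k ^ 2 = Real.sqrt (1 + k ^ 2) * Real.sqrt (1 + k ^ 2) :=
            (Real.mul_self_sqrt (by positivity)).symm
        _ ≤ 2 * |k| * Real.sqrt (1 + k ^ 2) := by gcongr
        _ = _ := by rw [omega]; ring
    calc (1 + k ^ 2) * |sinK k τ| ≤ 2 * omega k * (omega k)⁻¹ := by
          gcongr
          exact abs_sinK_le_inv k τ
      _ = 2 := by field_simp
      _ ≤ _ := by linarith

theorem hatNorm_duhamel_le {T t : ℝ} {Fhat : ℝ → ℝ → ℂ}
    (hF : Measurable (Function.uncurry Fhat)) (σ : ℝ) (ht : t ∈ Icc 0 T) :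
    hatNorm (σ + 2) (duhamel T Fhat t)
      ≤ (2 * T + 2).toNNReal * ∫⁻ a in Ioo 0 T, hatNorm σ fun k => Fhat k a := by
  refine le_trans (le_of_eq ?_) (hatNorm_setIntegral_mul_le hF (δ := 1)
    (K := fun k a => (((Iio t).indicator (fun a => sinK k (t - a)) a : ℝ) : ℂ)) ?_ σ)
  · rw [mul_one]; rfl
  · intro k a ha
    rw [← ofReal_norm, Complex.norm_real, Real.norm_eq_abs, ← ENNReal.ofReal_mul (wt_pos _ _).le]
    refine ENNReal.ofReal_le_ofReal ?_
    rw [indicator_apply]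
    have hT : 0 < T := ha.1.trans ha.2
    split_ifs with h
    · refine wt_one_mul_abs_sinK_le k ?_
      have h' : a < t := h
      rw [abs_of_pos (by linarith)]
      linarith [ha.1, ht.2]
    · simp only [abs_zero, mul_zero]
      linarith

/-- The time derivative of the Duhamel integral,
`∫_{(0,T) ∩ (-∞,t)} cos(ω(t - a)) Fhat(k, a) da`. -/
def duhamelDeriv (T : ℝ) (Fhat : ℝ → ℝ → ℂ) (t k : ℝ) : ℂ :=
  ∫ a in Ioo 0 T, (((Iio t).indicator (fun a => Real.cos (omega k * (t - a))) a : ℝ) : ℂ) * Fhat k a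

theorem abs_indicator_cos_le (k t a : ℝ) :
    |(Iio t).indicator (fun a => Real.cos (omega k * (t - a))) a| ≤ 1 := by
  rw [indicator_apply]
  split_ifs
  · exact Real.abs_cos_le_one _
  · simp

theorem measurable_indicator_cos (t : ℝ) : Measurable fun p : ℝ × ℝ =>
    (Iio t).indicator (fun a => Real.cos (omega p.2 * (t - a))) p.1 := by
  have := continuous_omega.measurable
  exact Measurable.indicator (s := {p : ℝ × ℝ | p.1 < t})
    (f := fun p : ℝ × ℝ => Real.cos (omega p.2 * (t - p.1))) (by fun_prop)
    (measurableSet_lt measurable_fst measurable_const)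

theorem measurable_duhamelDeriv {T t : ℝ} {Fhat : ℝ → ℝ → ℂ}
    (hF : Measurable (Function.uncurry Fhat)) : Measurable (duhamelDeriv T Fhat t) := by
  refine (StronglyMeasurable.integral_prod_right (f := fun (k : ℝ) (a : ℝ) =>
    (((Iio t).indicator (fun a => Real.cos (omega k * (t - a))) a : ℝ) : ℂ) * Fhat k a)
      (ν := volume.restrict (Ioo 0 T)) ?_).measurable
  refine Measurable.stronglyMeasurable (Measurable.mul ?_ hF)
  exact Complex.measurable_ofReal.comp ((measurable_indicator_cos t).comp measurable_swap)

theorem hatNorm_duhamelDeriv_le {T : ℝ} {Fhat : ℝ → ℝ → ℂ}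
    (hF : Measurable (Function.uncurry Fhat)) (σ t : ℝ) :
    hatNorm σ (duhamelDeriv T Fhat t) ≤ ∫⁻ a in Ioo 0 T, hatNorm σ fun k => Fhat k a := by
  refine le_trans (le_of_eq ?_) ((hatNorm_setIntegral_mul_le (T := T) hF (δ := 0) (C := 1)
    (K := fun k a => (((Iio t).indicator (fun a => Real.cos (omega k * (t - a))) a : ℝ) : ℂ))
    ?_ σ).trans_eq ?_)
  · rw [mul_zero, add_zero]; rfl
  · intro k a ha
    rw [wt_zero, ENNReal.ofReal_one, one_mul, ← ofReal_norm, Complex.norm_real, Real.norm_eq_abs,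
      ENNReal.coe_one]
    exact ENNReal.ofReal_le_one.2 (abs_indicator_cos_le k t a)
  · rw [ENNReal.coe_one, one_mul]

theorem exists_isFourierDensity_of_hatNorm {σ : ℝ} {u : ℝ → ℂ} (hu : Measurable u)
    (h : hatNorm σ u < ∞) : ∃ f : 𝓢'(ℝ, ℂ), IsFourierDensity f u := by
  refine exists_isFourierDensity (a := σ / 2) ⟨?_, ?_⟩
  · exact ((Complex.measurable_ofReal.comp (measurable_wt _)).mul hu).aestronglyMeasurable
  · rwa [← hatNorm_eq_eLpNorm]

/-! ### Existence of the solution and its time derivative -/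

section

variable {T σ : ℝ} {Fhat : ℝ → ℝ → ℂ}

theorem exists_isForcedSolution {F : ℝ → 𝓢'(ℝ, ℂ)} (hF : IsSpatialFourier T F Fhat)
    (hN : ∫⁻ a in Ioo 0 T, hatNorm σ (fun k => Fhat k a) < ∞) :
    ∃ Z : ℝ → 𝓢'(ℝ, ℂ), IsForcedSolution T F Z := by
  have h : ∀ t, ∃ f : 𝓢'(ℝ, ℂ), t ∈ Icc 0 T → IsFourierDensity f (solutionHat Fhat t) := fun t => by
    by_cases ht : t ∈ Icc 0 T
    · obtain ⟨f, hf⟩ := exists_isFourierDensity_of_hatNorm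
        ((measurable_duhamel (T := T) hF.1).comp measurable_prodMk_left)
        ((hatNorm_duhamel_le hF.1 σ ht).trans_lt (ENNReal.mul_lt_top ENNReal.coe_lt_top hN))
      refine ⟨f, fun _ => hf.congr_ae ?_⟩
      filter_upwards [ae_integrableOn hF.1 hN] with k hk
      exact (solutionHat_eq_duhamel ht hk).symm
    · exact ⟨0, fun h => absurd h ht⟩
  choose Z hZ using h
  exact ⟨Z, Fhat, hF, hZ⟩

theorem integrable_mul_schwartz (hF : Measurable (Function.uncurry Fhat))
    (hN : ∫⁻ a in Ioo 0 T, hatNorm σ (fun k => Fhat k a) < ∞) (φ : 𝓢(ℝ, ℂ)) :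
    Integrable (fun p : ℝ × ℝ => Fhat p.2 p.1 * φ p.2)
      ((volume.restrict (Ioo 0 T)).prod volume) := by
  have hm : Measurable fun p : ℝ × ℝ => Fhat p.2 p.1 * φ p.2 :=
    (hF.comp measurable_swap).mul (φ.continuous.measurable.comp measurable_snd)
  refine ⟨hm.aestronglyMeasurable, ?_⟩
  rw [HasFiniteIntegral, lintegral_prod_symm _ hm.enorm.aemeasurable]
  refine lt_of_le_of_lt (le_of_eq ?_) (lintegral_mul_schwartz_lt_top hF hN φ)
  refine lintegral_congr fun k => ?_
  simp_rw [enorm_mul]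
  exact lintegral_mul_const' _ _ enorm_ne_top

theorem integral_kernel_mul {K : ℝ × ℝ → ℝ} (φ : 𝓢(ℝ, ℂ))
    (hK : Integrable (fun p : ℝ × ℝ => (K p : ℂ) * (Fhat p.2 p.1 * φ p.2))
      ((volume.restrict (Ioo 0 T)).prod volume)) :
    ∫ p, (K p : ℂ) * (Fhat p.2 p.1 * φ p.2) ∂((volume.restrict (Ioo 0 T)).prod volume)
      = ∫ k, (∫ a in Ioo 0 T, (K (a, k) : ℂ) * Fhat k a) * φ k := by
  rw [integral_prod_symm _ hK]
  congr 1
  ext k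
  rw [← integral_mul_const]
  simp_rw [mul_assoc]

theorem hasDerivAt_sinK {k : ℝ} (hk : k ≠ 0) (τ : ℝ) :
    HasDerivAt (sinK k) (Real.cos (omega k * τ)) τ := by
  have h := ((hasDerivAt_id τ).const_mul (omega k)).sin.div_const (omega k)
  refine h.congr_deriv ?_
  have := (omega_pos hk).ne'
  field_simp
  simp

theorem abs_sinK_sub_le (k x y : ℝ) : |sinK k x - sinK k y| ≤ |x - y| := by
  by_cases hk : k = 0
  · simp [sinK, hk, omega]
  have h := omega_pos hk
  rw [sinK, sinK, ← sub_div, abs_div, abs_of_pos h, div_le_iff₀ h]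
  refine (Real.abs_sin_sub_sin_le _ _).trans_eq ?_
  rw [← mul_sub, abs_mul, abs_of_pos h, mul_comm]

/-- Since `sinK k 0 = 0`, cutting off at `a = t` creates no jump. In this form the kernel is
Lipschitz in `t` with constant 1, uniformly in `a` and `k`. -/
theorem indicator_sinK_eq (k t a : ℝ) :
    (Iio t).indicator (fun a => sinK k (t - a)) a = sinK k (max (t - a) 0) := by
  rcases lt_or_ge a t with h | h
  · rw [indicator_of_mem (show a ∈ Iio t from h), max_eq_left (by linarith)]
  · rw [indicator_of_notMem (show a ∉ Iio t from not_lt.2 h), max_eq_right (by linarith)]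
    simp [sinK]

theorem hasDerivAt_sinK_max {k a t : ℝ} (hk : k ≠ 0) (hat : a ≠ t) :
    HasDerivAt (fun τ => sinK k (max (τ - a) 0))
      ((Iio t).indicator (fun a => Real.cos (omega k * (t - a))) a) t := by
  rcases lt_or_gt_of_ne hat with h | h
  · rw [indicator_of_mem (show a ∈ Iio t from h)]
    refine HasDerivAt.congr_of_eventuallyEq (f := fun τ => sinK k (τ - a))
      ((hasDerivAt_sinK hk (t - a)).comp_sub_const t a) ?_
    filter_upwards [lt_mem_nhds h] with τ hτ
    rw [max_eq_left (by linarith)]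
  · rw [indicator_of_notMem (show a ∉ Iio t from not_lt.2 h.le)]
    refine (hasDerivAt_const t (sinK k 0)).congr_of_eventuallyEq ?_
    filter_upwards [gt_mem_nhds h] with τ hτ
    rw [max_eq_right (by linarith)]

theorem integrable_sinK_mul (hF : Measurable (Function.uncurry Fhat))
    (hN : ∫⁻ a in Ioo 0 T, hatNorm σ (fun k => Fhat k a) < ∞) (φ : 𝓢(ℝ, ℂ)) (τ : ℝ) :
    Integrable (fun p : ℝ × ℝ => (sinK p.2 (max (τ - p.1) 0) : ℂ) * (Fhat p.2 p.1 * φ p.2))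
      ((volume.restrict (Ioo 0 T)).prod volume) := by
  refine (integrable_mul_schwartz hF hN φ).bdd_mul (c := |τ|) ?_ ?_
  · refine (Complex.measurable_ofReal.comp ?_).aestronglyMeasurable
    exact measurable_sinK.comp (g := fun p : ℝ × ℝ => sinK p.1 p.2)
      (f := fun p : ℝ × ℝ => (p.2, max (τ - p.1) 0)) (by fun_prop)
  · have h0 : ∀ᵐ a ∂(volume.restrict (Ioo 0 T)), a ∈ Ioo 0 T := ae_restrict_mem measurableSet_Ioo
    filter_upwards [(Measure.quasiMeasurePreserving_fst (ν := (volume : Measure ℝ))).ae h0] with p hp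
    rw [Complex.norm_real, Real.norm_eq_abs]
    refine (abs_sinK_le _ _).trans ?_
    rw [abs_of_nonneg (le_max_right _ _)]
    exact max_le ((by linarith [hp.1] : τ - p.1 ≤ τ).trans (le_abs_self _)) (abs_nonneg _)

/-- Differentiation under the integral with `‖Fhat k a * φ k‖` as Lipschitz bound. The kernel is
differentiable in time except where `a = t` or `k = 0`, a null set; no continuity of the forcing in
time is needed. -/
theorem hasDerivAt_integral_sinK_mul (hF : Measurable (Function.uncurry Fhat))
    (hN : ∫⁻ a in Ioo 0 T, hatNorm σ (fun k => Fhat k a) < ∞) (φ : 𝓢(ℝ, ℂ)) (t : ℝ) :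
    HasDerivAt (fun τ => ∫ k, duhamel T Fhat τ k * φ k) (∫ k, duhamelDeriv T Fhat t k * φ k) t := by
  set μ := (volume.restrict (Ioo (0 : ℝ) T)).prod (volume : Measure ℝ) with hμ
  have h0 : ∀ᵐ a ∂(volume.restrict (Ioo 0 T)), a ≠ t :=
    ae_restrict_of_ae (Measure.ae_ne volume t)
  have h1 : ∀ᵐ p ∂μ, p.1 ≠ t :=
    (Measure.quasiMeasurePreserving_fst (ν := (volume : Measure ℝ))).ae h0
  have h2 : ∀ᵐ p ∂μ, p.2 ≠ 0 :=
    (Measure.quasiMeasurePreserving_snd (μ := volume.restrict (Ioo (0 : ℝ) T))).ae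
      (Measure.ae_ne (volume : Measure ℝ) 0)
  have hbase := integrable_mul_schwartz hF hN φ
  obtain ⟨hint, hder⟩ := hasDerivAt_integral_of_dominated_loc_of_lip (μ := μ) (s := univ)
    (F := fun τ (p : ℝ × ℝ) => (sinK p.2 (max (τ - p.1) 0) : ℂ) * (Fhat p.2 p.1 * φ p.2))
    (F' := fun p : ℝ × ℝ =>
      (((Iio t).indicator (fun a => Real.cos (omega p.2 * (t - a))) p.1 : ℝ) : ℂ)
        * (Fhat p.2 p.1 * φ p.2))
    (bound := fun p : ℝ × ℝ => ‖Fhat p.2 p.1 * φ p.2‖) (x₀ := t) Filter.univ_mem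
    (Filter.Eventually.of_forall fun τ => (integrable_sinK_mul hF hN φ τ).aestronglyMeasurable)
    (integrable_sinK_mul hF hN φ t)
    ((Complex.measurable_ofReal.comp (measurable_indicator_cos t)).aestronglyMeasurable.mul
      hbase.aestronglyMeasurable)
    (Filter.Eventually.of_forall fun p => LipschitzOnWith.of_dist_le_mul fun x _ y _ => by
      rw [dist_eq_norm, dist_eq_norm, ← sub_mul, norm_mul, ← Complex.ofReal_sub, Complex.norm_real,
        mul_comm, Real.coe_nnabs, abs_norm]
      gcongr
      refine (abs_sinK_sub_le _ _ _).trans ((abs_max_sub_max_le_abs _ _ _).trans_eq ?_)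
      rw [Real.norm_eq_abs, sub_sub_sub_cancel_right])
    hbase.norm (by
      filter_upwards [h1, h2] with p hp1 hp2
      exact (hasDerivAt_sinK_max hp2 hp1).ofReal_comp.mul_const _)
  rw [integral_kernel_mul φ hint] at hder
  refine hder.congr_of_eventuallyEq (Filter.Eventually.of_forall fun τ => ?_)
  have := integral_kernel_mul φ (integrable_sinK_mul hF hN φ τ)
  simp only [duhamel, indicator_sinK_eq]
  exact this.symm

theorem exists_isTimeDerivative {Z : ℝ → 𝓢'(ℝ, ℂ)}
    (hZ : ∀ t ∈ Icc 0 T, IsFourierDensity (Z t) (solutionHat Fhat t))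
    (hF : Measurable (Function.uncurry Fhat))
    (hN : ∫⁻ a in Ioo 0 T, hatNorm σ (fun k => Fhat k a) < ∞) :
    ∃ Z' : ℝ → 𝓢'(ℝ, ℂ), IsTimeDerivative T Z Z' ∧
      ∀ t, IsFourierDensity (Z' t) (duhamelDeriv T Fhat t) := by
  choose Z' hZ' using fun t => exists_isFourierDensity_of_hatNorm
    (measurable_duhamelDeriv (T := T) (t := t) hF) ((hatNorm_duhamelDeriv_le hF σ t).trans_lt hN)
  refine ⟨Z', fun t ht ψ => ?_, hZ'⟩
  rw [(hZ' t).apply_eq]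
  refine (hasDerivAt_integral_sinK_mul hF hN (fourierSchwartzInv ψ) t).hasDerivWithinAt.congr
    (fun τ hτ => (hZ τ hτ).apply_eq_duhamel hτ hF hN ψ) ((hZ t ht).apply_eq_duhamel ht hF hN ψ)

theorem IsTimeDerivative.unique {Z Z₁ Z₂ : ℝ → 𝓢'(ℝ, ℂ)} (hT : 0 < T)
    (h₁ : IsTimeDerivative T Z Z₁) (h₂ : IsTimeDerivative T Z Z₂) {t : ℝ} (ht : t ∈ Icc 0 T) :
    Z₁ t = Z₂ t :=
  DFunLike.ext _ _ fun ψ =>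
    (uniqueDiffOn_Icc hT t ht).eq_deriv _ (h₁ t ht ψ) (h₂ t ht ψ)

theorem space_estimate {Z Z' : ℝ → 𝓢'(ℝ, ℂ)} (hT : 0 < T)
    (hZ : ∀ t ∈ Icc 0 T, IsFourierDensity (Z t) (solutionHat Fhat t))
    (hF : Measurable (Function.uncurry Fhat))
    (hN : ∫⁻ a in Ioo 0 T, hatNorm σ (fun k => Fhat k a) < ∞)
    (hZ' : IsTimeDerivative T Z Z') {t : ℝ} (ht : t ∈ Icc 0 T) :
    sobolevENorm (σ + 2) (Z t) + sobolevENorm σ (Z' t)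
      ≤ ((2 * T + 2).toNNReal + 1 : ℝ≥0) * ∫⁻ a in Ioo 0 T, hatNorm σ fun k => Fhat k a := by
  obtain ⟨W, hW, hWd⟩ := exists_isTimeDerivative hZ hF hN
  have hd : IsFourierDensity (Z t) (duhamel T Fhat t) := (hZ t ht).congr_ae (by
    filter_upwards [ae_integrableOn hF hN] with k hk
    exact solutionHat_eq_duhamel ht hk)
  have e : ∀ {f : 𝓢'(ℝ, ℂ)} {u : ℝ → ℂ} (τ : ℝ), IsFourierDensity f u →
      sobolevENorm τ f = hatNorm τ u := fun τ hf => by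
    rw [sobolevENorm_eq hf, hatNorm_eq_eLpNorm]
    rfl
  rw [hZ'.unique hT hW ht, e _ hd, e _ (hWd t), ENNReal.coe_add, add_mul, ENNReal.coe_one, one_mul]
  exact add_le_add (hatNorm_duhamel_le hF σ ht) (hatNorm_duhamelDeriv_le hF σ t)

end

/-! ### The time estimates -/

theorem exists_time_estimate_one (j : ℕ) {s T : ℝ} (hT : 0 < T)
    (h1 : -1 / 2 + j ≤ s) (h2 : s ≤ 3 / 2 + j) :
    ∃ C : ℝ≥0, ∀ F Z : ℝ → 𝓢'(ℝ, ℂ), bochnerENorm 1 (s - 2) T F < ∞ → IsForcedSolution T F Z →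
      (∃ v, IsTimeTrace j T Z v) ∧ ∀ v, IsTimeTrace j T Z v → ∀ x,
        sobolevENormOn ((2 * s - 2 * j + 1) / 4) T (v x) ≤ C * bochnerENorm 1 (s - 2) T F := by
  obtain ⟨c⟩ := nonempty_cutoff T
  obtain ⟨C, hC⟩ := exists_pairing_bound_one c hT j (s := s) (m := (2 * s - 2 * j + 1) / 4)
    ⟨by linarith, by linarith⟩ (by ring)
  refine ⟨C, fun F Z hB ⟨Fhat, hF, hZ⟩ => ?_⟩
  have hN := hB
  rw [hF.bochnerENorm_one] at hN
  -- A finite norm is needed so that the constant of `TraceBound`, and with it the Riesz bound, is a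
  -- real number.
  lift bochnerENorm 1 (s - 2) T F to ℝ≥0 using hB.ne with B hBe
  have hb : TraceBound c j ((2 * s - 2 * j + 1) / 4) Fhat (C * B) := fun f hf => by
    rw [ENNReal.coe_mul, hBe, hF.bochnerENorm_one]
    exact hC Fhat hF.1 f hf
  rw [← ENNReal.coe_mul]
  exact ⟨hb.exists_isTimeTrace (by linarith) hZ hF.1 hN,
    fun v hv x => hb.sobolevENormOn_le hZ hF.1 hN hv x⟩

theorem exists_time_estimate_two (j : ℕ) {s T : ℝ} (hT : 0 < T)
    (h1 : 3 / 2 + j ≤ s) (h2 : s ≤ 7 / 2 + j) :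
    ∃ C : ℝ≥0, ∀ F Z : ℝ → 𝓢'(ℝ, ℂ), bochnerENorm 2 (s - 2) T F < ∞ → IsForcedSolution T F Z →
      (∃ v, IsTimeTrace j T Z v) ∧ ∀ v, IsTimeTrace j T Z v → ∀ x,
        sobolevENormOn ((2 * s - 2 * j + 1) / 4) T (v x) ≤ C * bochnerENorm 2 (s - 2) T F := by
  obtain ⟨c⟩ := nonempty_cutoff T
  obtain ⟨C, hC⟩ := exists_pairing_bound_two c hT j (s := s) (m := (2 * s - 2 * j + 1) / 4)
    ⟨by linarith, by linarith⟩ (by ring)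
  refine ⟨C, fun F Z hB ⟨Fhat, hF, hZ⟩ => ?_⟩
  have hN := hF.lintegral_hatNorm_lt_top_of_two hB
  lift bochnerENorm 2 (s - 2) T F to ℝ≥0 using hB.ne with B hBe
  have hb : TraceBound c j ((2 * s - 2 * j + 1) / 4) Fhat (C * B) := fun f hf => by
    rw [ENNReal.coe_mul, hBe, hF.bochnerENorm_two]
    exact hC Fhat hF.1 f hf
  rw [← ENNReal.coe_mul]
  exact ⟨hb.exists_isTimeTrace (by linarith) hZ hF.1 hN,
    fun v hv x => hb.sobolevENormOn_le hZ hF.1 hN hv x⟩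

end Boussinesq

end

/-! ### The theorem -/

theorem theorem3p2 :
    -- the space estimate
    (∀ T : ℝ, 0 < T → ∃ c : ℝ≥0, ∀ (s : ℝ) (F : ℝ → 𝓢'(ℝ, ℂ)),
      Boussinesq.MemBochner 1 (s - 2) T F →
        (∃ Z : ℝ → 𝓢'(ℝ, ℂ), Boussinesq.IsForcedSolution T F Z) ∧
        ∀ Z : ℝ → 𝓢'(ℝ, ℂ), Boussinesq.IsForcedSolution T F Z →
          (∃ Z' : ℝ → 𝓢'(ℝ, ℂ), Boussinesq.IsTimeDerivative T Z Z') ∧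
          ∀ Z' : ℝ → 𝓢'(ℝ, ℂ), Boussinesq.IsTimeDerivative T Z Z' →
            ∀ t ∈ Set.Icc 0 T,
              Boussinesq.sobolevENorm s (Z t) + Boussinesq.sobolevENorm (s - 2) (Z' t)
                ≤ c * Boussinesq.bochnerENorm 1 (s - 2) T F) ∧
    -- the time estimates
    (∀ (j : ℕ) (s T : ℝ), 0 < T → ∃ c : ℝ≥0,
      (-1 / 2 + j ≤ s → s ≤ 3 / 2 + j → ∀ F : ℝ → 𝓢'(ℝ, ℂ),
        Boussinesq.MemBochner 1 (s - 2) T F →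
        (∃ Z : ℝ → 𝓢'(ℝ, ℂ), Boussinesq.IsForcedSolution T F Z) ∧
        ∀ Z : ℝ → 𝓢'(ℝ, ℂ), Boussinesq.IsForcedSolution T F Z →
          (∃ v : ℝ → ℝ → ℂ, Boussinesq.IsTimeTrace j T Z v) ∧
          ∀ v : ℝ → ℝ → ℂ, Boussinesq.IsTimeTrace j T Z v → ∀ x : ℝ,
            Boussinesq.sobolevENormOn ((2 * s - 2 * j + 1) / 4) T (v x)
              ≤ c * Boussinesq.bochnerENorm 1 (s - 2) T F) ∧
      (3 / 2 + j ≤ s → s ≤ 7 / 2 + j → ∀ F : ℝ → 𝓢'(ℝ, ℂ),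
        Boussinesq.MemBochner 2 (s - 2) T F →
        (∃ Z : ℝ → 𝓢'(ℝ, ℂ), Boussinesq.IsForcedSolution T F Z) ∧
        ∀ Z : ℝ → 𝓢'(ℝ, ℂ), Boussinesq.IsForcedSolution T F Z →
          (∃ v : ℝ → ℝ → ℂ, Boussinesq.IsTimeTrace j T Z v) ∧
          ∀ v : ℝ → ℝ → ℂ, Boussinesq.IsTimeTrace j T Z v → ∀ x : ℝ,
            Boussinesq.sobolevENormOn ((2 * s - 2 * j + 1) / 4) T (v x)
              ≤ c * Boussinesq.bochnerENorm 2 (s - 2) T F)) := by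
  refine ⟨fun T hT => ⟨(2 * T + 2).toNNReal + 1, fun s F hF => ?_⟩, fun j s T hT => ?_⟩
  · obtain ⟨⟨Fhat, hFhat⟩, hB⟩ := hF
    refine ⟨Boussinesq.exists_isForcedSolution hFhat (by rwa [← hFhat.bochnerENorm_one]), ?_⟩
    rintro Z ⟨Ghat, hG, hZ⟩
    have hN := hB
    -- The transform `Ghat` that comes with `Z` need not be the chosen `Fhat`, but the norm of `F`
    -- can be computed from either.
    rw [hG.bochnerENorm_one] at hN
    refine ⟨(Boussinesq.exists_isTimeDerivative hZ hG.1 hN).imp fun _ h => h.1,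
      fun Z' hZ' t ht => ?_⟩
    have h := Boussinesq.space_estimate hT hZ hG.1 hN hZ' ht
    rwa [sub_add_cancel, ← hG.bochnerENorm_one] at h
  -- The constant has to be fixed before `s` is known to lie in the range; outside the range 0 will
  -- do. The final constant is the sum of those for the two ranges.
  · have key : ∀ {p : ℝ≥0∞} {P : Prop}, (P → ∃ C : ℝ≥0, ∀ F Z : ℝ → 𝓢'(ℝ, ℂ),
        Boussinesq.bochnerENorm p (s - 2) T F < ∞ → Boussinesq.IsForcedSolution T F Z →
        (∃ v, Boussinesq.IsTimeTrace j T Z v) ∧ ∀ v, Boussinesq.IsTimeTrace j T Z v → ∀ x,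
          Boussinesq.sobolevENormOn ((2 * s - 2 * j + 1) / 4) T (v x)
            ≤ C * Boussinesq.bochnerENorm p (s - 2) T F) →
        ∃ C : ℝ≥0, P → ∀ F Z : ℝ → 𝓢'(ℝ, ℂ),
        Boussinesq.bochnerENorm p (s - 2) T F < ∞ → Boussinesq.IsForcedSolution T F Z →
        (∃ v, Boussinesq.IsTimeTrace j T Z v) ∧ ∀ v, Boussinesq.IsTimeTrace j T Z v → ∀ x,
          Boussinesq.sobolevENormOn ((2 * s - 2 * j + 1) / 4) T (v x)
            ≤ C * Boussinesq.bochnerENorm p (s - 2) T F := by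
      intro p P h
      by_cases hP : P
      · obtain ⟨C, hC⟩ := h hP
        exact ⟨C, fun _ => hC⟩
      · exact ⟨0, fun h => absurd h hP⟩
    obtain ⟨C₁, h₁⟩ := key (P := -1 / 2 + (j : ℝ) ≤ s ∧ s ≤ 3 / 2 + j)
      fun h => Boussinesq.exists_time_estimate_one j hT h.1 h.2
    obtain ⟨C₂, h₂⟩ := key (P := 3 / 2 + (j : ℝ) ≤ s ∧ s ≤ 7 / 2 + j)
      fun h => Boussinesq.exists_time_estimate_two j hT h.1 h.2
    refine ⟨C₁ + C₂, fun hs hs' F ⟨⟨Fhat, hFhat⟩, hB⟩ => ⟨?_, fun Z hZ => ?_⟩,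
      fun hs hs' F ⟨⟨Fhat, hFhat⟩, hB⟩ => ⟨?_, fun Z hZ => ?_⟩⟩
    · exact Boussinesq.exists_isForcedSolution hFhat (by rwa [← hFhat.bochnerENorm_one])
    · obtain ⟨hv, hle⟩ := h₁ ⟨hs, hs'⟩ F Z hB hZ
      refine ⟨hv, fun v hv x => (hle v hv x).trans ?_⟩
      gcongr
      exact le_self_add
    · exact Boussinesq.exists_isForcedSolution hFhat (hFhat.lintegral_hatNorm_lt_top_of_two hB)
    · obtain ⟨hv, hle⟩ := h₂ ⟨hs, hs'⟩ F Z hB hZ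
      refine ⟨hv, fun v hv x => (hle v hv x).trans ?_⟩
      gcongr
      exact le_add_self
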